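/- A tropical plane curve is a finite metric graph $\Gamma\subset\mathbb R^2$, possibly with unbounded edges, with straight edges of rational slope (edge lengths are lattice lengths) carrying positive integer weights $w_e$, balanced at every vertex: the weighted sum of the outgoing primitive integral vectors is $0$. It is dual to a regular subdivision of a lattice polygon (its subdivided Newton polygon): the curve is the locus where the maximum of a tropical polynomial is attained at least twice, its vertices correspond to the two-dimensional faces, its edges to the edges of the subdivision, and $w_e$ is the lattice length of the edge dual to $e$. The curve has degree $d$ if its Newton polygon is the standard triangle with vertices $(0,0),(d,0),(0,d)$; a tropical line has degree $1$, a tropical plane quartic degree $4$. The weight $w_v$ of a vertex $v$ is the number of lattice points in the interior of its dual face. Fix $\varepsilon>0$. The paired metric graph $\Sigma$ of $\Gamma$ is obtained from $\Gamma$ by replacing every edge $e$ by $w_e$ edges of the same length (an unbounded edge by $w_e$ separate unbounded edges) and attaching $w_v$ loops of length $\varepsilon$ at every vertex $v$; $\phi:\Sigma\to\Gamma$ is the map that collapses the loops and the multiple edges. Every unbounded edge of $\Gamma$ and of $\Sigma$ is completed by a $1$-valent point at infinity. A rational function on $\Sigma$ is a continuous piecewise linear function with integer slopes and finitely many pieces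 (allowed to be infinite at points at infinity); its divisor has at each point the sum of the incoming slopes as coefficient. Such divisors are called principal and form the group $\operatorname{Prin}(\Sigma)$; two divisors are linearly equivalent if their difference is principal. The canonical divisor is $K_\Sigma=\sum_p(\operatorname{val}(p)-2)\,p$. Let $\phi_*:\operatorname{Div}(\Sigma)\to\operatorname{Div}(\Gamma)$ be the push-forward, $K_\Gamma=\phi_*K_\Sigma$ and $\operatorname{Pic}(\Sigma,\Gamma)=\operatorname{Div}(\Gamma)/\phi_*(\operatorname{Prin}(\Sigma))$. For a tropical line $\Lambda$, the line section $\Lambda\cdot\Gamma\in\operatorname{Div}(\Gamma)$ is the stable intersection: the limit, as $t\to0^+$, of the intersections of $\Gamma$ with $\Lambda+tv$, counted with multiplicities $w_ew_{e'}|\det(u_e,u_{e'})|$ (where $u_e,u_{e'}$ are primitive direction vectors), for any direction $v$ such that $\Gamma$ and $\Lambda+tv$ meet properly for all small $t>0$. The pullback of $\Lambda\cdot\Gamma$ to $\Sigma$ is the divisor $L$ with $\phi_*L=\Lambda\cdot\Gamma$ that is supported away from the interiors of the loops and in which the chips at a point of an edge of weight $w_e$ are distributed evenly over the $w_e$ corresponding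 points of $\Sigma$. **Proposition.** Let $\Gamma$ be a tropical plane quartic and $\Lambda$ a tropical line. Then the line section $\Lambda\cdot\Gamma$ is well defined and has a unique pullback $L$ to the paired metric graph $\Sigma$. The divisor $L$ is linearly equivalent to the canonical divisor $K_\Sigma$. Consequently, $\Lambda\cdot\Gamma$ and $K_\Gamma$ have the same class in $\operatorname{Pic}(\Sigma,\Gamma)$. -/

import Mathlib

open Filter Topology

noncomputable section

/-! ## Metric graphs, divisors and linear equivalence -/

/-- A finite metric graph, possibly with unbounded edges.  `E` is the set of bounded edges, each
with a length and (arbitrarily chosen) orientation; loops and multiple edges are allowed.  `R` is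
the set of unbounded edges, each emanating from a vertex. -/
structure MetricGraph where
  V : Type
  E : Type
  R : Type
  [fintypeV : Fintype V]
  [fintypeE : Fintype E]
  [fintypeR : Fintype R]
  src : E → V
  tgt : E → V
  len : E → ℝ
  len_pos : ∀ e, 0 < len e
  root : R → V

attribute [instance] MetricGraph.fintypeV MetricGraph.fintypeE MetricGraph.fintypeR

namespace MetricGraph

/-- The points of a metric graph: vertices, interior points of bounded edges (at distance `t` from
the source), points of unbounded edges (at distance `t` from the root), and, as usual for graphs
with unbounded edges, one 1-valent point at infinity at the end of every unbounded edge. -/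
inductive Point (G : MetricGraph) : Type
  | vertex (v : G.V) : Point G
  | inEdge (e : G.E) (t : Set.Ioo (0 : ℝ) (G.len e)) : Point G
  | inRay (r : G.R) (t : Set.Ioi (0 : ℝ)) : Point G
  | infty (r : G.R) : Point G

/-- The divisor group: the free abelian group on the points. -/
abbrev Divisor (G : MetricGraph) : Type := G.Point →₀ ℤ

open Classical in
/-- The valency of a vertex: the number of edge ends at it (a loop counts twice). -/
def valency (G : MetricGraph) (v : G.V) : ℕ :=
  (∑ e : G.E, if G.src e = v then 1 else 0) + (∑ e : G.E, if G.tgt e = v then 1 else 0)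
    + ∑ r : G.R, if G.root r = v then 1 else 0

/-- The canonical divisor `∑ (val p - 2) p`.  Interior points of edges are 2-valent and do not
contribute, points at infinity are 1-valent. -/
def canonical (G : MetricGraph) : G.Divisor :=
  (∑ v : G.V, Finsupp.single (Point.vertex v) ((G.valency v : ℤ) - 2))
    + ∑ r : G.R, Finsupp.single (Point.infty r) ((1 : ℤ) - 2)

/-- `g` is linear with slope `s` on some interval `[t, t + δ)`. -/
def HasRightSlope (g : ℝ → ℝ) (t : ℝ) (s : ℤ) : Prop :=
  ∀ᶠ h in 𝓝[>] (0 : ℝ), g (t + h) = g t + s * h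

/-- On some interval `(t - δ, t]`, the function `g` is linear, with slope `s` in the direction
leaving `t`. -/
def HasLeftSlope (g : ℝ → ℝ) (t : ℝ) (s : ℤ) : Prop :=
  ∀ᶠ h in 𝓝[>] (0 : ℝ), g (t - h) = g t + s * h

/-- A rational function: a continuous piecewise linear function with integer slopes (and finitely
many pieces), recorded with its slopes in the directions leaving each point.  Only the values of
`onEdge e` on `[0, len e]` and of `onRay r` on `[0, ∞)` matter.  Having a one-sided integer slope
at every point on either side is, on a compact interval, the same as being continuous and
piecewise linear with finitely many pieces of integer slope; on an unbounded edge one adds that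
the function is eventually linear. -/
structure RationalFunction (G : MetricGraph) where
  onVertex : G.V → ℝ
  onEdge : G.E → ℝ → ℝ
  onRay : G.R → ℝ → ℝ
  /-- slope leaving the point at `t` of an edge in the direction of the target -/
  edgeRight : G.E → ℝ → ℤ
  /-- slope leaving the point at `t` of an edge in the direction of the source -/
  edgeLeft : G.E → ℝ → ℤ
  /-- slope leaving the point at `t` of an unbounded edge in the direction of infinity -/
  rayRight : G.R → ℝ → ℤ
  /-- slope leaving the point at `t` of an unbounded edge in the direction of the root -/
  rayLeft : G.R → ℝ → ℤ
  /-- slope, in the direction of infinity, near the point at infinity of an unbounded edge -/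
  rayEnd : G.R → ℤ
  onEdge_src : ∀ e, onEdge e 0 = onVertex (G.src e)
  onEdge_tgt : ∀ e, onEdge e (G.len e) = onVertex (G.tgt e)
  onRay_root : ∀ r, onRay r 0 = onVertex (G.root r)
  edgeRight_spec : ∀ e, ∀ t ∈ Set.Ico 0 (G.len e), HasRightSlope (onEdge e) t (edgeRight e t)
  edgeLeft_spec : ∀ e, ∀ t ∈ Set.Ioc 0 (G.len e), HasLeftSlope (onEdge e) t (edgeLeft e t)
  rayRight_spec : ∀ r, ∀ t ∈ Set.Ici (0 : ℝ), HasRightSlope (onRay r) t (rayRight r t)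
  rayLeft_spec : ∀ r, ∀ t ∈ Set.Ioi (0 : ℝ), HasLeftSlope (onRay r) t (rayLeft r t)
  rayEnd_spec : ∀ r, ∃ T : ℝ, 0 ≤ T ∧ ∀ t, T ≤ t → onRay r t = onRay r T + rayEnd r * (t - T)

namespace RationalFunction

variable {G : MetricGraph}

open Classical in
/-- The order of a rational function at a point: the sum of the incoming slopes, that is, minus
the sum of the outgoing ones. -/
def ord (f : G.RationalFunction) : G.Point → ℤ
  | .vertex v => -((∑ e : G.E, if G.src e = v then f.edgeRight e 0 else 0)
      + (∑ e : G.E, if G.tgt e = v then f.edgeLeft e (G.len e) else 0)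
      + ∑ r : G.R, if G.root r = v then f.rayRight r 0 else 0)
  | .inEdge e t => -(f.edgeRight e t + f.edgeLeft e t)
  | .inRay r t => -(f.rayRight r t + f.rayLeft r t)
  | .infty r => f.rayEnd r

/-- The zero function. -/
def zero (G : MetricGraph) : G.RationalFunction where
  onVertex _ := 0
  onEdge _ _ := 0
  onRay _ _ := 0
  edgeRight _ _ := 0
  edgeLeft _ _ := 0
  rayRight _ _ := 0
  rayLeft _ _ := 0
  rayEnd _ := 0
  onEdge_src _ := rfl
  onEdge_tgt _ := rfl
  onRay_root _ := rfl
  edgeRight_spec _ _ _ := by simp [HasRightSlope]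
  edgeLeft_spec _ _ _ := by simp [HasLeftSlope]
  rayRight_spec _ _ _ := by simp [HasRightSlope]
  rayLeft_spec _ _ _ := by simp [HasLeftSlope]
  rayEnd_spec _ := ⟨0, le_rfl, by simp⟩

/-- The sum of two rational functions. -/
def add (f g : G.RationalFunction) : G.RationalFunction where
  onVertex v := f.onVertex v + g.onVertex v
  onEdge e t := f.onEdge e t + g.onEdge e t
  onRay r t := f.onRay r t + g.onRay r t
  edgeRight e t := f.edgeRight e t + g.edgeRight e t
  edgeLeft e t := f.edgeLeft e t + g.edgeLeft e t
  rayRight r t := f.rayRight r t + g.rayRight r t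
  rayLeft r t := f.rayLeft r t + g.rayLeft r t
  rayEnd r := f.rayEnd r + g.rayEnd r
  onEdge_src e := by rw [f.onEdge_src, g.onEdge_src]
  onEdge_tgt e := by rw [f.onEdge_tgt, g.onEdge_tgt]
  onRay_root r := by rw [f.onRay_root, g.onRay_root]
  edgeRight_spec e t ht := by
    filter_upwards [f.edgeRight_spec e t ht, g.edgeRight_spec e t ht] with h h1 h2
    rw [h1, h2]; push_cast; ring
  edgeLeft_spec e t ht := by
    filter_upwards [f.edgeLeft_spec e t ht, g.edgeLeft_spec e t ht] with h h1 h2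
    rw [h1, h2]; push_cast; ring
  rayRight_spec r t ht := by
    filter_upwards [f.rayRight_spec r t ht, g.rayRight_spec r t ht] with h h1 h2
    rw [h1, h2]; push_cast; ring
  rayLeft_spec r t ht := by
    filter_upwards [f.rayLeft_spec r t ht, g.rayLeft_spec r t ht] with h h1 h2
    rw [h1, h2]; push_cast; ring
  rayEnd_spec r := by
    obtain ⟨T, hT, h1⟩ := f.rayEnd_spec r
    obtain ⟨S, hS, h2⟩ := g.rayEnd_spec r
    refine ⟨max T S, le_max_of_le_left hT, fun t ht => ?_⟩
    rw [h1 t ((le_max_left _ _).trans ht), h2 t ((le_max_right _ _).trans ht),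
      h1 _ (le_max_left _ _), h2 _ (le_max_right _ _)]
    push_cast; ring

/-- The negative of a rational function. -/
def neg (f : G.RationalFunction) : G.RationalFunction where
  onVertex v := -f.onVertex v
  onEdge e t := -f.onEdge e t
  onRay r t := -f.onRay r t
  edgeRight e t := -f.edgeRight e t
  edgeLeft e t := -f.edgeLeft e t
  rayRight r t := -f.rayRight r t
  rayLeft r t := -f.rayLeft r t
  rayEnd r := -f.rayEnd r
  onEdge_src e := by rw [f.onEdge_src]
  onEdge_tgt e := by rw [f.onEdge_tgt]
  onRay_root r := by rw [f.onRay_root]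
  edgeRight_spec e t ht := by
    filter_upwards [f.edgeRight_spec e t ht] with h h1
    rw [h1]; push_cast; ring
  edgeLeft_spec e t ht := by
    filter_upwards [f.edgeLeft_spec e t ht] with h h1
    rw [h1]; push_cast; ring
  rayRight_spec r t ht := by
    filter_upwards [f.rayRight_spec r t ht] with h h1
    rw [h1]; push_cast; ring
  rayLeft_spec r t ht := by
    filter_upwards [f.rayLeft_spec r t ht] with h h1
    rw [h1]; push_cast; ring
  rayEnd_spec r := by
    obtain ⟨T, hT, h1⟩ := f.rayEnd_spec r
    refine ⟨T, hT, fun t ht => ?_⟩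
    rw [h1 t ht]; push_cast; ring

theorem ord_zero (p : G.Point) : (zero G).ord p = 0 := by
  cases p <;> simp [ord, zero]

theorem ord_add (f g : G.RationalFunction) (p : G.Point) :
    (f.add g).ord p = f.ord p + g.ord p := by
  classical
  cases p with
  | vertex v =>
    have key : ∀ (a b : ℤ) (P : Prop), (if P then a + b else 0)
        = (if P then a else 0) + (if P then b else 0) := by
      intro a b P; split_ifs <;> simp
    simp only [ord, add, key, Finset.sum_add_distrib]
    ring
  | inEdge e t => simp only [ord, add]; ring
  | inRay r t => simp only [ord, add]; ring
  | infty r => simp only [ord, add]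

theorem ord_neg (f : G.RationalFunction) (p : G.Point) : f.neg.ord p = -f.ord p := by
  classical
  cases p with
  | vertex v =>
    have key : ∀ (a : ℤ) (P : Prop), (if P then -a else 0) = -(if P then a else 0) := by
      intro a P; split_ifs <;> simp
    simp only [ord, neg, key, Finset.sum_neg_distrib]
    ring
  | inEdge e t => simp only [ord, neg]; ring
  | inRay r t => simp only [ord, neg]; ring
  | infty r => simp only [ord, neg]

end RationalFunction

/-- The group of principal divisors: divisors of rational functions. -/
def principal (G : MetricGraph) : AddSubgroup G.Divisor where
  carrier := {D | ∃ f : G.RationalFunction, ∀ p, D p = f.ord p}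
  zero_mem' := ⟨RationalFunction.zero G, fun p => by simp [RationalFunction.ord_zero]⟩
  add_mem' := by
    rintro D D' ⟨f, hf⟩ ⟨g, hg⟩
    exact ⟨f.add g, fun p => by simp [RationalFunction.ord_add, hf, hg]⟩
  neg_mem' := by
    rintro D ⟨f, hf⟩
    exact ⟨f.neg, fun p => by simp [RationalFunction.ord_neg, hf]⟩

/-- Two divisors are linearly equivalent if their difference is principal. -/
def LinearlyEquivalent (G : MetricGraph) (D D' : G.Divisor) : Prop := D - D' ∈ G.principal

end MetricGraph

/-! ## Tropical plane curves -/

/-- The inclusion of the lattice `ℤ²` in the plane. -/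
def latticeToPlane (m : ℤ × ℤ) : ℝ × ℝ := ((m.1 : ℝ), (m.2 : ℝ))

/-- The determinant of two lattice vectors. -/
def latticeDet (u v : ℤ × ℤ) : ℤ := u.1 * v.2 - u.2 * v.1

/-- A metric graph drawn in the plane with straight edges of rational slope: each edge has a
primitive integral direction vector, and lengths are lattice lengths. -/
structure PlaneGraph where
  graph : MetricGraph
  pos : graph.V → ℝ × ℝ
  edgeDir : graph.E → ℤ × ℤ
  rayDir : graph.R → ℤ × ℤ
  edgeDir_primitive : ∀ e, IsCoprime (edgeDir e).1 (edgeDir e).2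
  rayDir_primitive : ∀ r, IsCoprime (rayDir r).1 (rayDir r).2
  pos_tgt : ∀ e, pos (graph.tgt e) = pos (graph.src e) + graph.len e • latticeToPlane (edgeDir e)

namespace PlaneGraph

/-- The position in the plane of a point of the graph; a point at infinity has none. -/
def location (Γ : PlaneGraph) : Γ.graph.Point → Option (ℝ × ℝ)
  | .vertex v => some (Γ.pos v)
  | .inEdge e t => some (Γ.pos (Γ.graph.src e) + (t : ℝ) • latticeToPlane (Γ.edgeDir e))
  | .inRay r t => some (Γ.pos (Γ.graph.root r) + (t : ℝ) • latticeToPlane (Γ.rayDir r))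
  | .infty _ => none

/-- The subset of the plane covered by the graph. -/
def carrier (Γ : PlaneGraph) : Set (ℝ × ℝ) := {x | ∃ p, Γ.location p = some x}

/-- The bounded and unbounded edges together. -/
abbrev Edge (Γ : PlaneGraph) : Type := Γ.graph.E ⊕ Γ.graph.R

/-- The primitive direction vector of a bounded or unbounded edge. -/
def dir (Γ : PlaneGraph) : Γ.Edge → ℤ × ℤ := Sum.elim Γ.edgeDir Γ.rayDir

/-- The relative interior of a bounded or unbounded edge, as a subset of the plane. -/
def edgeInterior (Γ : PlaneGraph) : Γ.Edge → Set (ℝ × ℝ)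
  | .inl e => {x | ∃ t, Γ.location (.inEdge e t) = some x}
  | .inr r => {x | ∃ t, Γ.location (.inRay r t) = some x}

end PlaneGraph

open Classical in
/-- A tropical plane curve: a metric graph embedded in the plane, possibly with unbounded edges,
with edges of rational slope carrying positive integral weights, and balanced at every vertex. -/
structure TropicalPlaneCurve extends PlaneGraph where
  edgeWeight : graph.E → ℕ
  rayWeight : graph.R → ℕ
  edgeWeight_pos : ∀ e, 0 < edgeWeight e
  rayWeight_pos : ∀ r, 0 < rayWeight r
  /-- distinct points of the graph have distinct positions -/
  embedded : ∀ p q x, toPlaneGraph.location p = some x → toPlaneGraph.location q = some x → p = q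
  /-- the weighted sum of the outgoing primitive vectors at every vertex is zero -/
  balanced : ∀ v : graph.V,
    (∑ e : graph.E, if graph.src e = v then (edgeWeight e : ℤ) • edgeDir e else 0)
      + (∑ e : graph.E, if graph.tgt e = v then (edgeWeight e : ℤ) • (-edgeDir e) else 0)
      + (∑ r : graph.R, if graph.root r = v then (rayWeight r : ℤ) • rayDir r else 0) = 0

namespace TropicalPlaneCurve

/-- The weight of a bounded or unbounded edge. -/
def weight (Γ : TropicalPlaneCurve) : Γ.Edge → ℕ := Sum.elim Γ.edgeWeight Γ.rayWeight

end TropicalPlaneCurve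

/-- For a finite set `S` of exponents and coefficients `c`, the exponents of the terms of the
tropical polynomial `max_{m ∈ S} (c m + ⟨m, x⟩)` that attain the maximum at `x`. -/
def maximalExponents (S : Finset (ℤ × ℤ)) (c : ℤ × ℤ → ℝ) (x : ℝ × ℝ) : Set (ℤ × ℤ) :=
  {m | m ∈ S ∧ ∀ n ∈ S, c n + (n.1 * x.1 + n.2 * x.2) ≤ c m + (m.1 * x.1 + m.2 * x.2)}

/-- The cell dual to the point `x` in the regular subdivision of the convex hull of `S` that is
induced by the heights `c`. -/
def dualCell (S : Finset (ℤ × ℤ)) (c : ℤ × ℤ → ℝ) (x : ℝ × ℝ) : Set (ℝ × ℝ) :=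
  convexHull ℝ (latticeToPlane '' maximalExponents S c x)

/-- A regular subdivision of a lattice polygon dual to the tropical plane curve `Γ`, also called
its subdivided Newton polygon.  It is the subdivision of the convex hull of `exponents` induced by
`coeff`.  The curve is the locus where at least two terms of the tropical polynomial attain the
maximum, its vertices correspond to the two-dimensional cells, and each of its edges corresponds to
an edge of the subdivision, which is orthogonal to it and whose lattice length is the weight. -/
structure DualSubdivision (Γ : TropicalPlaneCurve) where
  exponents : Finset (ℤ × ℤ)
  coeff : ℤ × ℤ → ℝ
  mem_carrier_iff : ∀ x, x ∈ Γ.carrier ↔ (maximalExponents exponents coeff x).Nontrivial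
  vertex_iff : ∀ x, (∃ v, Γ.pos v = x) ↔
    ¬ Collinear ℝ (latticeToPlane '' maximalExponents exponents coeff x)
  edge_dual : ∀ a : Γ.Edge, ∀ x ∈ Γ.edgeInterior a, ∃ m m' : ℤ × ℤ,
    m' - m = (Γ.weight a : ℤ) • (-(Γ.dir a).2, (Γ.dir a).1) ∧
    dualCell exponents coeff x = segment ℝ (latticeToPlane m) (latticeToPlane m')

namespace DualSubdivision

variable {Γ : TropicalPlaneCurve}

/-- The curve has degree `d`: its Newton polygon is the standard triangle of edge length `d`. -/
def HasDegree (N : DualSubdivision Γ) (d : ℕ) : Prop :=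
  convexHull ℝ (latticeToPlane '' (N.exponents : Set (ℤ × ℤ)))
    = convexHull ℝ {((0 : ℝ), (0 : ℝ)), ((d : ℝ), (0 : ℝ)), ((0 : ℝ), (d : ℝ))}

/-- The weight of a vertex: the number of lattice points in the interior of its dual face. -/
def vertexWeight (N : DualSubdivision Γ) (v : Γ.graph.V) : ℕ :=
  Set.ncard {m : ℤ × ℤ |
    latticeToPlane m ∈ interior (dualCell N.exponents N.coeff (Γ.pos v))}

/-- The paired metric graph: every edge of weight `w` is replaced by `w` edges of the same length,
and `vertexWeight v` loops of length `ε` are attached at every vertex `v`. -/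
def pairedGraph (N : DualSubdivision Γ) (ε : ℝ) (hε : 0 < ε) : MetricGraph where
  V := Γ.graph.V
  E := (Σ e : Γ.graph.E, Fin (Γ.edgeWeight e)) ⊕ (Σ v : Γ.graph.V, Fin (N.vertexWeight v))
  R := Σ r : Γ.graph.R, Fin (Γ.rayWeight r)
  src := Sum.elim (fun a => Γ.graph.src a.1) (fun b => b.1)
  tgt := Sum.elim (fun a => Γ.graph.tgt a.1) (fun b => b.1)
  len := Sum.elim (fun a => Γ.graph.len a.1) (fun _ => ε)
  len_pos := by
    rintro (a | b)
    · exact Γ.graph.len_pos a.1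
    · exact hε
  root := fun a => Γ.graph.root a.1

/-- The pairing morphism, which collapses the loops and the multiple edges. -/
def pairing (N : DualSubdivision Γ) (ε : ℝ) (hε : 0 < ε) :
    (N.pairedGraph ε hε).Point → Γ.graph.Point
  | .vertex v => .vertex v
  | .inEdge (.inl a) t => .inEdge a.1 t
  | .inEdge (.inr b) _ => .vertex b.1
  | .inRay a t => .inRay a.1 t
  | .infty a => .infty a.1

/-- The point lies in the interior of one of the attached loops. -/
def InLoop (N : DualSubdivision Γ) (ε : ℝ) (hε : 0 < ε) : (N.pairedGraph ε hε).Point → Prop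
  | .inEdge (.inr _) _ => True
  | _ => False

/-- The push-forward of divisors along the pairing morphism:
`(φ_* D)(P) = ∑_{φ(P') = P} D(P')`. -/
def pushforward (N : DualSubdivision Γ) (ε : ℝ) (hε : 0 < ε) :
    (N.pairedGraph ε hε).Divisor →+ Γ.graph.Divisor :=
  Finsupp.mapDomain.addMonoidHom (N.pairing ε hε)

/-- `L` is the pullback to the paired metric graph of the divisor `D` on the curve: it is a lift
of `D` supported away from the loops, in which the chips at a point of a weighted edge are
distributed evenly over the corresponding parallel edges. -/
structure IsPullback (N : DualSubdivision Γ) (ε : ℝ) (hε : 0 < ε) (D : Γ.graph.Divisor)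
    (L : (N.pairedGraph ε hε).Divisor) : Prop where
  lift : N.pushforward ε hε L = D
  off_loops : ∀ p, N.InLoop ε hε p → L p = 0
  even : ∀ p q, ¬ N.InLoop ε hε p → ¬ N.InLoop ε hε q →
    N.pairing ε hε p = N.pairing ε hε q → L p = L q

/-- The Picard group of the curve with respect to its paired metric graph. -/
abbrev Pic (N : DualSubdivision Γ) (ε : ℝ) (hε : 0 < ε) : Type :=
  Γ.graph.Divisor ⧸ (N.pairedGraph ε hε).principal.map (N.pushforward ε hε)

/-- The class in the Picard group of the curve of a divisor on the curve. -/
def picClass (N : DualSubdivision Γ) (ε : ℝ) (hε : 0 < ε) (D : Γ.graph.Divisor) : N.Pic ε hε :=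
  QuotientAddGroup.mk D

/-- The canonical divisor of the curve: the push-forward of the one of the paired graph. -/
def canonical (N : DualSubdivision Γ) (ε : ℝ) (hε : 0 < ε) : Γ.graph.Divisor :=
  N.pushforward ε hε (N.pairedGraph ε hε).canonical

end DualSubdivision

/-! ## Stable intersections -/

namespace TropicalPlaneCurve

/-- `Γ` and the translate `Λ + y` intersect properly: they meet only in relative interiors of
edges, and edges that meet are not parallel. -/
def MeetsProperly (Γ Λ : TropicalPlaneCurve) (y : ℝ × ℝ) : Prop :=
  (∀ v, ∀ x ∈ Λ.carrier, Γ.pos v ≠ x + y) ∧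
  (∀ v, ∀ x ∈ Γ.carrier, x ≠ Λ.pos v + y) ∧
  (∀ a b, (∃ x ∈ Λ.edgeInterior b, x + y ∈ Γ.edgeInterior a) →
    latticeDet (Γ.dir a) (Λ.dir b) ≠ 0)

open Classical in
/-- If `Γ` and `Λ + y` intersect properly, this is the number of their intersection points in `U`,
counted with multiplicities: an intersection point of edges with weights `w, w'` and primitive
directions `u, u'` has multiplicity `w w' |det (u, u')|`.  (Two edges that are not parallel meet in
at most one point.) -/
def intersectionCount (Γ Λ : TropicalPlaneCurve) (y : ℝ × ℝ) (U : Set (ℝ × ℝ)) : ℤ :=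
  ∑ a : Γ.Edge, ∑ b : Λ.Edge,
    if ∃ x ∈ Λ.edgeInterior b, x + y ∈ Γ.edgeInterior a ∧ x + y ∈ U then
      (Γ.weight a : ℤ) * (Λ.weight b : ℤ) * |latticeDet (Γ.dir a) (Λ.dir b)|
    else 0

/-- `v` is a direction such that `Γ` and `Λ + ε v` intersect properly for all small `ε > 0`. -/
def GenericDirection (Γ Λ : TropicalPlaneCurve) (v : ℝ × ℝ) : Prop :=
  ∀ᶠ ε in 𝓝[>] (0 : ℝ), Γ.MeetsProperly Λ (ε • v)

/-- The divisor `D` on `Γ` is the stable intersection of `Γ` and `Λ`: for every generic direction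
`v` (and there is one), it is the limit of the intersections of `Γ` with `Λ + ε v` as `ε → 0`. -/
structure IsStableIntersection (Γ Λ : TropicalPlaneCurve) (D : Γ.graph.Divisor) : Prop where
  exists_generic : ∃ v, Γ.GenericDirection Λ v
  limit : ∀ v, Γ.GenericDirection Λ v → ∀ p x, Γ.location p = some x →
    ∀ᶠ r in 𝓝[>] (0 : ℝ), ∀ᶠ ε in 𝓝[>] (0 : ℝ),
      Γ.intersectionCount Λ (ε • v) (Metric.ball x r) = D p
  infty : ∀ r, D (.infty r) = 0

end TropicalPlaneCurve

end

/-! The equivalence is adjunction, made explicit by one rational function. Let `F` be the tropical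
polynomial of the quartic, `ℓ` that of the line, and `x + y` the monomial with exponent `(1, 1)`.
Pulled back to the paired graph (constant on the loops), `F - ℓ - (x + y)` has divisor exactly `L -
K`, checked point by point.

At a vertex `v`, minus the order of `F` is the sum over half-edges of weight times outgoing slope.
The slope of a maximum of affine functions in a direction is the support function of the dual cell,
and the half-edges at `v` are the outer normals of the sides of that cell, with weights as lattice
lengths. So the sum is twice the area of the dual polygon (`sum_maxSlope_vertex`), and Pick's
formula (`LatticePolygon.pick`) gives `2 * interior + boundary - 2`. As interior points become loops
and boundary length becomes the number of parallel edge ends, this is `val v - 2`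
(`valency_pairedGraph`). Inside an edge `F` is linear (`maxSlope_edge`). Hence `F` contributes `-K`
at all finite points. The monomial is linear, so by balancing it contributes nothing there.

Minus the order of `ℓ` at finite points is the line section. For a generic small translate of the
line, the slope of the translated `ℓ` along a segment of the curve increases precisely by the
intersection numbers met on the way (`IsTripod.sum_det_eq`, `edgeCount_eq`). Around a vertex all the
segments start where the same single term is maximal, and balancing removes the contribution of that
term. What remains is the sum of the slopes of `ℓ` leaving the vertex
(`eventually_intersectionCount_vertex`), that is, the order up to sign. Since `ℓ` is pulled back
along the collapsing map, its order is the same on all parallel edges and vanishes on loops, so the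
divisor upstairs is the pullback of the line section.

The degree enters at the points at infinity, where `L - K` has coefficient `1`. The triangle of size
4, moved inwards by one lattice unit along each side, is the unit triangle translated by `(1, 1)`,
so the end slopes of `F`, `ℓ` and `x + y` differ by exactly `1` on every unbounded edge
(`endSlope_quartic`). Uniqueness of the section and of its pullback is formal, and push-forward
gives the statement on Picard classes. -/

noncomputable section

/-! ## Lattice vectors -/

/-- The pairing of an exponent with a lattice direction. -/
def latticePairing (m u : ℤ × ℤ) : ℤ := m.1 * u.1 + m.2 * u.2

/-- The pairing of an exponent with a point of the plane. -/
def planePairing (m : ℤ × ℤ) (x : ℝ × ℝ) : ℝ := m.1 * x.1 + m.2 * x.2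

theorem planePairing_add (m : ℤ × ℤ) (x y : ℝ × ℝ) :
    planePairing m (x + y) = planePairing m x + planePairing m y := by
  simp only [planePairing, Prod.fst_add, Prod.snd_add]; ring

theorem planePairing_smul_lattice (m u : ℤ × ℤ) (t : ℝ) :
    planePairing m (t • latticeToPlane u) = t * latticePairing m u := by
  simp only [planePairing, latticePairing, latticeToPlane, Prod.smul_fst, Prod.smul_snd,
    smul_eq_mul]
  push_cast; ring

theorem continuous_planePairing (m : ℤ × ℤ) : Continuous (planePairing m) := by
  unfold planePairing; fun_prop

theorem latticePairing_neg (m u : ℤ × ℤ) : latticePairing m (-u) = -latticePairing m u := by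
  simp only [latticePairing, Prod.fst_neg, Prod.snd_neg]; ring

theorem latticeToPlane_neg (u : ℤ × ℤ) : latticeToPlane (-u) = -latticeToPlane u := by
  ext <;> simp [latticeToPlane]

theorem latticeToPlane_injective : Function.Injective latticeToPlane := by
  intro a b h
  simp only [latticeToPlane, Prod.mk.injEq, Int.cast_inj] at h
  exact Prod.ext h.1 h.2

theorem ne_zero_of_isCoprime {u : ℤ × ℤ} (hu : IsCoprime u.1 u.2) : u ≠ 0 := by
  rintro rfl
  exact not_isCoprime_zero_zero hu

theorem latticeToPlane_ne_zero {u : ℤ × ℤ} (hu : IsCoprime u.1 u.2) : latticeToPlane u ≠ 0 := by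
  intro h
  apply ne_zero_of_isCoprime hu
  apply latticeToPlane_injective
  rw [h]; ext <;> simp [latticeToPlane]

/-- Parallel primitive vectors agree up to sign. -/
theorem eq_or_eq_neg_of_latticeDet_eq_zero {u v : ℤ × ℤ} (hu : IsCoprime u.1 u.2)
    (hv : IsCoprime v.1 v.2) (h : latticeDet u v = 0) : u = v ∨ u = -v := by
  unfold latticeDet at h
  have e : u.1 * v.2 = u.2 * v.1 := by linarith
  -- Proportional coprime pairs have coordinates dividing each other, hence equal up to sign. If the
  -- two signs differ, one coordinate must vanish and its sign is immaterial.
  have h1 : u.1 ∣ v.1 := hu.dvd_of_dvd_mul_left ⟨v.2, e.symm⟩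
  have h2 : v.1 ∣ u.1 := hv.dvd_of_dvd_mul_right ⟨u.2, by rw [e]; ring⟩
  have h3 : u.2 ∣ v.2 := hu.symm.dvd_of_dvd_mul_left ⟨v.1, e⟩
  have h4 : v.2 ∣ u.2 := hv.symm.dvd_of_dvd_mul_right ⟨u.1, by rw [← e]; ring⟩
  have h5 := Int.natAbs_eq_natAbs_iff.1 (Int.natAbs_eq_of_dvd_dvd h1 h2)
  have h6 := Int.natAbs_eq_natAbs_iff.1 (Int.natAbs_eq_of_dvd_dvd h3 h4)
  rcases h5 with h5 | h5 <;> rcases h6 with h6 | h6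
  · exact Or.inl (Prod.ext h5 h6)
  · rw [h5, h6] at e
    have : v.1 * v.2 = 0 := by linarith
    rcases mul_eq_zero.1 this with h | h
    · exact Or.inr (Prod.ext (by simp [h5, h]) (by simp [h6]))
    · exact Or.inl (Prod.ext h5 (by simp [h6, h]))
  · rw [h5, h6] at e
    have : v.1 * v.2 = 0 := by linarith
    rcases mul_eq_zero.1 this with h | h
    · exact Or.inl (Prod.ext (by simp [h5, h]) h6)
    · exact Or.inr (Prod.ext (by simp [h5]) (by simp [h6, h]))
  · exact Or.inr (Prod.ext h5 h6)

/-- Primitive vectors that span the same ray agree. -/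
theorem eq_of_smul_eq_smul {u v : ℤ × ℤ} (hu : IsCoprime u.1 u.2) (hv : IsCoprime v.1 v.2)
    {s t : ℝ} (hs : 0 < s) (ht : 0 < t) (h : s • latticeToPlane u = t • latticeToPlane v) :
    u = v := by
  have h1 : s * u.1 = t * v.1 := by simpa [latticeToPlane] using congrArg Prod.fst h
  have h2 : s * u.2 = t * v.2 := by simpa [latticeToPlane] using congrArg Prod.snd h
  have hdet : latticeDet u v = 0 := by
    have : s * (latticeDet u v : ℝ) = 0 := by
      unfold latticeDet; push_cast
      linear_combination (v.2 : ℝ) * h1 - v.1 * h2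
    have := (mul_eq_zero.1 this).resolve_left hs.ne'
    exact_mod_cast this
  rcases eq_or_eq_neg_of_latticeDet_eq_zero hu hv hdet with h | h
  · exact h
  · exfalso
    subst h
    have h3 : (s + t) * v.1 = 0 := by
      simp only [Prod.fst_neg, Int.cast_neg] at h1; linarith
    have h4 : (s + t) * v.2 = 0 := by
      simp only [Prod.snd_neg, Int.cast_neg] at h2; linarith
    have hst : s + t ≠ 0 := by positivity
    apply ne_zero_of_isCoprime hv
    ext
    · exact_mod_cast (mul_eq_zero.1 h3).resolve_left hst
    · exact_mod_cast (mul_eq_zero.1 h4).resolve_left hst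

/-! ## Tropical polynomials -/

section TropicalPolynomial

variable (S : Finset (ℤ × ℤ)) (c : ℤ × ℤ → ℝ)

/-- The value of a tropical polynomial. -/
def tropicalEval (x : ℝ × ℝ) : ℝ := sSup ((fun m => c m + planePairing m x) '' (S : Set (ℤ × ℤ)))

/-- The slope of a tropical polynomial at a point in a direction leaving it. -/
def maxSlope (x : ℝ × ℝ) (u : ℤ × ℤ) : ℤ :=
  sSup ((latticePairing · u) '' maximalExponents S c x)

variable {S c}

theorem mem_maximalExponents {x : ℝ × ℝ} {m : ℤ × ℤ} : m ∈ maximalExponents S c x ↔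
    m ∈ S ∧ ∀ n ∈ S, c n + planePairing n x ≤ c m + planePairing m x := Iff.rfl

theorem maximalExponents_finite (x : ℝ × ℝ) : (maximalExponents S c x).Finite :=
  S.finite_toSet.subset fun _ h => h.1

theorem maximalExponents_nonempty (hS : S.Nonempty) (x : ℝ × ℝ) :
    (maximalExponents S c x).Nonempty := by
  obtain ⟨m, hm, h⟩ := S.exists_max_image (fun m => c m + planePairing m x) hS
  exact ⟨m, hm, h⟩

theorem tropicalEval_eq {x : ℝ × ℝ} {m : ℤ × ℤ} (hm : m ∈ maximalExponents S c x) :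
    tropicalEval S c x = c m + planePairing m x := by
  apply IsGreatest.csSup_eq
  refine ⟨⟨m, hm.1, rfl⟩, ?_⟩
  rintro _ ⟨n, hn, rfl⟩
  exact hm.2 n hn

theorem mem_maximalExponents_of_eq {x : ℝ × ℝ} {m n : ℤ × ℤ} (hm : m ∈ maximalExponents S c x)
    (hn : n ∈ S) (h : c n + planePairing n x = c m + planePairing m x) :
    n ∈ maximalExponents S c x := by
  refine ⟨hn, fun k hk => ?_⟩
  have := (mem_maximalExponents.1 hm).2 k hk
  rw [← h] at this
  exact this

theorem value_eq_of_mem {x : ℝ × ℝ} {m n : ℤ × ℤ} (hm : m ∈ maximalExponents S c x)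
    (hn : n ∈ maximalExponents S c x) : c n + planePairing n x = c m + planePairing m x := by
  rw [← tropicalEval_eq hm, ← tropicalEval_eq hn]

theorem exists_maxSlope (hS : S.Nonempty) (x : ℝ × ℝ) (u : ℤ × ℤ) :
    ∃ m ∈ maximalExponents S c x, latticePairing m u = maxSlope S c x u := by
  have := ((maximalExponents_nonempty (c := c) hS x).image (latticePairing · u)).csSup_mem
    ((maximalExponents_finite x).image _)
  exact this

theorem le_maxSlope {x : ℝ × ℝ} {m : ℤ × ℤ} (hm : m ∈ maximalExponents S c x) (u : ℤ × ℤ) :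
    latticePairing m u ≤ maxSlope S c x u :=
  le_csSup ((maximalExponents_finite x).image _).bddAbove ⟨m, hm, rfl⟩

theorem maxSlope_eq {x : ℝ × ℝ} {u m : ℤ × ℤ} (hm : m ∈ maximalExponents S c x)
    (h : ∀ n ∈ maximalExponents S c x, latticePairing n u ≤ latticePairing m u) :
    maxSlope S c x u = latticePairing m u := by
  apply IsGreatest.csSup_eq
  refine ⟨⟨m, hm, rfl⟩, ?_⟩
  rintro _ ⟨n, hn, rfl⟩
  exact h n hn

/-- A term strictly below the maximum stays below it nearby by continuity, and there are only
finitely many terms. -/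
theorem eventually_maximalExponents_subset (hS : S.Nonempty) (x : ℝ × ℝ) :
    ∀ᶠ y in 𝓝 x, maximalExponents S c y ⊆ maximalExponents S c x := by
  obtain ⟨m, hm⟩ := maximalExponents_nonempty (c := c) hS x
  have key : ∀ n ∈ S, ∀ᶠ y in 𝓝 x, n ∈ maximalExponents S c y → n ∈ maximalExponents S c x := by
    intro n hn
    by_cases hnx : n ∈ maximalExponents S c x
    · exact Eventually.of_forall fun _ _ => hnx
    · have hlt : c n + planePairing n x < c m + planePairing m x := by
        refine lt_of_le_of_ne (hm.2 n hn) fun h => hnx (mem_maximalExponents_of_eq hm hn h)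
      have hc1 : Continuous fun y => c n + planePairing n y :=
        continuous_const.add (continuous_planePairing n)
      have hc2 : Continuous fun y => c m + planePairing m y :=
        continuous_const.add (continuous_planePairing m)
      filter_upwards [hc1.continuousAt.eventually_lt hc2.continuousAt hlt] with y hy h
      exact absurd ((mem_maximalExponents.1 h).2 m hm.1) (not_le.2 hy)
  filter_upwards [(eventually_all_finset S).2 key] with y hy n hn
  exact hy n hn.1 hn

/-- Near a point, in a fixed direction, the maximal exponents are those of largest slope. -/
theorem eventually_mem_maximalExponents_iff (hS : S.Nonempty) (x : ℝ × ℝ) (u : ℤ × ℤ) :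
    ∀ᶠ h in 𝓝[>] (0 : ℝ), ∀ n, n ∈ maximalExponents S c (x + h • latticeToPlane u) ↔
      n ∈ maximalExponents S c x ∧ latticePairing n u = maxSlope S c x u := by
  obtain ⟨m, hm, hmu⟩ := exists_maxSlope (c := c) hS x u
  have hcont : Continuous fun h : ℝ => x + h • latticeToPlane u := by fun_prop
  have h1 : ∀ᶠ h in 𝓝[>] (0 : ℝ),
      maximalExponents S c (x + h • latticeToPlane u) ⊆ maximalExponents S c x := by
    have : Tendsto (fun h : ℝ => x + h • latticeToPlane u) (𝓝[>] 0) (𝓝 x) := by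
      have := hcont.tendsto 0
      simp only [zero_smul, add_zero] at this
      exact this.mono_left nhdsWithin_le_nhds
    exact this.eventually (eventually_maximalExponents_subset hS x)
  filter_upwards [h1, self_mem_nhdsWithin] with h h1 (hpos : 0 < h) n
  have val : ∀ k, c k + planePairing k (x + h • latticeToPlane u)
      = (c k + planePairing k x) + h * latticePairing k u := by
    intro k; rw [planePairing_add, planePairing_smul_lattice]; ring
  -- The terms maximal at `x` start from a common value, so their order at positive `h` is decided
  -- by their slopes along `u`.
  have hle : ∀ k ∈ maximalExponents S c x,
      c k + planePairing k (x + h • latticeToPlane u)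
        ≤ c m + planePairing m (x + h • latticeToPlane u) := by
    intro k hk
    rw [val, val, value_eq_of_mem hm hk, hmu]
    have : (latticePairing k u : ℝ) ≤ maxSlope S c x u := by exact_mod_cast le_maxSlope hk u
    nlinarith
  have hm' : m ∈ maximalExponents S c (x + h • latticeToPlane u) := by
    obtain ⟨k, hk⟩ := maximalExponents_nonempty (c := c) hS (x + h • latticeToPlane u)
    have e := le_antisymm (hle k (h1 hk)) (hk.2 m hm.1)
    exact mem_maximalExponents_of_eq hk hm.1 e.symm
  constructor
  · intro hn
    refine ⟨h1 hn, ?_⟩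
    have e := value_eq_of_mem hm' hn
    rw [val, val, value_eq_of_mem hm (h1 hn), hmu] at e
    have e2 : h * (latticePairing n u : ℝ) = h * maxSlope S c x u := by linarith
    exact_mod_cast mul_left_cancel₀ hpos.ne' e2
  · rintro ⟨hn, hnu⟩
    apply mem_maximalExponents_of_eq hm' hn.1
    rw [val, val, value_eq_of_mem hm hn, hmu, hnu]

/-- Along a short segment one fixed term of largest slope realizes the maximum. This is what makes
`maxSlope` a one-sided slope of the pulled-back function. -/
theorem eventually_tropicalEval_eq (hS : S.Nonempty) (x : ℝ × ℝ) (u : ℤ × ℤ) :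
    ∀ᶠ h in 𝓝[>] (0 : ℝ), tropicalEval S c (x + h • latticeToPlane u)
      = tropicalEval S c x + maxSlope S c x u * h := by
  obtain ⟨m, hm, hmu⟩ := exists_maxSlope (c := c) hS x u
  filter_upwards [eventually_mem_maximalExponents_iff (c := c) hS x u] with h hh
  rw [tropicalEval_eq ((hh m).2 ⟨hm, hmu⟩), tropicalEval_eq hm, planePairing_add,
    planePairing_smul_lattice, hmu]
  ring

variable (S) in
/-- The largest slope of a tropical polynomial in a direction. -/
def endSlope (u : ℤ × ℤ) : ℤ := sSup ((latticePairing · u) '' (S : Set (ℤ × ℤ)))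

theorem exists_endSlope (hS : S.Nonempty) (u : ℤ × ℤ) :
    ∃ m ∈ S, latticePairing m u = endSlope S u :=
  (Set.Nonempty.image (latticePairing · u) (s := (S : Set (ℤ × ℤ))) hS).csSup_mem
    (S.finite_toSet.image _)

theorem le_endSlope {m : ℤ × ℤ} (hm : m ∈ S) (u : ℤ × ℤ) : latticePairing m u ≤ endSlope S u :=
  le_csSup (S.finite_toSet.image _).bddAbove ⟨m, hm, rfl⟩

theorem endSlope_eq {u : ℤ × ℤ} {a : ℤ} (h : ∃ m ∈ S, latticePairing m u = a)
    (h' : ∀ m ∈ S, latticePairing m u ≤ a) : endSlope S u = a := by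
  apply IsGreatest.csSup_eq
  obtain ⟨m, hm, rfl⟩ := h
  refine ⟨⟨m, hm, rfl⟩, ?_⟩
  rintro _ ⟨n, hn, rfl⟩
  exact h' n hn

/-- Far out in a fixed direction, the maximal exponents have the largest slope, and one of them is
constant. -/
theorem exists_forall_maximalExponents (hS : S.Nonempty) (x : ℝ × ℝ) (u : ℤ × ℤ) :
    ∃ T : ℝ, 0 ≤ T ∧ ∃ m, latticePairing m u = endSlope S u ∧ ∀ t, T ≤ t →
      m ∈ maximalExponents S c (x + t • latticeToPlane u) ∧
      ∀ n ∈ maximalExponents S c (x + t • latticeToPlane u),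
        latticePairing n u = endSlope S u := by
  classical
  have val : ∀ (h : ℝ) k, c k + planePairing k (x + h • latticeToPlane u)
      = (c k + planePairing k x) + h * latticePairing k u := by
    intro h k; rw [planePairing_add, planePairing_smul_lattice]; ring
  obtain ⟨m0, hm0, hm0u⟩ := exists_endSlope hS u
  obtain ⟨m, hm, hmax⟩ := (S.filter fun m => latticePairing m u = endSlope S u).exists_max_image
    (fun m => c m + planePairing m x) ⟨m0, Finset.mem_filter.2 ⟨hm0, hm0u⟩⟩
  rw [Finset.mem_filter] at hm
  have key : ∀ n ∈ S, ∀ᶠ t : ℝ in atTop, latticePairing n u ≠ endSlope S u →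
      c n + planePairing n (x + t • latticeToPlane u)
        < c m + planePairing m (x + t • latticeToPlane u) := by
    intro n hn
    -- Slopes are integers, so a term of smaller slope loses at least one per unit of `t`; its
    -- initial lead is therefore a sufficient threshold.
    filter_upwards [eventually_gt_atTop ((c n + planePairing n x) - (c m + planePairing m x)),
      eventually_gt_atTop (0 : ℝ)] with t ht ht0 hne
    have hlt : latticePairing n u + 1 ≤ endSlope S u := lt_of_le_of_ne (le_endSlope hn u) hne
    have hlt' : (latticePairing n u : ℝ) + 1 ≤ endSlope S u := by exact_mod_cast hlt
    rw [val, val, hm.2]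
    nlinarith
  obtain ⟨T, hT⟩ := eventually_atTop.1 ((eventually_all_finset S).2 key)
  refine ⟨max T 0, le_max_right _ _, m, hm.2, fun t ht => ?_⟩
  have ht' := hT t ((le_max_left _ _).trans ht)
  have hmm : m ∈ maximalExponents S c (x + t • latticeToPlane u) := by
    refine ⟨hm.1, fun n hn => ?_⟩
    by_cases hnu : latticePairing n u = endSlope S u
    · change c n + planePairing n _ ≤ c m + planePairing m _
      rw [val, val, hnu, hm.2]
      have := hmax n (Finset.mem_filter.2 ⟨hn, hnu⟩)
      linarith
    · exact (ht' n hn hnu).le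
  refine ⟨hmm, fun n hn => ?_⟩
  by_contra hne
  exact absurd (value_eq_of_mem hmm hn) (ht' n hn.1 hne).ne

/-- Far out a single term stays maximal, so its affine formula can be used at both `T` and `t`. -/
theorem exists_tropicalEval_eventually_linear (hS : S.Nonempty) (x : ℝ × ℝ) (u : ℤ × ℤ) :
    ∃ T : ℝ, 0 ≤ T ∧ ∀ t, T ≤ t → tropicalEval S c (x + t • latticeToPlane u)
      = tropicalEval S c (x + T • latticeToPlane u) + endSlope S u * (t - T) := by
  obtain ⟨T, hT, m, hm, h⟩ := exists_forall_maximalExponents (c := c) hS x u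
  refine ⟨T, hT, fun t ht => ?_⟩
  rw [tropicalEval_eq (h t ht).1, tropicalEval_eq (h T le_rfl).1, planePairing_add,
    planePairing_add, planePairing_smul_lattice, planePairing_smul_lattice, hm]
  ring

/-- The slopes in opposite directions cancel at all but finitely many points of a line. -/
theorem finite_setOf_maxSlope_add_ne_zero (x : ℝ × ℝ) (u : ℤ × ℤ) (hS : S.Nonempty) :
    {t : ℝ | maxSlope S c (x + t • latticeToPlane u) u
      + maxSlope S c (x + t • latticeToPlane u) (-u) ≠ 0}.Finite := by
  classical
  -- The slopes fail to cancel only where two maximal terms of different slope tie. The image lists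
  -- the parameters at which the affine functions of such a pair agree.
  apply ((S ×ˢ S).finite_toSet.image fun p : (ℤ × ℤ) × (ℤ × ℤ) =>
    ((c p.2 + planePairing p.2 x) - (c p.1 + planePairing p.1 x))
      / ((latticePairing p.1 u : ℝ) - latticePairing p.2 u)).subset
  intro t ht
  obtain ⟨m, hm, hmu⟩ := exists_maxSlope (c := c) hS (x + t • latticeToPlane u) u
  obtain ⟨n, hn, hnu⟩ := exists_maxSlope (c := c) hS (x + t • latticeToPlane u) (-u)
  rw [Set.mem_ofPred_eq, ← hmu, ← hnu, latticePairing_neg] at ht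
  refine ⟨(m, n), by simp [hm.1, hn.1], ?_⟩
  have h0 : (latticePairing m u : ℝ) - latticePairing n u ≠ 0 := by
    intro h
    apply ht
    exact_mod_cast (by linarith : (latticePairing m u : ℝ) + -latticePairing n u = 0)
  have e := value_eq_of_mem hm hn
  rw [planePairing_add, planePairing_add, planePairing_smul_lattice,
    planePairing_smul_lattice] at e
  change _ / _ = t
  rw [div_eq_iff h0]
  dsimp only
  linarith

end TropicalPolynomial

/-! ## Pick's formula -/

/-- A lattice polygon with its sides: `start i` and `finish i` are the vertices of the side with
outer normal vector `normal i`, in counterclockwise order. -/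
structure LatticePolygon (ι : Type) where
  pts : Set (ℤ × ℤ)
  finite : pts.Finite
  normal : ι → ℤ × ℤ
  length : ι → ℕ
  start : ι → ℤ × ℤ
  primitive : ∀ i, IsCoprime (normal i).1 (normal i).2
  length_pos : ∀ i, 0 < length i
  start_mem : ∀ i, start i ∈ pts
  finish_mem : ∀ i, ((start i).1 - length i * (normal i).2, (start i).2 + length i * (normal i).1)
    ∈ pts
  le_support : ∀ i, ∀ a ∈ pts, latticePairing a (normal i) ≤ latticePairing (start i) (normal i)
  side_subset : ∀ i, ∀ a ∈ pts, latticePairing a (normal i) = latticePairing (start i) (normal i) →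
    ∃ t : ℝ, 0 ≤ t ∧ t ≤ length i ∧ (a.1 : ℝ) = (start i).1 - t * (normal i).2 ∧
      (a.2 : ℝ) = (start i).2 + t * (normal i).1
  normal_injective : Function.Injective normal
  complete : ∀ u : ℤ × ℤ, IsCoprime u.1 u.2 → ∀ a ∈ pts, ∀ b ∈ pts, a ≠ b →
    latticePairing a u = latticePairing b u →
    (∀ p ∈ pts, latticePairing p u ≤ latticePairing a u) → ∃ i, normal i = u
  noncollinear : ∀ u : ℤ × ℤ, u ≠ 0 →
    ∃ a ∈ pts, ∃ b ∈ pts, latticePairing a u < latticePairing b u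

namespace LatticePolygon

variable {ι : Type} (D : LatticePolygon ι)

/-- The other end of a side. -/
def finish (i : ι) : ℤ × ℤ :=
  ((D.start i).1 - D.length i * (D.normal i).2, (D.start i).2 + D.length i * (D.normal i).1)

/-- The value of the support function at the normal vector of a side. -/
def support (i : ι) : ℤ := latticePairing (D.start i) (D.normal i)

/-- The polygon as a subset of the plane. -/
def hull : Set (ℝ × ℝ) := convexHull ℝ (latticeToPlane '' D.pts)

/-- The line spanned by a side, as a function of the first coordinate. -/
def height (i : ι) (x : ℝ) : ℝ := (D.support i - (D.normal i).1 * x) / (D.normal i).2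

/-- The upper boundary of the polygon. -/
def top (x : ℝ) : ℝ := sSup {y | (x, y) ∈ D.hull}

/-- The side is an upper side that lies above the interval `[k, k + 1]`. -/
def Covers (i : ι) (k : ℤ) : Prop :=
  0 < (D.normal i).2 ∧ (D.finish i).1 ≤ k ∧ k + 1 ≤ (D.start i).1

theorem mem_hull {a : ℤ × ℤ} (ha : a ∈ D.pts) : latticeToPlane a ∈ D.hull :=
  subset_convexHull _ _ ⟨a, ha, rfl⟩

theorem convex_hull : Convex ℝ D.hull := convex_convexHull _ _

theorem le_of_mem_hull {α β γ : ℝ} (h : ∀ a ∈ D.pts, α * a.1 + β * a.2 ≤ γ) {z : ℝ × ℝ}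
    (hz : z ∈ D.hull) : α * z.1 + β * z.2 ≤ γ := by
  have hlin : IsLinearMap ℝ fun z : ℝ × ℝ => α * z.1 + β * z.2 :=
    ⟨fun x y => by simp only [Prod.fst_add, Prod.snd_add]; ring,
      fun c x => by simp only [Prod.smul_fst, Prod.smul_snd, smul_eq_mul]; ring⟩
  have : D.hull ⊆ {z : ℝ × ℝ | α * z.1 + β * z.2 ≤ γ} := by
    apply convexHull_min _ (convex_halfSpace_le hlin γ)
    rintro _ ⟨a, ha, rfl⟩
    exact h a ha
  exact this hz

theorem le_support_of_mem_hull {z : ℝ × ℝ} (hz : z ∈ D.hull) (i : ι) :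
    (D.normal i).1 * z.1 + (D.normal i).2 * z.2 ≤ D.support i := by
  refine D.le_of_mem_hull (fun a ha => ?_) hz
  have := D.le_support i a ha
  have h2 : ((latticePairing a (D.normal i) : ℤ) : ℝ) ≤ D.support i := by exact_mod_cast this
  refine le_trans (le_of_eq ?_) h2
  simp only [latticePairing]; push_cast; ring

theorem le_height_of_mem_hull {x y : ℝ} (hz : (x, y) ∈ D.hull) {i : ι}
    (hi : 0 < (D.normal i).2) : y ≤ D.height i x := by
  have h := D.le_support_of_mem_hull hz i
  have hi' : (0 : ℝ) < (D.normal i).2 := by exact_mod_cast hi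
  rw [height, le_div_iff₀ hi']
  dsimp only at h
  linarith

theorem height_mem_hull {i : ι} (hi : 0 < (D.normal i).2) {x : ℝ} (h1 : ((D.finish i).1 : ℝ) ≤ x)
    (h2 : x ≤ (D.start i).1) : (x, D.height i x) ∈ D.hull := by
  have hi' : (0 : ℝ) < (D.normal i).2 := by exact_mod_cast hi
  have hw : (0 : ℝ) < D.length i := by exact_mod_cast D.length_pos i
  have hseg := D.convex_hull.segment_subset (D.mem_hull (D.start_mem i))
    (D.mem_hull (D.finish_mem i))
  apply hseg
  rw [segment_eq_image']
  have hq : (0 : ℝ) < D.length i * (D.normal i).2 := by positivity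
  refine ⟨((D.start i).1 - x) / (D.length i * (D.normal i).2), ⟨?_, ?_⟩, ?_⟩
  · apply div_nonneg _ hq.le; linarith
  · rw [div_le_one hq]
    simp only [finish] at h1; push_cast at h1; linarith
  · ext
    · simp only [latticeToPlane, Prod.fst_add, Prod.smul_fst, Prod.fst_sub, smul_eq_mul]
      push_cast; field_simp; ring
    · simp only [latticeToPlane, Prod.snd_add, Prod.smul_snd, Prod.snd_sub, smul_eq_mul, height,
        support, latticePairing]
      push_cast; field_simp; ring

theorem isGreatest_height {i : ι} (hi : 0 < (D.normal i).2) {x : ℝ}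
    (h1 : ((D.finish i).1 : ℝ) ≤ x) (h2 : x ≤ (D.start i).1) :
    IsGreatest {y | (x, y) ∈ D.hull} (D.height i x) :=
  ⟨D.height_mem_hull hi h1 h2, fun _ hy => D.le_height_of_mem_hull hy hi⟩

theorem Covers.bounds {D : LatticePolygon ι} {i : ι} {k : ℤ} (h : D.Covers i k) :
    ((D.finish i).1 : ℝ) ≤ k ∧ (k : ℝ) + 1 ≤ (D.start i).1 :=
  ⟨by exact_mod_cast h.2.1, by exact_mod_cast h.2.2⟩

theorem Covers.isGreatest_left {D : LatticePolygon ι} {i : ι} {k : ℤ} (h : D.Covers i k) :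
    IsGreatest {y | ((k : ℝ), y) ∈ D.hull} (D.height i k) :=
  D.isGreatest_height h.1 h.bounds.1 (by linarith [h.bounds.2])

theorem Covers.isGreatest_right {D : LatticePolygon ι} {i : ι} {k : ℤ} (h : D.Covers i k) :
    IsGreatest {y | ((k : ℝ) + 1, y) ∈ D.hull} (D.height i (k + 1)) :=
  D.isGreatest_height h.1 (by linarith [h.bounds.1]) h.bounds.2

theorem Covers.top_left {D : LatticePolygon ι} {i : ι} {k : ℤ} (h : D.Covers i k) :
    D.top k = D.height i k := h.isGreatest_left.csSup_eq

theorem Covers.top_right {D : LatticePolygon ι} {i : ι} {k : ℤ} (h : D.Covers i k) :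
    D.top (k + 1) = D.height i (k + 1) := h.isGreatest_right.csSup_eq

/-- Two such sides carry the same upper boundary at both ends of the column, so their lines have the
same slope. Their primitive normals are then parallel, and both point upwards. -/
theorem Covers.unique {D : LatticePolygon ι} {i j : ι} {k : ℤ} (hi : D.Covers i k)
    (hj : D.Covers j k) : i = j := by
  have e0 : D.height i k = D.height j k := by rw [← hi.top_left, hj.top_left]
  have e1 : D.height i (k + 1) = D.height j (k + 1) := by rw [← hi.top_right, hj.top_right]
  have hi' : (0 : ℝ) < (D.normal i).2 := by exact_mod_cast hi.1
  have hj' : (0 : ℝ) < (D.normal j).2 := by exact_mod_cast hj.1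
  have e2 : ((D.normal i).1 : ℝ) / (D.normal i).2 = (D.normal j).1 / (D.normal j).2 := by
    simp only [height, mul_add, mul_one, sub_div, add_div] at e0 e1
    linarith
  rw [div_eq_div_iff hi'.ne' hj'.ne'] at e2
  have e3 : latticeDet (D.normal i) (D.normal j) = 0 := by
    unfold latticeDet
    have : (D.normal i).1 * (D.normal j).2 = (D.normal j).1 * (D.normal i).2 := by
      exact_mod_cast e2
    linarith
  rcases eq_or_eq_neg_of_latticeDet_eq_zero (D.primitive i) (D.primitive j) e3 with h | h
  · exact D.normal_injective h
  · exfalso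
    have := congrArg Prod.snd h
    rw [Prod.snd_neg] at this
    have h1 := hi.1
    have h2 := hj.1
    omega

/-- The upper boundary above an interval `[k, k + 1]` is part of a side. -/
theorem exists_covers {k : ℤ} {p q : ℤ × ℤ} (hp : p ∈ D.pts) (hpk : p.1 ≤ k) (hq : q ∈ D.pts)
    (hqk : k + 1 ≤ q.1) : ∃ i, D.Covers i k := by
  classical
  -- The middle of the column: no lattice point has this abscissa, so the points split strictly into
  -- left and right ones. `H` is the height at `κ` of the chord joining a left point to a right one,
  -- and the highest chord spans the side sought.
  set κ : ℝ := k + 1 / 2 with hκ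
  set H : (ℤ × ℤ) × (ℤ × ℤ) → ℝ := fun r =>
    (r.1.2 * (r.2.1 - κ) + r.2.2 * (κ - r.1.1)) / (r.2.1 - r.1.1) with hH
  have hfin : {r : (ℤ × ℤ) × (ℤ × ℤ) | (r.1 ∈ D.pts ∧ r.1.1 ≤ k) ∧
      (r.2 ∈ D.pts ∧ k + 1 ≤ r.2.1)}.Finite :=
    (D.finite.prod D.finite).subset fun r hr => ⟨hr.1.1, hr.2.1⟩
  obtain ⟨⟨a, b⟩, ⟨⟨ha, hak⟩, hb, hbk⟩, hmax⟩ :=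
    Set.exists_max_image _ H hfin ⟨(p, q), ⟨hp, hpk⟩, hq, hqk⟩
  have hleft : ∀ x : ℤ × ℤ, x.1 ≤ k → (x.1 : ℝ) < κ := by
    intro x hx
    have : (x.1 : ℝ) ≤ k := by exact_mod_cast hx
    rw [hκ]; linarith
  have hright : ∀ x : ℤ × ℤ, k + 1 ≤ x.1 → κ < (x.1 : ℝ) := by
    intro x hx
    have : (k : ℝ) + 1 ≤ x.1 := by exact_mod_cast hx
    rw [hκ]; linarith
  have ha' := hleft a hak
  have hb' := hright b hbk
  dsimp only at hak hbk
  have hΔ : 0 < b.1 - a.1 := by omega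
  -- the line through `a` and `b` lies above the polygon
  have habove : ∀ r ∈ D.pts, (a.1 - b.1 : ℤ) * (r.2 - a.2) ≥ (a.2 - b.2) * (r.1 - a.1) := by
    intro r hr
    by_contra hlt
    push Not at hlt
    have hlt' : ((a.1 : ℝ) - b.1) * (r.2 - a.2) < (a.2 - b.2) * (r.1 - a.1) := by
      exact_mod_cast hlt
    -- A point strictly above the chord, joined to the end of the chord on the other side of `κ`,
    -- would give a higher chord.
    rcases le_or_gt r.1 k with hrk | hrk
    · have hr' := hleft r hrk
      have h := hmax (r, b) ⟨⟨hr, hrk⟩, hb, hbk⟩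
      simp only [hH] at h
      rw [div_le_div_iff₀ (by linarith) (by linarith)] at h
      have := mul_pos (sub_pos.2 hb') (sub_pos.2 hlt')
      nlinarith
    · have hr' := hright r hrk
      have h := hmax (a, r) ⟨⟨ha, hak⟩, hr, hrk⟩
      simp only [hH] at h
      rw [div_le_div_iff₀ (by linarith) (by linarith)] at h
      have := mul_pos (sub_pos.2 ha') (sub_pos.2 hlt')
      nlinarith
  -- The quarter turn of `b - a` is an outer normal; division by the gcd makes it primitive.
  set g : ℤ := (Int.gcd (a.2 - b.2) (b.1 - a.1) : ℤ) with hg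
  have hgpos : 0 < g := by
    rw [hg]; exact_mod_cast Int.gcd_pos_of_ne_zero_right _ hΔ.ne'
  obtain ⟨u1, hu1⟩ : g ∣ a.2 - b.2 := Int.gcd_dvd_left ..
  obtain ⟨u2, hu2⟩ : g ∣ b.1 - a.1 := Int.gcd_dvd_right ..
  have hcop : IsCoprime u1 u2 := by
    rw [Int.isCoprime_iff_gcd_eq_one]
    have : Int.gcd (g * u1) (g * u2) = g.natAbs * Int.gcd u1 u2 := Int.gcd_mul_left ..
    rw [← hu1, ← hu2] at this
    have h3 : g.natAbs = Int.gcd (a.2 - b.2) (b.1 - a.1) := by rw [hg]; simp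
    rw [h3] at this
    have h4 : 0 < Int.gcd (a.2 - b.2) (b.1 - a.1) := Int.gcd_pos_of_ne_zero_right _ hΔ.ne'
    exact Nat.eq_of_mul_eq_mul_left h4 (by rw [← this, mul_one])
  have hu2pos : 0 < u2 := by
    rw [hu2] at hΔ; exact pos_of_mul_pos_right hΔ hgpos.le
  have hab : latticePairing a (u1, u2) = latticePairing b (u1, u2) := by
    have : g * (latticePairing a (u1, u2) - latticePairing b (u1, u2)) = 0 := by
      simp only [latticePairing]
      linear_combination -(a.1 - b.1) * hu1 - (a.2 - b.2) * hu2
    have := (mul_eq_zero.1 this).resolve_left hgpos.ne'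
    linarith
  have hsup : ∀ r ∈ D.pts, latticePairing r (u1, u2) ≤ latticePairing a (u1, u2) := by
    intro r hr
    have h := habove r hr
    have : g * latticePairing r (u1, u2) ≤ g * latticePairing a (u1, u2) := by
      have e1 : g * latticePairing r (u1, u2) = r.1 * (a.2 - b.2) + r.2 * (b.1 - a.1) := by
        simp only [latticePairing]; rw [hu1, hu2]; ring
      have e2 : g * latticePairing a (u1, u2) = a.1 * (a.2 - b.2) + a.2 * (b.1 - a.1) := by
        simp only [latticePairing]; rw [hu1, hu2]; ring
      rw [e1, e2]; linarith
    exact le_of_mul_le_mul_left this hgpos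
  have hne : a ≠ b := by rintro rfl; omega
  obtain ⟨i, hi⟩ := D.complete (u1, u2) hcop a ha b hb hne hab hsup
  have hsi : latticePairing (D.start i) (D.normal i) = latticePairing a (D.normal i) := by
    apply le_antisymm
    · rw [hi]; exact hsup _ (D.start_mem i)
    · exact D.le_support i a ha
  -- Both ends of the chord lie on the side, so the abscissas of the side enclose those of the chord
  -- and hence the column.
  obtain ⟨s, -, hs2, hs3, -⟩ := D.side_subset i a ha hsi.symm
  obtain ⟨t, ht1, -, ht3, -⟩ := D.side_subset i b hb (by rw [hsi, hi, hab])
  refine ⟨i, by rw [hi]; exact hu2pos, ?_, ?_⟩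
  · refine le_trans ?_ hak
    have : ((D.finish i).1 : ℝ) ≤ a.1 := by
      rw [hs3, finish]; push_cast
      have : (0 : ℝ) < (D.normal i).2 := by rw [hi]; exact_mod_cast hu2pos
      nlinarith
    exact_mod_cast this
  · refine le_trans hbk ?_
    have : (b.1 : ℝ) ≤ (D.start i).1 := by
      rw [ht3]
      have : (0 : ℝ) < (D.normal i).2 := by rw [hi]; exact_mod_cast hu2pos
      nlinarith
    exact_mod_cast this

end LatticePolygon

/-! ### Sums of rounded heights over lattice columns. -/

theorem Int.sum_Ico_add_eq_sum_range {M : Type*} [AddCommMonoid M] (f : ℤ → M) (a : ℤ) (N : ℕ) :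
    ∑ k ∈ Finset.Ico a (a + N), f k = ∑ j ∈ Finset.range N, f (a + j) := by
  refine Finset.sum_nbij' (fun k => (k - a).toNat) (fun j => a + j) ?_ ?_ ?_ ?_ ?_
  · intro k hk; simp only [Finset.mem_Ico, Finset.mem_range] at *; omega
  · intro k hk; simp only [Finset.mem_Ico, Finset.mem_range] at *; omega
  · intro k hk; simp only [Finset.mem_Ico] at *; omega
  · intro k hk; simp
  · intro k hk
    simp only [Finset.mem_Ico] at hk
    congr 1; omega

theorem Nat.sum_range_mul_ite_dvd (q w : ℕ) (hq : 0 < q) :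
    ∑ j ∈ Finset.range (w * q), (if q ∣ j then (1 : ℤ) else 0) = w := by
  induction w with
  | zero => simp
  | succ w ih =>
    rw [Nat.succ_mul, Finset.sum_range_add, ih]
    have : ∑ j ∈ Finset.range q, (if q ∣ w * q + j then (1 : ℤ) else 0) = 1 := by
      rw [Finset.sum_eq_single_of_mem 0 (Finset.mem_range.2 hq)]
      · simp
      · intro j hj hj0
        rw [if_neg]
        rw [Nat.dvd_add_right (Nat.dvd_mul_left q w)]
        intro hd
        exact absurd (Nat.le_of_dvd (Nat.pos_of_ne_zero hj0) hd)
          (not_le.2 (Finset.mem_range.1 hj))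
    rw [this]; push_cast; ring

/-- The rounded-up heights of the lattice columns on a lattice segment. -/
theorem sum_ceil_add_ceil {n w : ℕ} (hn : 0 < n) {p : ℤ} (hp : IsCoprime p n) (y : ℤ) :
    ∑ j ∈ Finset.range (w * n), (⌈(y : ℝ) - p * j / n⌉ + ⌈(y : ℝ) - p * (j + 1) / n⌉)
      = w * n * (2 * y - w * p + 1) - w := by
  have hn' : (n : ℝ) ≠ 0 := by exact_mod_cast hn.ne'
  -- Reversing the second sum pairs each column end with its image under the half-turn of the
  -- segment. The two heights add up to an integer, so their ceilings add up to that integer plus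
  -- one, except that there is no extra one when both heights are integral, which by coprimality
  -- means `n ∣ j`.
  rw [Finset.sum_add_distrib,
    ← Finset.sum_range_reflect (fun j : ℕ => ⌈(y : ℝ) - p * (j + 1) / n⌉), ← Finset.sum_add_distrib]
  have key : ∀ j ∈ Finset.range (w * n), ⌈(y : ℝ) - p * j / n⌉
      + ⌈(y : ℝ) - p * ((w * n - 1 - j : ℕ) + 1) / n⌉
        = (2 * y - w * p + 1) - (if n ∣ j then (1 : ℤ) else 0) := by
    intro j hj
    rw [Finset.mem_range] at hj
    have e1 : ((w * n - 1 - j : ℕ) : ℝ) + 1 = w * n - j := by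
      have : (w * n - 1 - j) + 1 + j = w * n := by omega
      have : (((w * n - 1 - j) + 1 + j : ℕ) : ℝ) = (w * n : ℕ) := by rw [this]
      push_cast at this ⊢
      linarith
    have e2 : (y : ℝ) - p * (w * n - j) / n = ((y - w * p : ℤ) : ℝ) + p * j / n := by
      push_cast; field_simp; ring
    have e3 : (y : ℝ) - p * j / n = (y : ℝ) + -(p * j / n) := by ring
    rw [e1, e2, e3, Int.ceil_intCast_add, Int.ceil_intCast_add, Int.ceil_neg]
    split_ifs with hd
    · obtain ⟨s, rfl⟩ := hd
      have : (p : ℝ) * (n * s : ℕ) / n = ((p * s : ℤ) : ℝ) := by push_cast; field_simp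
      rw [this, Int.floor_intCast, Int.ceil_intCast]; ring
    · have : ⌈(p : ℝ) * j / n⌉ = ⌊(p : ℝ) * j / n⌋ + 1 := by
        rw [Int.ceil_eq_floor_add_one_iff_notMem]
        rintro ⟨s, hs⟩
        apply hd
        rw [eq_div_iff hn'] at hs
        have hs' : s * n = p * j := by exact_mod_cast hs
        have : (n : ℤ) ∣ j := hp.symm.dvd_of_dvd_mul_left ⟨s, by rw [← hs']; ring⟩
        exact_mod_cast this
      rw [this]; ring
  rw [Finset.sum_congr rfl key, Finset.sum_sub_distrib, Nat.sum_range_mul_ite_dvd n w hn]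
  simp

theorem Int.sum_Ico_telescope {M : Type*} [AddCommGroup M] (f : ℤ → M) {a b : ℤ} (h : a ≤ b) :
    ∑ k ∈ Finset.Ico a b, (f (k + 1) - f k) = f b - f a := by
  obtain ⟨N, hN⟩ := Int.eq_ofNat_of_zero_le (sub_nonneg.2 h)
  obtain rfl : b = a + N := by omega
  rw [Int.sum_Ico_add_eq_sum_range]
  have := Finset.sum_range_sub (fun j : ℕ => f (a + j)) N
  simp only [Nat.cast_zero, add_zero] at this
  rw [← this]
  refine Finset.sum_congr rfl fun j _ => ?_
  push_cast; rw [add_assoc]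

/-! ### Pick's formula, counted column by column. -/

namespace LatticePolygon

variable {ι : Type} (D : LatticePolygon ι)

theorem support_eq_finish (i : ι) : D.support i = latticePairing (D.finish i) (D.normal i) := by
  simp only [support, finish, latticePairing]; ring

/-- The contribution of the column segment `[k, k + 1]` below the upper boundary. -/
def columnTerm (k : ℤ) : ℝ :=
  ((⌈D.top k⌉ + ⌈D.top (k + 1)⌉ - 1 : ℤ) : ℝ) - ((k + 1) * D.top (k + 1) - k * D.top k)

/-- Length times support is `∫ (T - x T') dx = 2 ∫ T dx - [x T]` over an upper side with height `T`.
The trapezoid sum of `T` over integer columns computes the integral exactly, and by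
`sum_ceil_add_ceil` replacing heights by ceilings minus the correction `1` per column changes it by
the lattice length of the side. -/
theorem sum_side {i : ι} (hi : 0 < (D.normal i).2) :
    ∑ k ∈ Finset.Ico (D.finish i).1 (D.start i).1, D.columnTerm k
      = D.length i * (D.support i - 1) := by
  obtain ⟨n, hn⟩ := Int.eq_ofNat_of_zero_le hi.le
  have hnpos : 0 < n := by omega
  have hn0 : (n : ℝ) ≠ 0 := by exact_mod_cast hnpos.ne'
  have hsx : (D.start i).1 = (D.finish i).1 + (D.length i * n : ℕ) := by
    simp only [finish]; rw [hn]; push_cast; ring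
  have hsy : (D.start i).2 = (D.finish i).2 - D.length i * (D.normal i).1 := by
    simp only [finish]; ring
  have hheight : ∀ s : ℝ, D.height i ((D.finish i).1 + s)
      = (D.finish i).2 - (D.normal i).1 * s / n := by
    intro s
    rw [height, support_eq_finish, hn]
    simp only [latticePairing]; rw [hn]; push_cast; field_simp; ring
  have hcov : ∀ k ∈ Finset.Ico (D.finish i).1 (D.start i).1, D.columnTerm k
      = ((⌈D.height i k⌉ + ⌈D.height i (k + 1)⌉ - 1 : ℤ) : ℝ)
        - (((k + 1 : ℤ) : ℝ) * D.height i ((k + 1 : ℤ) : ℝ) - k * D.height i k) := by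
    intro k hk
    rw [Finset.mem_Ico] at hk
    have hc : D.Covers i k := ⟨hi, hk.1, by omega⟩
    rw [columnTerm, hc.top_left, hc.top_right]
    push_cast; ring
  rw [Finset.sum_congr rfl hcov, Finset.sum_sub_distrib,
    Int.sum_Ico_telescope (fun k : ℤ => (k : ℝ) * D.height i k) (by rw [hsx]; omega)]
  have e1 : D.height i (D.start i).1 = (D.start i).2 := by
    have := hheight (D.length i * n : ℕ)
    rw [hsx]; push_cast at this ⊢; rw [this, hsy]; push_cast; field_simp
  have e2 : D.height i (D.finish i).1 = (D.finish i).2 := by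
    have := hheight 0
    simpa using this
  rw [e1, e2, ← Int.cast_sum, Finset.sum_sub_distrib]
  have e3 : ∑ k ∈ Finset.Ico (D.finish i).1 (D.start i).1,
      (⌈D.height i k⌉ + ⌈D.height i (k + 1)⌉)
        = D.length i * n * (2 * (D.finish i).2 - D.length i * (D.normal i).1 + 1)
          - D.length i := by
    have hp := D.primitive i
    rw [hn] at hp
    rw [← sum_ceil_add_ceil hnpos hp, hsx, Int.sum_Ico_add_eq_sum_range]
    refine Finset.sum_congr rfl fun j _ => ?_
    have h1 := hheight j
    have h2 := hheight (j + 1)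
    push_cast at h1 h2 ⊢
    rw [h1, add_assoc, h2]
  rw [e3]
  have e4 : ∑ k ∈ Finset.Ico (D.finish i).1 (D.start i).1, (1 : ℤ) = D.length i * n := by
    rw [Finset.sum_const, Int.card_Ico, hsx]; simp; positivity
  rw [e4, support_eq_finish, hsx, hsy]
  simp only [latticePairing]; rw [hn]; push_cast; ring

/-- Every column lies under exactly one upper side, so the columns can be regrouped by sides. -/
theorem sum_upper [Fintype ι] {a b : ℤ} (hab : ∀ p ∈ D.pts, a ≤ p.1 ∧ p.1 ≤ b)
    (ha : ∃ p ∈ D.pts, p.1 = a) (hb : ∃ p ∈ D.pts, p.1 = b) :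
    ∑ k ∈ Finset.Ico a b, D.columnTerm k
      = ∑ i, if 0 < (D.normal i).2 then (D.length i : ℝ) * (D.support i - 1) else 0 := by
  classical
  have h1 : ∀ k ∈ Finset.Ico a b, D.columnTerm k
      = ∑ i, if D.Covers i k then D.columnTerm k else 0 := by
    intro k hk
    rw [Finset.mem_Ico] at hk
    obtain ⟨p, hp, hpa⟩ := ha
    obtain ⟨q, hq, hqb⟩ := hb
    obtain ⟨i, hi⟩ := D.exists_covers (k := k) hp (by omega) hq (by omega)
    rw [Finset.sum_eq_single_of_mem i (Finset.mem_univ _), if_pos hi]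
    intro j _ hj
    exact if_neg fun h => hj (h.unique hi)
  rw [Finset.sum_congr rfl h1, Finset.sum_comm]
  refine Finset.sum_congr rfl fun i _ => ?_
  split_ifs with hi
  · rw [← D.sum_side hi, ← Finset.sum_filter]
    refine Finset.sum_congr ?_ fun _ _ => rfl
    ext k
    have h1 := hab _ (D.finish_mem i)
    have h2 := hab _ (D.start_mem i)
    change a ≤ (D.finish i).1 ∧ (D.finish i).1 ≤ b at h1
    rw [Finset.mem_filter]
    simp only [Finset.mem_Ico, Covers]
    omega
  · exact Finset.sum_eq_zero fun k _ => if_neg fun h => hi h.1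

/-- The mirror image of a polygon under `(x, y) ↦ (x, -y)`. -/
def reflect : LatticePolygon ι where
  pts := {a | (a.1, -a.2) ∈ D.pts}
  finite := D.finite.preimage fun a _ b _ h => by
    simp only [Prod.mk.injEq, neg_inj] at h
    exact Prod.ext h.1 h.2
  normal i := ((D.normal i).1, -(D.normal i).2)
  length := D.length
  -- A reflection reverses orientation, so the ends of each side are exchanged.
  start i := ((D.finish i).1, -(D.finish i).2)
  primitive i := (D.primitive i).neg_right
  length_pos := D.length_pos
  start_mem i := by
    change ((D.finish i).1, - -(D.finish i).2) ∈ D.pts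
    rw [neg_neg]; exact D.finish_mem i
  finish_mem i := by
    have : ((D.finish i).1 - D.length i * -(D.normal i).2,
        -(-(D.finish i).2 + D.length i * (D.normal i).1)) = D.start i := by
      simp only [finish]; ext <;> ring
    change ((D.finish i).1 - D.length i * -(D.normal i).2,
        -(-(D.finish i).2 + D.length i * (D.normal i).1)) ∈ D.pts
    rw [this]; exact D.start_mem i
  le_support i a ha := by
    have h := D.le_support i _ ha
    have e := D.support_eq_finish i
    simp only [latticePairing, support] at h e ⊢
    linarith
  side_subset i a ha h := by
    have e := D.support_eq_finish i
    obtain ⟨t, h0, h1, h2, h3⟩ := D.side_subset i _ ha (by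
      simp only [latticePairing, support] at h e ⊢
      linarith)
    refine ⟨D.length i - t, by linarith, by linarith, ?_, ?_⟩
    · simp only [finish] at h2 ⊢; push_cast; linarith
    · simp only [finish] at h3 ⊢; push_cast at h3 ⊢; linarith
  normal_injective i j h := by
    simp only [Prod.mk.injEq, neg_inj] at h
    exact D.normal_injective (Prod.ext h.1 h.2)
  complete u hu a ha b hb hab h hmax := by
    obtain ⟨i, hi⟩ := D.complete (u.1, -u.2) hu.neg_right _ ha _ hb
      (fun h => hab (by
        simp only [Prod.mk.injEq, neg_inj] at h
        exact Prod.ext h.1 h.2))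
      (by simp only [latticePairing] at h ⊢; linarith)
      (fun p hp => by
        have := hmax (p.1, -p.2) (by simpa using hp)
        simp only [latticePairing] at this ⊢; linarith)
    exact ⟨i, by rw [hi]; simp⟩
  noncollinear u hu := by
    obtain ⟨a, ha, b, hb, h⟩ := D.noncollinear (u.1, -u.2) (fun h => hu (by
      simp only [Prod.mk_eq_zero, neg_eq_zero] at h
      exact Prod.ext h.1 h.2))
    refine ⟨(a.1, -a.2), by simpa using ha, (b.1, -b.2), by simpa using hb, ?_⟩
    simp only [latticePairing] at h ⊢; linarith

theorem support_reflect (i : ι) : D.reflect.support i = D.support i := by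
  rw [D.support_eq_finish]
  simp only [support, reflect, latticePairing]; ring

theorem mem_hull_reflect {x y : ℝ} : (x, y) ∈ D.reflect.hull ↔ (x, -y) ∈ D.hull := by
  let σ : ℝ × ℝ →ₗ[ℝ] ℝ × ℝ := LinearMap.prodMap LinearMap.id (-LinearMap.id)
  have hσ : ∀ z, σ z = (z.1, -z.2) := fun z => rfl
  have h1 : latticeToPlane '' D.reflect.pts = σ '' (latticeToPlane '' D.pts) := by
    ext z
    constructor
    · rintro ⟨a, ha, rfl⟩
      exact ⟨_, ⟨_, ha, rfl⟩, by simp [hσ, latticeToPlane]⟩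
    · rintro ⟨_, ⟨a, ha, rfl⟩, rfl⟩
      exact ⟨(a.1, -a.2), by simpa [reflect] using ha, by simp [hσ, latticeToPlane]⟩
  rw [hull, h1, ← LinearMap.image_convexHull]
  constructor
  · rintro ⟨z, hz, h⟩
    rw [hσ, Prod.mk.injEq] at h
    rw [← h.1, ← h.2, neg_neg]
    exact hz
  · intro h
    exact ⟨_, h, by simp [hσ]⟩

/-- The lower boundary of the polygon. -/
def bottom (x : ℝ) : ℝ := -D.reflect.top x

theorem exists_endpoints : ∃ a b : ℤ, a < b ∧ (∀ p ∈ D.pts, a ≤ p.1 ∧ p.1 ≤ b) ∧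
    (∃ p ∈ D.pts, p.1 = a) ∧ ∃ p ∈ D.pts, p.1 = b := by
  obtain ⟨p, hp, q, hq, h⟩ := D.noncollinear (1, 0) (by simp)
  obtain ⟨r, hr, hr'⟩ := Set.exists_min_image _ (fun p : ℤ × ℤ => p.1) D.finite ⟨p, hp⟩
  obtain ⟨s, hs, hs'⟩ := Set.exists_max_image _ (fun p : ℤ × ℤ => p.1) D.finite ⟨p, hp⟩
  refine ⟨r.1, s.1, ?_, fun p hp => ⟨hr' p hp, hs' p hp⟩, ⟨r, hr, rfl⟩, s, hs, rfl⟩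
  have h1 := hr' p hp
  have h2 := hs' q hq
  simp only [latticePairing] at h
  omega

section

variable {a b : ℤ}

theorem isGreatest_top (hlt : a < b) (ha : ∃ p ∈ D.pts, p.1 = a) (hb : ∃ p ∈ D.pts, p.1 = b)
    {k : ℤ} (h1 : a ≤ k) (h2 : k ≤ b) : IsGreatest {y | ((k : ℝ), y) ∈ D.hull} (D.top k) := by
  obtain ⟨p, hp, hpa⟩ := ha
  obtain ⟨q, hq, hqb⟩ := hb
  rcases lt_or_eq_of_le h2 with h2 | rfl
  · obtain ⟨i, hi⟩ := D.exists_covers (k := k) hp (by omega) hq (by omega)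
    rw [hi.top_left]; exact hi.isGreatest_left
  -- No column starts at the right end of the polygon; the one ending there is used instead.
  · obtain ⟨i, hi⟩ := D.exists_covers (k := k - 1) hp (by omega) hq (by omega)
    have e : (((k - 1 : ℤ) : ℝ) + 1) = k := by push_cast; ring
    have h3 := hi.top_right
    have h4 := hi.isGreatest_right
    rw [e] at h3 h4
    rw [h3]; exact h4

/-- The upper side over the last column cannot extend beyond the extreme abscissa, so its end is a
lattice point there. -/
theorem exists_top_right (hlt : a < b) (hab : ∀ p ∈ D.pts, a ≤ p.1 ∧ p.1 ≤ b)
    (ha : ∃ p ∈ D.pts, p.1 = a) (hb : ∃ p ∈ D.pts, p.1 = b) :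
    ∃ t : ℤ, D.top b = t ∧ (b, t) ∈ D.pts := by
  obtain ⟨p, hp, hpa⟩ := ha
  obtain ⟨q, hq, hqb⟩ := hb
  obtain ⟨i, hi⟩ := D.exists_covers (k := b - 1) hp (by omega) hq (by omega)
  have e : (((b - 1 : ℤ) : ℝ) + 1) = b := by push_cast; ring
  have h3 := hi.top_right
  rw [e] at h3
  have h4 : (D.start i).1 = b := by
    have := (hab _ (D.start_mem i)).2
    have := hi.2.2
    omega
  refine ⟨(D.start i).2, ?_, ?_⟩
  · have hi' : ((D.normal i).2 : ℝ) ≠ 0 := by exact_mod_cast hi.1.ne'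
    rw [h3, height, support, latticePairing, ← h4]
    push_cast; field_simp; ring
  · rw [← h4]; exact D.start_mem i

theorem exists_top_left (hlt : a < b) (hab : ∀ p ∈ D.pts, a ≤ p.1 ∧ p.1 ≤ b)
    (ha : ∃ p ∈ D.pts, p.1 = a) (hb : ∃ p ∈ D.pts, p.1 = b) :
    ∃ t : ℤ, D.top a = t ∧ (a, t) ∈ D.pts := by
  obtain ⟨p, hp, hpa⟩ := ha
  obtain ⟨q, hq, hqb⟩ := hb
  obtain ⟨i, hi⟩ := D.exists_covers (k := a) hp (by omega) hq (by omega)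
  have h4 : (D.finish i).1 = a := by
    have : a ≤ (D.finish i).1 := (hab _ (D.finish_mem i)).1
    have := hi.2.1
    omega
  refine ⟨(D.finish i).2, ?_, ?_⟩
  · have hi' : ((D.normal i).2 : ℝ) ≠ 0 := by exact_mod_cast hi.1.ne'
    rw [hi.top_left, height, support_eq_finish, latticePairing, ← h4]
    push_cast; field_simp; ring
  · rw [← h4]; exact D.finish_mem i

/-- The contribution of a vertical side. -/
theorem sum_vertical [Fintype ι] {s x t t' : ℤ} (hs : s = 1 ∨ s = -1)
    (hx : ∀ p ∈ D.pts, s * p.1 ≤ s * x) (ht : (x, t) ∈ D.pts) (ht' : (x, t') ∈ D.pts)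
    (hcol : ∀ y, (x, y) ∈ D.pts → t' ≤ y ∧ y ≤ t) :
    (∑ i, if D.normal i = (s, 0) then (D.length i : ℝ) * (D.support i - 1) else 0)
      = ((t : ℝ) - t') * (s * x - 1) := by
  classical
  by_cases hex : ∃ i, D.normal i = (s, 0)
  · obtain ⟨i, hi⟩ := hex
    rw [Finset.sum_eq_single_of_mem i (Finset.mem_univ _), if_pos hi]
    swap
    · intro j _ hj
      exact if_neg fun h => hj (D.normal_injective (h.trans hi.symm))
    have hsup : D.support i = s * x := by
      apply le_antisymm
      · have := hx _ (D.start_mem i)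
        simp only [support, latticePairing, hi]; linarith
      · have := D.le_support i _ ht
        simp only [support, latticePairing, hi] at this ⊢; linarith
    have hsx : (D.start i).1 = x := by
      simp only [support, latticePairing, hi] at hsup
      rcases hs with rfl | rfl <;> linarith
    have hfin := D.finish_mem i
    have hst := D.start_mem i
    rw [hi] at hfin
    simp only [mul_zero, sub_zero, hsx] at hfin
    have h1 := hcol _ hfin
    have h2 := hcol (D.start i).2 (by rw [← hsx]; exact hst)
    obtain ⟨τ, h3, h4, -, h5⟩ := D.side_subset i _ ht (by
      change _ = D.support i
      rw [hsup]; simp only [latticePairing, hi]; ring)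
    obtain ⟨τ', h6, h7, -, h8⟩ := D.side_subset i _ ht' (by
      change _ = D.support i
      rw [hsup]; simp only [latticePairing, hi]; ring)
    rw [hi] at h5 h8
    simp only at h5 h8
    have hlen : (D.length i : ℝ) = t - t' := by
      have h1' : (t' : ℝ) ≤ (D.start i).2 + D.length i * s ∧
        ((D.start i).2 + D.length i * s : ℝ) ≤ t := by exact_mod_cast h1
      have h2' : (t' : ℝ) ≤ (D.start i).2 ∧ ((D.start i).2 : ℝ) ≤ t := by exact_mod_cast h2
      rcases hs with rfl | rfl
      · push_cast at h5 h8 h1'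
        linarith [h1'.1, h1'.2, h2'.1, h2'.2]
      · push_cast at h5 h8 h1'
        linarith [h1'.1, h1'.2, h2'.1, h2'.2]
    rw [hlen, hsup]; push_cast; ring
  -- Two distinct extreme points on the vertical support line would yield a side by completeness;
  -- without one the column is a single point and contributes zero.
  · have : t = t' := by
      by_contra hne
      apply hex
      apply D.complete (s, 0) _ _ ht _ ht' (by simpa using hne)
      · simp only [latticePairing]; ring
      · intro p hp
        have := hx p hp
        simp only [latticePairing]; linarith
      · rcases hs with rfl | rfl
        · exact isCoprime_one_left
        · exact isCoprime_one_left.neg_left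
    rw [this, sub_self, zero_mul]
    exact Finset.sum_eq_zero fun i _ => if_neg fun h => hex ⟨i, h⟩

theorem reflect_fst {P : ℤ → Prop} (h : ∀ p ∈ D.pts, P p.1) : ∀ p ∈ D.reflect.pts, P p.1 :=
  fun p hp => h (p.1, -p.2) hp

theorem reflect_exists_fst {P : ℤ → Prop} (h : ∃ p ∈ D.pts, P p.1) :
    ∃ p ∈ D.reflect.pts, P p.1 := by
  obtain ⟨p, hp, hP⟩ := h
  exact ⟨(p.1, -p.2), by simpa [reflect] using hp, hP⟩

theorem isLeast_bottom (hlt : a < b) (ha : ∃ p ∈ D.pts, p.1 = a) (hb : ∃ p ∈ D.pts, p.1 = b)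
    {k : ℤ} (h1 : a ≤ k) (h2 : k ≤ b) :
    IsLeast {y | ((k : ℝ), y) ∈ D.hull} (D.bottom k) := by
  have h := D.reflect.isGreatest_top hlt (D.reflect_exists_fst (P := (· = a)) ha)
    (D.reflect_exists_fst (P := (· = b)) hb) h1 h2
  refine ⟨D.mem_hull_reflect.1 h.1, fun y hy => ?_⟩
  have : (-y) ∈ {y | ((k : ℝ), y) ∈ D.reflect.hull} := by
    change _ ∈ D.reflect.hull
    rw [mem_hull_reflect, neg_neg]; exact hy
  have := h.2 this
  rw [bottom]; linarith

/-- The width between the lines of an upper and a lower side over `k` is affine and nonnegative at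
both extreme abscissas. If it vanished strictly between them it would vanish identically, forcing
all points onto one line. -/
theorem bottom_lt_top (ha : ∃ p ∈ D.pts, p.1 = a) (hb : ∃ p ∈ D.pts, p.1 = b)
    {k : ℤ} (h1 : a < k) (h2 : k < b) : D.bottom k < D.top k := by
  have hlt := h1.trans h2
  have hT := D.isGreatest_top hlt ha hb h1.le h2.le
  have hB := D.isLeast_bottom hlt ha hb h1.le h2.le
  refine lt_of_le_of_ne (hB.2 hT.1) fun heq => ?_
  obtain ⟨p, hp, hpa⟩ := id ha
  obtain ⟨q, hq, hqb⟩ := id hb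
  obtain ⟨i, hi⟩ := D.exists_covers (k := k) hp (by omega) hq (by omega)
  obtain ⟨p', hp', hpa'⟩ := D.reflect_exists_fst (P := (· = a)) ha
  obtain ⟨q', hq', hqb'⟩ := D.reflect_exists_fst (P := (· = b)) hb
  obtain ⟨j, hj⟩ := D.reflect.exists_covers (k := k) hp' (by omega) hq' (by omega)
  rw [bottom, hj.top_left, hi.top_left] at heq
  have hbd : ∀ r ∈ D.pts, -D.reflect.height j r.1 ≤ r.2 ∧ (r.2 : ℝ) ≤ D.height i r.1 := by
    intro r hr
    refine ⟨?_, D.le_height_of_mem_hull (D.mem_hull hr) hi.1⟩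
    have h : ((r.1 : ℝ), -(r.2 : ℝ)) ∈ D.reflect.hull := by
      rw [mem_hull_reflect, neg_neg]; exact D.mem_hull hr
    linarith [D.reflect.le_height_of_mem_hull h hj.1]
  -- the two boundary lines agree at `k`, so they agree everywhere
  obtain ⟨α, β, hαβ⟩ : ∃ α β : ℝ, ∀ x, D.height i x + D.reflect.height j x = α * x + β := by
    refine ⟨-((D.normal i).1 / (D.normal i).2) - (D.reflect.normal j).1 / (D.reflect.normal j).2,
      D.support i / (D.normal i).2 + D.reflect.support j / (D.reflect.normal j).2,
      fun x => ?_⟩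
    simp only [height]; ring
  have hk := hαβ k
  have hpp := hbd p hp
  have hqq := hbd q hq
  have hp1 := hαβ p.1
  have hq1 := hαβ q.1
  rw [hpa] at hpp hp1
  rw [hqb] at hqq hq1
  have h1' : (a : ℝ) < k := by exact_mod_cast h1
  have h2' : (k : ℝ) < b := by exact_mod_cast h2
  have hα : α = 0 := by
    have hβ : β = -α * k := by linarith
    have e1 : 0 ≤ α * (a - k) := by nlinarith [hpp.1, hpp.2]
    have e2 : 0 ≤ α * (b - k) := by nlinarith [hqq.1, hqq.2]
    apply le_antisymm
    · by_contra h; push Not at h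
      nlinarith
    · by_contra h; push Not at h
      nlinarith
  have hβ : β = 0 := by rw [hα] at hk; linarith
  obtain ⟨r, hr, s, hs, hrs⟩ := D.noncollinear _ (ne_zero_of_isCoprime (D.primitive i))
  have hval : ∀ r ∈ D.pts, (latticePairing r (D.normal i) : ℝ) = D.support i := by
    intro r hr
    have h3 := hbd r hr
    have h4 := hαβ r.1
    rw [hα, hβ] at h4
    have h5 : (r.2 : ℝ) = D.height i r.1 := le_antisymm h3.2 (by linarith)
    have hi' : ((D.normal i).2 : ℝ) ≠ 0 := by exact_mod_cast hi.1.ne'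
    rw [height, eq_div_iff hi'] at h5
    simp only [latticePairing]; push_cast; linarith
  have := (hval r hr).trans (hval s hs).symm
  have : latticePairing r (D.normal i) = latticePairing s (D.normal i) := by exact_mod_cast this
  omega

/-- Interior points can be moved a little in the four axis directions. Conversely, a functional
separating `m` from the interior is weakly maximal at `m` on the hull: the points above and below
`m` kill its second coefficient, the leftmost and rightmost points the first, and the zero
functional cannot separate strictly. -/
theorem mem_interior_hull_iff (hne : (interior D.hull).Nonempty) (hlt : a < b)
    (hab : ∀ p ∈ D.pts, a ≤ p.1 ∧ p.1 ≤ b)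
    (ha : ∃ p ∈ D.pts, p.1 = a) (hb : ∃ p ∈ D.pts, p.1 = b) (m : ℤ × ℤ) :
    latticeToPlane m ∈ interior D.hull ↔
      (a < m.1 ∧ m.1 < b) ∧ D.bottom m.1 < m.2 ∧ (m.2 : ℝ) < D.top m.1 := by
  have hle : ∀ z ∈ D.hull, (a : ℝ) ≤ z.1 ∧ z.1 ≤ b := by
    intro z hz
    have h1 := D.le_of_mem_hull (α := -1) (β := 0) (γ := -a) (fun p hp => by
      have : (a : ℝ) ≤ p.1 := by exact_mod_cast (hab p hp).1
      linarith) hz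
    have h2 := D.le_of_mem_hull (α := 1) (β := 0) (γ := b) (fun p hp => by
      have : (p.1 : ℝ) ≤ b := by exact_mod_cast (hab p hp).2
      linarith) hz
    constructor <;> linarith
  constructor
  · intro hm
    have hev : ∀ w : ℝ × ℝ, ∃ δ > (0 : ℝ), latticeToPlane m + δ • w ∈ D.hull := by
      intro w
      have hcont : Continuous fun δ : ℝ => latticeToPlane m + δ • w := by fun_prop
      have h1 : ∀ᶠ δ in 𝓝 (0 : ℝ), latticeToPlane m + δ • w ∈ D.hull := by
        apply hcont.continuousAt.eventually
        simp only [zero_smul, add_zero]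
        exact mem_interior_iff_mem_nhds.1 hm
      obtain ⟨δ, h2, h3⟩ := ((h1.filter_mono nhdsWithin_le_nhds).and
        (self_mem_nhdsWithin : ∀ᶠ δ in 𝓝[>] (0 : ℝ), 0 < δ)).exists
      exact ⟨δ, h3, h2⟩
    have hm1 : a < m.1 ∧ m.1 < b := by
      obtain ⟨δ, hδ, h⟩ := hev (-1, 0)
      obtain ⟨δ', hδ', h'⟩ := hev (1, 0)
      have h1 := (hle _ h).1
      have h2 := (hle _ h').2
      simp only [latticeToPlane, Prod.fst_add, Prod.smul_fst, smul_eq_mul] at h1 h2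
      constructor
      · have : (a : ℝ) < m.1 := by linarith
        exact_mod_cast this
      · have : (m.1 : ℝ) < b := by linarith
        exact_mod_cast this
    refine ⟨hm1, ?_, ?_⟩
    · obtain ⟨δ, hδ, h⟩ := hev (0, -1)
      have := (D.isLeast_bottom hlt ha hb hm1.1.le hm1.2.le).2
        (show ((m.2 : ℝ) - δ) ∈ _ by
          simpa [latticeToPlane, sub_eq_add_neg] using h)
      linarith
    · obtain ⟨δ, hδ, h⟩ := hev (0, 1)
      have := (D.isGreatest_top hlt ha hb hm1.1.le hm1.2.le).2
        (show ((m.2 : ℝ) + δ) ∈ _ by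
          simpa [latticeToPlane] using h)
      linarith
  · rintro ⟨hm1, hbm, htm⟩
    by_contra hm
    obtain ⟨f, hf⟩ := geometric_hahn_banach_open_point (convex_convexHull ℝ _).interior
      isOpen_interior hm
    have hcl : D.hull ⊆ closure (interior D.hull) := by
      rw [D.convex_hull.closure_interior_eq_closure_of_nonempty_interior hne]
      exact subset_closure
    have hf' : ∀ z ∈ D.hull, f z ≤ f (latticeToPlane m) := by
      intro z hz
      have : closure (interior D.hull) ⊆ {z | f z ≤ f (latticeToPlane m)} :=
        closure_minimal (fun z hz => (hf z hz).le)
          (isClosed_le f.continuous continuous_const)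
      exact this (hcl hz)
    have hlin : ∀ x y : ℝ, f (x, y) = x * f (1, 0) + y * f (0, 1) := by
      intro x y
      rw [← smul_eq_mul, ← smul_eq_mul, ← map_smul, ← map_smul, ← map_add]
      simp
    have hmval : f (latticeToPlane m) = m.1 * f (1, 0) + m.2 * f (0, 1) := hlin _ _
    have h1 := hf' _ (D.isGreatest_top hlt ha hb hm1.1.le hm1.2.le).1
    have h2 := hf' _ (D.isLeast_bottom hlt ha hb hm1.1.le hm1.2.le).1
    rw [hlin, hmval] at h1 h2
    have hf2 : f (0, 1) = 0 := by
      apply le_antisymm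
      · by_contra h; push Not at h; nlinarith
      · by_contra h; push Not at h; nlinarith
    obtain ⟨p, hp, hpa⟩ := ha
    obtain ⟨q, hq, hqb⟩ := hb
    have h3 := hf' _ (D.mem_hull hp)
    have h4 := hf' _ (D.mem_hull hq)
    rw [hmval, latticeToPlane, hlin, hf2] at h3 h4
    rw [hpa] at h3
    rw [hqb] at h4
    have hm1' : (a : ℝ) < m.1 := by exact_mod_cast hm1.1
    have hm2' : (m.1 : ℝ) < b := by exact_mod_cast hm1.2
    have hf1 : f (1, 0) = 0 := by
      apply le_antisymm
      · by_contra h; push Not at h; nlinarith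
      · by_contra h; push Not at h; nlinarith
    obtain ⟨z, hz⟩ := hne
    have h5 := hf z hz
    rw [hmval, ← Prod.mk.eta (p := z), hlin, hf1, hf2] at h5
    linarith

/-- The integers strictly between the lower and the upper boundary are counted in each column; the
ceiling and floor make the endpoint conventions strict. -/
theorem ncard_interior (hne : (interior D.hull).Nonempty) (hlt : a < b)
    (hab : ∀ p ∈ D.pts, a ≤ p.1 ∧ p.1 ≤ b)
    (ha : ∃ p ∈ D.pts, p.1 = a) (hb : ∃ p ∈ D.pts, p.1 = b) :
    (Set.ncard {m : ℤ × ℤ | latticeToPlane m ∈ interior D.hull} : ℤ)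
      = ∑ k ∈ Finset.Ioo a b, (⌈D.top k⌉ - ⌊D.bottom k⌋ - 1) := by
  classical
  have hset : {m : ℤ × ℤ | latticeToPlane m ∈ interior D.hull}
      = ((Finset.Ioo a b).biUnion fun k : ℤ =>
        (Finset.Ioo ⌊D.bottom k⌋ ⌈D.top k⌉).image fun y => (k, y) : Finset (ℤ × ℤ)) := by
    ext ⟨x, y⟩
    rw [Set.mem_ofPred_eq, D.mem_interior_hull_iff hne hlt hab ha hb]
    simp only [Finset.coe_biUnion, Finset.coe_image, Set.mem_iUnion, Set.mem_image,
      Finset.mem_coe, Finset.mem_Ioo, Int.floor_lt, Int.lt_ceil]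
    constructor
    · rintro ⟨h1, h2⟩
      exact ⟨x, h1, y, h2, rfl⟩
    · rintro ⟨k, h1, z, h2, h3⟩
      rw [Prod.mk.injEq] at h3
      obtain ⟨rfl, rfl⟩ := h3
      exact ⟨h1, h2⟩
  rw [hset, Set.ncard_coe_finset, Finset.card_biUnion]
  · push_cast
    refine Finset.sum_congr rfl fun k hk => ?_
    rw [Finset.mem_Ioo] at hk
    rw [Finset.card_image_of_injective _ (fun y z h => by simpa using h), Int.card_Ioo]
    have h := D.bottom_lt_top ha hb hk.1 hk.2
    have h' : ⌊D.bottom k⌋ < ⌈D.top k⌉ := by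
      have h1 := Int.floor_le (D.bottom k)
      have h2 := Int.le_ceil (D.top k)
      have : (⌊D.bottom k⌋ : ℝ) < ⌈D.top k⌉ := by linarith
      exact_mod_cast this
    omega
  · intro k _ l _ hkl
    rw [Function.onFun, Finset.disjoint_left]
    intro z hz hz'
    simp only [Finset.mem_image] at hz hz'
    obtain ⟨_, _, rfl⟩ := hz
    obtain ⟨_, _, h⟩ := hz'
    rw [Prod.mk.injEq] at h
    exact hkl h.1.symm

end

/-- **Pick's formula**, with the area computed from the support function. -/
theorem pick [Fintype ι] (hne : (interior D.hull).Nonempty) :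
    ∑ i, (D.length i : ℤ) * D.support i
      = 2 * Set.ncard {m : ℤ × ℤ | latticeToPlane m ∈ interior D.hull}
        + ∑ i, (D.length i : ℤ) - 2 := by
  classical
  obtain ⟨a, b, hlt, hab, ha, hb⟩ := D.exists_endpoints
  have hab' : ∀ p ∈ D.reflect.pts, a ≤ p.1 ∧ p.1 ≤ b :=
    D.reflect_fst (P := fun x => a ≤ x ∧ x ≤ b) hab
  have ha' := D.reflect_exists_fst (P := (· = a)) ha
  have hb' := D.reflect_exists_fst (P := (· = b)) hb
  have hU := D.sum_upper hab ha hb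
  have hL := D.reflect.sum_upper hab' ha' hb'
  obtain ⟨tb, htb, htb'⟩ := D.exists_top_right hlt hab ha hb
  obtain ⟨ta, hta, hta'⟩ := D.exists_top_left hlt hab ha hb
  obtain ⟨sb, hsb, hsb'⟩ := D.reflect.exists_top_right hlt hab' ha' hb'
  obtain ⟨sa, hsa, hsa'⟩ := D.reflect.exists_top_left hlt hab' ha' hb'
  have hcol : ∀ (k : ℤ), a ≤ k → k ≤ b → ∀ y : ℤ, (k, y) ∈ D.pts →
      D.bottom k ≤ y ∧ (y : ℝ) ≤ D.top k := fun k h1 h2 y hy =>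
    ⟨(D.isLeast_bottom hlt ha hb h1 h2).2 (D.mem_hull hy),
      (D.isGreatest_top hlt ha hb h1 h2).2 (D.mem_hull hy)⟩
  have hR := D.sum_vertical (s := 1) (x := b) (t := tb) (t' := -sb) (Or.inl rfl)
    (fun p hp => by linarith [(hab p hp).2]) htb' hsb' (fun y hy => by
      have := hcol b hlt.le le_rfl y hy
      rw [bottom, hsb, htb] at this
      exact_mod_cast this)
  have hM := D.sum_vertical (s := -1) (x := a) (t := ta) (t' := -sa) (Or.inr rfl)
    (fun p hp => by linarith [(hab p hp).1]) hta' hsa' (fun y hy => by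
      have := hcol a le_rfl hlt.le y hy
      rw [bottom, hsa, hta] at this
      exact_mod_cast this)
  -- Sides are upper, lower or vertical according to the sign of the second coordinate of the
  -- normal; a primitive normal with zero second coordinate is `(1, 0)` or `(-1, 0)`.
  have hsplit : ∀ i, (D.length i : ℝ) * (D.support i - 1)
      = (if 0 < (D.normal i).2 then (D.length i : ℝ) * (D.support i - 1) else 0)
        + (if 0 < (D.reflect.normal i).2 then
            (D.reflect.length i : ℝ) * (D.reflect.support i - 1) else 0)
        + (if D.normal i = (1, 0) then (D.length i : ℝ) * (D.support i - 1) else 0)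
        + (if D.normal i = (-1, 0) then (D.length i : ℝ) * (D.support i - 1) else 0) := by
    intro i
    rw [support_reflect]
    change _ = _ + (if 0 < -(D.normal i).2 then
      (D.length i : ℝ) * (D.support i - 1) else 0) + _ + _
    have hp := D.primitive i
    rcases lt_trichotomy (D.normal i).2 0 with h | h | h
    · rw [if_neg (by omega), if_pos (by omega), if_neg, if_neg]
      · ring
      · intro e; rw [e] at h; simp at h
      · intro e; rw [e] at h; simp at h
    · rw [if_neg (by omega), if_neg (by omega)]
      rw [h, isCoprime_zero_right, Int.isUnit_iff] at hp
      rcases hp with hp | hp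
      · rw [if_pos (Prod.ext hp h), if_neg]
        · ring
        · intro e; rw [e] at hp; simp at hp
      · rw [if_neg, if_pos (Prod.ext hp h)]
        · ring
        · intro e; rw [e] at hp; simp at hp
    · rw [if_pos (by omega), if_neg (by omega), if_neg, if_neg]
      · ring
      · intro e; rw [e] at h; simp at h
      · intro e; rw [e] at h; simp at h
  have htotal : ∑ i, (D.length i : ℝ) * (D.support i - 1)
      = ∑ k ∈ Finset.Ico a b, (D.columnTerm k + D.reflect.columnTerm k)
        + ((tb : ℝ) + sb) * (b - 1) + (ta + sa) * (-a - 1) := by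
    rw [Finset.sum_congr rfl fun i _ => hsplit i, Finset.sum_add_distrib,
      Finset.sum_add_distrib, Finset.sum_add_distrib, hR, hM, ← hU, ← hL,
      Finset.sum_add_distrib]
    push_cast; ring
  set c : ℤ → ℤ := fun k => ⌈D.top k⌉ - ⌊D.bottom k⌋ - 1 with hc
  -- The upper and lower terms of a column combine into the count `c` at its two ends plus a
  -- telescoping part. Writing `c k + c (k + 1)` as `2 * c k` plus a difference leaves only boundary
  -- values besides twice the interior count.
  have hterm : ∀ k ∈ Finset.Ico a b, D.columnTerm k + D.reflect.columnTerm k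
      = ((2 * c k + (c (k + 1) - c k) : ℤ) : ℝ)
        - (((k + 1 : ℤ) * (D.top (k + 1 : ℤ) - D.bottom (k + 1 : ℤ)))
          - (k * (D.top k - D.bottom k))) := by
    intro k _
    have h1 : ∀ x : ℝ, ⌊D.bottom x⌋ = -⌈D.reflect.top x⌉ := fun x => by
      rw [bottom, Int.floor_neg]
    simp only [columnTerm, hc, h1]
    simp only [bottom]
    push_cast; ring
  rw [Finset.sum_congr rfl hterm, Finset.sum_sub_distrib,
    Int.sum_Ico_telescope (fun k : ℤ => (k : ℝ) * (D.top k - D.bottom k)) hlt.le,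
    ← Int.cast_sum, Finset.sum_add_distrib, Int.sum_Ico_telescope c hlt.le,
    ← Finset.mul_sum, ← Finset.Ioo_insert_left hlt,
    Finset.sum_insert Finset.left_notMem_Ioo, ← D.ncard_interior hne hlt hab ha hb] at htotal
  -- At an extreme abscissa `c` is the length of the vertical side minus one. The lengths cancel
  -- against the vertical contributions, and each end leaves `-1`, whence the `-2` in the formula.
  have hca : c a = ta + sa - 1 := by
    simp only [hc, bottom, hta, hsa, Int.ceil_intCast, Int.floor_neg]; ring
  have hcb : c b = tb + sb - 1 := by
    simp only [hc, bottom, htb, hsb, Int.ceil_intCast, Int.floor_neg]; ring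
  rw [hca, hcb, bottom, bottom, hta, htb, hsa, hsb] at htotal
  have hfinal : (∑ i, (D.length i : ℝ) * (D.support i - 1))
      = ((∑ i, (D.length i : ℤ) * D.support i - ∑ i, (D.length i : ℤ) : ℤ) : ℝ) := by
    rw [← Finset.sum_sub_distrib]
    push_cast
    exact Finset.sum_congr rfl fun i _ => by ring
  rw [hfinal] at htotal
  have : (∑ i, (D.length i : ℤ) * D.support i - ∑ i, (D.length i : ℤ) : ℤ)
      = 2 * (Set.ncard {m : ℤ × ℤ | latticeToPlane m ∈ interior D.hull} : ℤ) - 2 := by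
    have h2 : ((∑ i, (D.length i : ℤ) * D.support i - ∑ i, (D.length i : ℤ) : ℤ) : ℝ)
      = ((2 * (Set.ncard {m : ℤ × ℤ | latticeToPlane m ∈ interior D.hull} : ℤ) - 2 : ℤ) : ℝ) := by
      rw [htotal]; push_cast; ring
    exact_mod_cast h2
  linarith

end LatticePolygon

/-! ## Edges and half-edges of plane graphs -/

/-- The endpoints of a segment that is the convex hull of a set of lattice points lie in the
set. -/
theorem left_mem_of_convexHull_eq_segment {A : Set (ℤ × ℤ)} {m m' : ℤ × ℤ}
    (h : convexHull ℝ (latticeToPlane '' A) = segment ℝ (latticeToPlane m) (latticeToPlane m')) :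
    m ∈ A := by
  by_contra hm
  set d : ℝ × ℝ := latticeToPlane m' - latticeToPlane m with hd
  have hlin : IsLinearMap ℝ fun z : ℝ × ℝ => -(d.1 * z.1 + d.2 * z.2) :=
    ⟨fun x y => by simp only [Prod.fst_add, Prod.snd_add]; ring,
      fun c x => by simp only [Prod.smul_fst, Prod.smul_snd, smul_eq_mul]; ring⟩
  -- If `m` were missing, every point of `A` would lie strictly further along `d`. The hull would
  -- then stay in an open half-plane that excludes the endpoint `m`.
  have hsub : convexHull ℝ (latticeToPlane '' A) ⊆ {z : ℝ × ℝ | -(d.1 * z.1 + d.2 * z.2)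
      < -(d.1 * (latticeToPlane m).1 + d.2 * (latticeToPlane m).2)} := by
    apply convexHull_min _ (convex_halfSpace_lt hlin _)
    rintro _ ⟨a, ha, rfl⟩
    have h1 : latticeToPlane a ∈ segment ℝ (latticeToPlane m) (latticeToPlane m') := by
      rw [← h]; exact subset_convexHull _ _ ⟨a, ha, rfl⟩
    rw [segment_eq_image'] at h1
    obtain ⟨s, ⟨hs0, -⟩, hs⟩ := h1
    rw [← hd] at hs
    dsimp only at hs
    have hne : s • d ≠ 0 := by
      intro h0
      rw [h0, add_zero] at hs
      exact hm (by rw [latticeToPlane_injective hs]; exact ha)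
    have hs1 : 0 < s := lt_of_le_of_ne hs0 fun h => hne (by rw [← h, zero_smul])
    have hd0 : 0 < d.1 * d.1 + d.2 * d.2 := by
      have : ¬(d.1 = 0 ∧ d.2 = 0) := fun h0 => hne (by
        rw [show d = 0 from Prod.ext h0.1 h0.2, smul_zero])
      rcases not_and_or.1 this with h | h
      · have := mul_self_pos.2 h; nlinarith [mul_self_nonneg d.2]
      · have := mul_self_pos.2 h; nlinarith [mul_self_nonneg d.1]
    rw [Set.mem_ofPred_eq, ← hs]
    simp only [Prod.fst_add, Prod.snd_add, Prod.smul_fst, Prod.smul_snd, smul_eq_mul]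
    nlinarith [mul_pos hs1 hd0]
  have := hsub (h ▸ left_mem_segment ℝ _ _)
  rw [Set.mem_ofPred_eq] at this
  exact lt_irrefl _ this

theorem right_mem_of_convexHull_eq_segment {A : Set (ℤ × ℤ)} {m m' : ℤ × ℤ}
    (h : convexHull ℝ (latticeToPlane '' A) = segment ℝ (latticeToPlane m) (latticeToPlane m')) :
    m' ∈ A :=
  left_mem_of_convexHull_eq_segment (h.trans (segment_symm ..))

/-- A non-collinear set has direction space of dimension at least two, so its affine span is the
whole plane. -/
theorem interior_convexHull_nonempty_of_not_collinear {s : Set (ℝ × ℝ)} (hs : ¬ Collinear ℝ s) :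
    (interior (convexHull ℝ s)).Nonempty := by
  rw [interior_convexHull_nonempty_iff_affineSpan_eq_top]
  have hne : s.Nonempty := by
    rw [Set.nonempty_iff_ne_empty]
    rintro rfl
    exact hs (collinear_empty ℝ _)
  rw [← AffineSubspace.direction_eq_top_iff_of_nonempty ((affineSpan_nonempty ℝ).2 hne), direction_affineSpan]
  apply Submodule.eq_top_of_finrank_eq
  rw [collinear_iff_finrank_le_one] at hs
  have h1 := Submodule.finrank_le (vectorSpan ℝ s)
  have h2 : Module.finrank ℝ (ℝ × ℝ) = 2 := by simp
  omega

/-! ### Local structure of edges and half-edges. -/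

namespace PlaneGraph

variable (Γ : PlaneGraph)

/-- The point from which an edge emanates. -/
def origin : Γ.Edge → ℝ × ℝ :=
  Sum.elim (fun e => Γ.pos (Γ.graph.src e)) (fun r => Γ.pos (Γ.graph.root r))

/-- The parameters of the interior points of an edge. -/
def openRange : Γ.Edge → Set ℝ := Sum.elim (fun e => Set.Ioo 0 (Γ.graph.len e)) fun _ => Set.Ioi 0

/-- The parameters of the points of an edge, including its ends. -/
def closedRange : Γ.Edge → Set ℝ :=
  Sum.elim (fun e => Set.Icc 0 (Γ.graph.len e)) fun _ => Set.Ici 0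

/-- The closure of an edge in the plane. -/
def closedEdge (a : Γ.Edge) : Set (ℝ × ℝ) :=
  (fun t : ℝ => Γ.origin a + t • latticeToPlane (Γ.dir a)) '' Γ.closedRange a

variable {Γ}

theorem dir_primitive (a : Γ.Edge) : IsCoprime (Γ.dir a).1 (Γ.dir a).2 := by
  rcases a with e | r
  · exact Γ.edgeDir_primitive e
  · exact Γ.rayDir_primitive r

theorem mem_edgeInterior {a : Γ.Edge} {x : ℝ × ℝ} : x ∈ Γ.edgeInterior a ↔
    ∃ t ∈ Γ.openRange a, Γ.origin a + t • latticeToPlane (Γ.dir a) = x := by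
  rcases a with e | r
  · simp [edgeInterior, location, openRange, origin, dir]
  · simp [edgeInterior, location, openRange, origin, dir]

theorem openRange_subset (a : Γ.Edge) : Γ.openRange a ⊆ Γ.closedRange a := by
  rcases a with e | r
  · exact Set.Ioo_subset_Icc_self
  · exact Set.Ioi_subset_Ici_self

theorem edgeInterior_subset_closedEdge (a : Γ.Edge) : Γ.edgeInterior a ⊆ Γ.closedEdge a := by
  intro x hx
  obtain ⟨t, ht, h⟩ := mem_edgeInterior.1 hx
  exact ⟨t, openRange_subset a ht, h⟩

theorem isClosed_closedEdge (a : Γ.Edge) : IsClosed (Γ.closedEdge a) := by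
  have h1 : IsClosed (Γ.closedRange a) := by
    rcases a with e | r
    · exact isClosed_Icc
    · exact isClosed_Ici
  have h2 : IsClosedEmbedding fun t : ℝ => t • latticeToPlane (Γ.dir a) :=
    isClosedEmbedding_smul_left (latticeToPlane_ne_zero (dir_primitive a))
  have h3 := (Homeomorph.addLeft (Γ.origin a)).isClosedEmbedding.comp h2
  exact h3.isClosedMap _ h1

theorem edgeInterior_subset_carrier (a : Γ.Edge) : Γ.edgeInterior a ⊆ Γ.carrier := by
  rcases a with e | r
  · rintro x ⟨t, ht⟩
    exact ⟨_, ht⟩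
  · rintro x ⟨t, ht⟩
    exact ⟨_, ht⟩

theorem mem_carrier_iff {x : ℝ × ℝ} : x ∈ Γ.carrier ↔
    (∃ v, Γ.pos v = x) ∨ ∃ a, x ∈ Γ.edgeInterior a := by
  constructor
  · rintro ⟨p, hp⟩
    cases p with
    | vertex v => exact Or.inl ⟨v, by simpa [location] using hp⟩
    | inEdge e t => exact Or.inr ⟨.inl e, t, hp⟩
    | inRay r t => exact Or.inr ⟨.inr r, t, hp⟩
    | infty r => simp [location] at hp
  · rintro (⟨v, rfl⟩ | ⟨a, ha⟩)
    · exact ⟨.vertex v, rfl⟩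
    · exact edgeInterior_subset_carrier a ha

variable (Γ)

/-- The half-edges: the ends of bounded edges at their sources, those at their targets, and the
unbounded edges. -/
abbrev HalfEdge : Type := Γ.graph.E ⊕ Γ.graph.E ⊕ Γ.graph.R

/-- The vertex of a half-edge. -/
def base : Γ.HalfEdge → Γ.graph.V := Sum.elim Γ.graph.src (Sum.elim Γ.graph.tgt Γ.graph.root)

/-- The primitive vector of a half-edge that leaves its vertex. -/
def outDir : Γ.HalfEdge → ℤ × ℤ :=
  Sum.elim Γ.edgeDir (Sum.elim (fun e => -Γ.edgeDir e) Γ.rayDir)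

/-- The edge of a half-edge. -/
def edgeOf : Γ.HalfEdge → Γ.Edge := Sum.elim Sum.inl (Sum.elim Sum.inl Sum.inr)

variable {Γ}

theorem outDir_primitive (h : Γ.HalfEdge) : IsCoprime (Γ.outDir h).1 (Γ.outDir h).2 := by
  rcases h with e | e | r
  · exact Γ.edgeDir_primitive e
  · exact (Γ.edgeDir_primitive e).neg_neg
  · exact Γ.rayDir_primitive r

theorem outDir_eq_or (h : Γ.HalfEdge) :
    Γ.outDir h = Γ.dir (Γ.edgeOf h) ∨ Γ.outDir h = -Γ.dir (Γ.edgeOf h) := by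
  rcases h with e | e | r
  · exact Or.inl rfl
  · exact Or.inr rfl
  · exact Or.inl rfl

theorem src_ne_tgt (e : Γ.graph.E) : Γ.graph.src e ≠ Γ.graph.tgt e := by
  intro h
  have := Γ.pos_tgt e
  rw [← h, left_eq_add, smul_eq_zero] at this
  exact this.elim (Γ.graph.len_pos e).ne' (latticeToPlane_ne_zero (Γ.edgeDir_primitive e))

theorem norm_outDir_pos (h : Γ.HalfEdge) : 0 < ‖latticeToPlane (Γ.outDir h)‖ :=
  norm_pos_iff.2 (latticeToPlane_ne_zero (outDir_primitive h))

theorem mem_ball_add_smul {x u : ℝ × ℝ} (hu : 0 < ‖u‖) {r t : ℝ} :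
    x + t • u ∈ Metric.ball x r ↔ |t| < r / ‖u‖ := by
  rw [Metric.mem_ball, dist_self_add_left, norm_smul, Real.norm_eq_abs, lt_div_iff₀ hu]

theorem exists_forall_mem_edgeInterior (h : Γ.HalfEdge) : ∃ L : ℝ, 0 < L ∧ ∀ t : ℝ, 0 < t → t < L →
    Γ.pos (Γ.base h) + t • latticeToPlane (Γ.outDir h) ∈ Γ.edgeInterior (Γ.edgeOf h) := by
  rcases h with e | e | r
  · exact ⟨Γ.graph.len e, Γ.graph.len_pos e, fun t h1 h2 =>
      mem_edgeInterior.2 ⟨t, ⟨h1, h2⟩, rfl⟩⟩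
  · refine ⟨Γ.graph.len e, Γ.graph.len_pos e, fun t h1 h2 =>
      mem_edgeInterior.2 ⟨Γ.graph.len e - t, ⟨by linarith, by linarith⟩, ?_⟩⟩
    change Γ.pos (Γ.graph.src e) + (Γ.graph.len e - t) • latticeToPlane (Γ.edgeDir e)
      = Γ.pos (Γ.graph.tgt e) + t • latticeToPlane (-Γ.edgeDir e)
    rw [Γ.pos_tgt, latticeToPlane_neg, sub_smul, smul_neg]
    abel
  · exact ⟨1, one_pos, fun t h1 _ => mem_edgeInterior.2 ⟨t, h1, rfl⟩⟩

theorem eventually_mem_edgeInterior (h : Γ.HalfEdge) : ∀ᶠ t in 𝓝[>] (0 : ℝ),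
    Γ.pos (Γ.base h) + t • latticeToPlane (Γ.outDir h) ∈ Γ.edgeInterior (Γ.edgeOf h) := by
  obtain ⟨L, hL, h⟩ := exists_forall_mem_edgeInterior h
  filter_upwards [(eventually_lt_nhds hL).filter_mono nhdsWithin_le_nhds, self_mem_nhdsWithin]
    with t ht ht0
  exact h t ht0 ht

/-- Near its vertex, an edge is a segment in the direction of the half-edge. -/
theorem eventually_edgeOf_inter_ball (h : Γ.HalfEdge) : ∀ᶠ r in 𝓝[>] (0 : ℝ),
    (∀ z, z ∈ Γ.edgeInterior (Γ.edgeOf h) ∧ z ∈ Metric.ball (Γ.pos (Γ.base h)) r ↔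
      ∃ t ∈ Set.Ioo 0 (r / ‖latticeToPlane (Γ.outDir h)‖),
        z = Γ.pos (Γ.base h) + t • latticeToPlane (Γ.outDir h)) ∧
    Γ.pos (Γ.base h) + (r / ‖latticeToPlane (Γ.outDir h)‖) • latticeToPlane (Γ.outDir h)
      ∈ Γ.edgeInterior (Γ.edgeOf h) := by
  have hu := norm_outDir_pos h
  obtain ⟨L, hL, hrange⟩ := exists_forall_mem_edgeInterior h
  have hline : ∀ z ∈ Γ.edgeInterior (Γ.edgeOf h), ∃ t : ℝ, 0 < t ∧
      z = Γ.pos (Γ.base h) + t • latticeToPlane (Γ.outDir h) := by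
    intro z hz
    obtain ⟨t, ht, rfl⟩ := mem_edgeInterior.1 hz
    rcases h with e | e | r
    · exact ⟨t, ht.1, rfl⟩
    · refine ⟨Γ.graph.len e - t, sub_pos.2 ht.2, ?_⟩
      change Γ.pos (Γ.graph.src e) + t • latticeToPlane (Γ.edgeDir e)
        = Γ.pos (Γ.graph.tgt e) + (Γ.graph.len e - t) • latticeToPlane (-Γ.edgeDir e)
      rw [Γ.pos_tgt, latticeToPlane_neg, sub_smul, smul_neg, smul_neg]
      abel
    · exact ⟨t, ht, rfl⟩
  have hmem : ∀ᶠ r in 𝓝[>] (0 : ℝ), r < L * ‖latticeToPlane (Γ.outDir h)‖ :=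
    (eventually_lt_nhds (by positivity)).filter_mono nhdsWithin_le_nhds
  filter_upwards [hmem, self_mem_nhdsWithin] with r hr (hr0 : 0 < r)
  -- The half-edge leaves the ball at parameter `r / ‖u‖`. Keeping this below `L` makes the exit
  -- point an interior point of the edge, so that proper intersection can be applied there.
  have hrL : r / ‖latticeToPlane (Γ.outDir h)‖ < L := by rwa [div_lt_iff₀ hu]
  refine ⟨fun z => ⟨?_, ?_⟩, hrange _ (by positivity) hrL⟩
  · rintro ⟨h1, h2⟩
    obtain ⟨t, ht, rfl⟩ := hline z h1
    rw [mem_ball_add_smul hu, abs_of_pos ht] at h2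
    exact ⟨t, ⟨ht, h2⟩, rfl⟩
  · rintro ⟨t, ⟨h1, h2⟩, rfl⟩
    refine ⟨hrange t h1 (h2.trans hrL), ?_⟩
    rw [mem_ball_add_smul hu, abs_of_pos h1]
    exact h2

/-- Near one of its interior points, an edge is a segment. -/
theorem eventually_edgeInterior_inter_ball (a : Γ.Edge) {x : ℝ × ℝ} (hx : x ∈ Γ.edgeInterior a) :
    ∀ᶠ r in 𝓝[>] (0 : ℝ),
      (∀ z, z ∈ Γ.edgeInterior a ∧ z ∈ Metric.ball x r ↔
        ∃ t ∈ Set.Ioo (-(r / ‖latticeToPlane (Γ.dir a)‖)) (r / ‖latticeToPlane (Γ.dir a)‖),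
          z = x + t • latticeToPlane (Γ.dir a)) ∧
      x + (r / ‖latticeToPlane (Γ.dir a)‖) • latticeToPlane (Γ.dir a) ∈ Γ.edgeInterior a ∧
      x + (-(r / ‖latticeToPlane (Γ.dir a)‖)) • latticeToPlane (Γ.dir a) ∈ Γ.edgeInterior a := by
  have hu : 0 < ‖latticeToPlane (Γ.dir a)‖ :=
    norm_pos_iff.2 (latticeToPlane_ne_zero (dir_primitive a))
  obtain ⟨s, hs, rfl⟩ := mem_edgeInterior.1 hx
  have hopen : IsOpen (Γ.openRange a) := by
    rcases a with e | r
    · exact isOpen_Ioo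
    · exact isOpen_Ioi
  obtain ⟨L, hL, hLs⟩ := Metric.isOpen_iff.1 hopen s hs
  have hrange : ∀ t, |t| < L → Γ.origin a + s • latticeToPlane (Γ.dir a)
      + t • latticeToPlane (Γ.dir a) ∈ Γ.edgeInterior a := by
    intro t ht
    refine mem_edgeInterior.2 ⟨s + t, hLs ?_, by rw [add_smul, add_assoc]⟩
    rw [Metric.mem_ball, dist_self_add_left, Real.norm_eq_abs]; exact ht
  have hmem : ∀ᶠ r in 𝓝[>] (0 : ℝ), r < L * ‖latticeToPlane (Γ.dir a)‖ :=
    (eventually_lt_nhds (by positivity)).filter_mono nhdsWithin_le_nhds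
  filter_upwards [hmem, self_mem_nhdsWithin] with r hr (hr0 : 0 < r)
  have hrL : r / ‖latticeToPlane (Γ.dir a)‖ < L := by rwa [div_lt_iff₀ hu]
  have hpos : 0 < r / ‖latticeToPlane (Γ.dir a)‖ := by positivity
  refine ⟨fun z => ⟨?_, ?_⟩, hrange _ (by rwa [abs_of_pos hpos]),
    hrange _ (by rwa [abs_neg, abs_of_pos hpos])⟩
  · rintro ⟨h1, h2⟩
    obtain ⟨t, ht, rfl⟩ := mem_edgeInterior.1 h1
    refine ⟨t - s, ?_, by rw [sub_smul]; abel⟩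
    have e : Γ.origin a + t • latticeToPlane (Γ.dir a)
        = (Γ.origin a + s • latticeToPlane (Γ.dir a)) + (t - s) • latticeToPlane (Γ.dir a) := by
      rw [sub_smul]; abel
    rw [e, mem_ball_add_smul hu] at h2
    exact abs_lt.1 h2
  · rintro ⟨t, ht, rfl⟩
    have ht' : |t| < r / ‖latticeToPlane (Γ.dir a)‖ := abs_lt.2 ht
    exact ⟨hrange t (ht'.trans hrL), (mem_ball_add_smul hu).2 ht'⟩

theorem eventually_edgeInterior_inter_ball_empty (a : Γ.Edge) {x : ℝ × ℝ}
    (hx : x ∉ Γ.closedEdge a) :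
    ∀ᶠ r in 𝓝[>] (0 : ℝ), ∀ z ∈ Metric.ball x r, z ∉ Γ.edgeInterior a := by
  obtain ⟨R, hR, hRs⟩ := Metric.isOpen_iff.1 (isClosed_closedEdge a).isOpen_compl x hx
  filter_upwards [(eventually_lt_nhds hR).filter_mono nhdsWithin_le_nhds] with r hr z hz hza
  exact hRs (Metric.ball_subset_ball hr.le hz) (edgeInterior_subset_closedEdge a hza)

end PlaneGraph

/-! ### Consequences of embeddedness and balancing. -/

namespace TropicalPlaneCurve

variable {Γ : TropicalPlaneCurve}

theorem pos_injective : Function.Injective Γ.pos := fun v v' h => by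
  have := Γ.embedded (.vertex v) (.vertex v') _ rfl (by rw [h]; rfl)
  simpa using this

/-- A vertex in the closure of an edge is one of its ends. -/
theorem exists_halfEdge_of_mem_closedEdge {v : Γ.graph.V} {a : Γ.Edge}
    (h : Γ.pos v ∈ Γ.closedEdge a) : ∃ k : Γ.HalfEdge, Γ.base k = v ∧ Γ.edgeOf k = a := by
  obtain ⟨t, ht, he⟩ := h
  rcases a with e | r
  · change t ∈ Set.Icc 0 (Γ.graph.len e) at ht
    change Γ.pos (Γ.graph.src e) + t • latticeToPlane (Γ.edgeDir e) = Γ.pos v at he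
    rcases eq_or_lt_of_le ht.1 with h0 | h0
    · refine ⟨.inl e, ?_, rfl⟩
      exact pos_injective (by rw [← he, ← h0]; simp [PlaneGraph.base])
    · rcases eq_or_lt_of_le ht.2 with h1 | h1
      · refine ⟨.inr (.inl e), ?_, rfl⟩
        exact pos_injective (by rw [← he, h1, ← Γ.pos_tgt]; rfl)
      · have := Γ.embedded (.inEdge e ⟨t, h0, h1⟩) (.vertex v) (Γ.pos v)
          (by rw [← he]; rfl) rfl
        simp at this
  · change t ∈ Set.Ici (0 : ℝ) at ht
    change Γ.pos (Γ.graph.root r) + t • latticeToPlane (Γ.rayDir r) = Γ.pos v at he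
    rcases eq_or_lt_of_le (Set.mem_Ici.1 ht) with h0 | h0
    · refine ⟨.inr (.inr r), ?_, rfl⟩
      exact pos_injective (by rw [← he, ← h0]; simp [PlaneGraph.base])
    · have := Γ.embedded (.inRay r ⟨t, h0⟩) (.vertex v) (Γ.pos v) (by rw [← he]; rfl) rfl
      simp at this

/-- Interiors of edges are disjoint from the vertices. -/
theorem pos_notMem_edgeInterior (v : Γ.graph.V) (a : Γ.Edge) : Γ.pos v ∉ Γ.edgeInterior a := by
  rcases a with e | r
  · rintro ⟨t, ht⟩
    have := Γ.embedded _ (.vertex v) _ ht rfl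
    simp at this
  · rintro ⟨t, ht⟩
    have := Γ.embedded _ (.vertex v) _ ht rfl
    simp at this

/-- Interiors of edges are disjoint. -/
theorem edge_eq_of_mem_edgeInterior {x : ℝ × ℝ} {a b : Γ.Edge} (ha : x ∈ Γ.edgeInterior a)
    (hb : x ∈ Γ.edgeInterior b) : a = b := by
  rcases a with e | r <;> rcases b with e' | r' <;> obtain ⟨t, ht⟩ := ha <;>
    obtain ⟨t', ht'⟩ := hb <;> have := Γ.embedded _ _ _ ht ht'
  · simp only [MetricGraph.Point.inEdge.injEq] at this
    rw [this.1]
  · simp at this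
  · simp at this
  · simp only [MetricGraph.Point.inRay.injEq] at this
    rw [this.1]

/-- A point of a closed edge outside its interior is a vertex, and no vertex lies in the interior of
an edge. -/
theorem edge_eq_of_mem_closedEdge {x : ℝ × ℝ} {a b : Γ.Edge} (ha : x ∈ Γ.edgeInterior a)
    (hb : x ∈ Γ.closedEdge b) : a = b := by
  by_cases h : x ∈ Γ.edgeInterior b
  · exact edge_eq_of_mem_edgeInterior ha h
  · exfalso
    obtain ⟨t, ht, rfl⟩ := hb
    have hpos : ∃ v, Γ.pos v = Γ.origin b + t • latticeToPlane (Γ.dir b) := by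
      have hn : t ∉ Γ.openRange b := fun h' => h (PlaneGraph.mem_edgeInterior.2 ⟨t, h', rfl⟩)
      rcases b with e | r
      · change t ∈ Set.Icc 0 (Γ.graph.len e) at ht
        rcases eq_or_lt_of_le ht.1 with h0 | h0
        · exact ⟨Γ.graph.src e, by rw [← h0]; simp [PlaneGraph.origin]⟩
        · rcases eq_or_lt_of_le ht.2 with h1 | h1
          · exact ⟨Γ.graph.tgt e, by rw [h1, Γ.pos_tgt]; rfl⟩
          · exact absurd ⟨h0, h1⟩ hn
      · rcases eq_or_lt_of_le (Set.mem_Ici.1 ht) with h0 | h0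
        · exact ⟨Γ.graph.root r, by rw [← h0]; simp [PlaneGraph.origin]⟩
        · exact absurd h0 hn
    obtain ⟨v, hv⟩ := hpos
    exact pos_notMem_edgeInterior v a (hv ▸ ha)

theorem eventually_pos_notMem_ball (v : Γ.graph.V) :
    ∀ᶠ r in 𝓝[>] (0 : ℝ), ∀ v', v' ≠ v → Γ.pos v' ∉ Metric.ball (Γ.pos v) r := by
  rw [eventually_all]
  intro v'
  by_cases h : v' = v
  · exact Eventually.of_forall fun _ h' => absurd h h'
  · have hne : Γ.pos v' ≠ Γ.pos v := fun h' => h (pos_injective h')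
    filter_upwards [(eventually_lt_nhds (dist_pos.2 hne)).filter_mono nhdsWithin_le_nhds]
      with r hr _ hm
    exact absurd (Metric.mem_ball.1 hm) (not_lt.2 hr.le)

/-- Near a vertex, only the edges that end there are visible. -/
theorem eventually_edgeInterior_vertex (v : Γ.graph.V) :
    ∀ᶠ r in 𝓝[>] (0 : ℝ), ∀ a : Γ.Edge, (∀ k : Γ.HalfEdge, Γ.base k = v → Γ.edgeOf k ≠ a) →
      ∀ z ∈ Metric.ball (Γ.pos v) r, z ∉ Γ.edgeInterior a := by
  rw [eventually_all]
  intro a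
  by_cases h : Γ.pos v ∈ Γ.closedEdge a
  · obtain ⟨k, hk, hk'⟩ := exists_halfEdge_of_mem_closedEdge h
    exact Eventually.of_forall fun _ h' => absurd hk' (h' k hk)
  · filter_upwards [PlaneGraph.eventually_edgeInterior_inter_ball_empty a h] with r hr _
    exact hr

/-- The half-edges at a vertex have distinct directions. -/
theorem halfEdge_eq_of_outDir_eq {k k' : Γ.HalfEdge} (hb : Γ.base k = Γ.base k')
    (hd : Γ.outDir k = Γ.outDir k') : k = k' := by
  obtain ⟨r, h1, h2⟩ := ((PlaneGraph.eventually_edgeOf_inter_ball k).and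
    (PlaneGraph.eventually_edgeOf_inter_ball k')).exists
  -- With equal base and direction the two half-edges leave the ball at the same point, which is
  -- interior to both edges.
  have he : Γ.edgeOf k = Γ.edgeOf k' := by
    refine edge_eq_of_mem_edgeInterior h1.2 ?_
    rw [hb, hd]; exact h2.2
  rcases k with e | e | r <;> rcases k' with e' | e' | r' <;>
    simp only [PlaneGraph.edgeOf, Sum.elim_inl, Sum.elim_inr, Sum.inl.injEq, Sum.inr.injEq,
      reduceCtorEq] at he ⊢ <;> first | exact he | subst he
  -- There remain the two ends of a single bounded edge, which are at different vertices because a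
  -- straight edge cannot be a loop.
  · exact PlaneGraph.src_ne_tgt e hb
  · exact PlaneGraph.src_ne_tgt e hb.symm

/-- Near a vertex, a curve consists of the rays spanned by the half-edges. -/
theorem exists_halfEdge_of_mem_carrier (v : Γ.graph.V) :
    ∀ᶠ r in 𝓝[>] (0 : ℝ), ∀ z ∈ Metric.ball (Γ.pos v) r, z ∈ Γ.carrier → z ≠ Γ.pos v →
      ∃ k : Γ.HalfEdge, Γ.base k = v ∧ ∃ t : ℝ, 0 < t ∧
        z = Γ.pos v + t • latticeToPlane (Γ.outDir k) := by
  have h3 : ∀ᶠ r in 𝓝[>] (0 : ℝ), ∀ k : Γ.HalfEdge, _ :=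
    eventually_all.2 fun k => PlaneGraph.eventually_edgeOf_inter_ball k
  filter_upwards [eventually_pos_notMem_ball v, eventually_edgeInterior_vertex v, h3]
    with r h1 h2 h3 z hz hzc hne
  rcases PlaneGraph.mem_carrier_iff.1 hzc with ⟨v', rfl⟩ | ⟨a, ha⟩
  · by_cases h : v' = v
    · exact absurd (by rw [h]) hne
    · exact absurd hz (h1 v' h)
  · by_contra hcon
    refine h2 a (fun k hk hka => hcon ?_) z hz ha
    subst hk hka
    obtain ⟨t, ht, rfl⟩ := ((h3 k).1 z).1 ⟨ha, hz⟩
    exact ⟨k, rfl, t, ht.1, rfl⟩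

variable (Γ) in
/-- The weight of the edge of a half-edge. -/
def halfWeight (k : Γ.HalfEdge) : ℕ := Γ.weight (Γ.edgeOf k)

theorem halfWeight_pos (k : Γ.HalfEdge) : 0 < Γ.halfWeight k := by
  rcases k with e | e | r
  · exact Γ.edgeWeight_pos e
  · exact Γ.edgeWeight_pos e
  · exact Γ.rayWeight_pos r

-- The balancing condition is evaluated by the linear form of an exponent `m`: the outgoing slopes
-- of a monomial have weighted sum zero.
open Classical in
theorem balanced_halfEdge (v : Γ.graph.V) (m : ℤ × ℤ) :
    ∑ k : Γ.HalfEdge, (if Γ.base k = v then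
      (Γ.halfWeight k : ℤ) * latticePairing m (Γ.outDir k) else 0) = 0 := by
  let f : ℤ × ℤ →+ ℤ := ⟨⟨fun u => latticePairing m u, by simp [latticePairing]⟩, fun a b => by
    simp only [latticePairing, Prod.fst_add, Prod.snd_add]; ring⟩
  have h := congrArg f (Γ.balanced v)
  rw [map_add, map_add, map_sum, map_sum, map_sum, map_zero] at h
  rw [Fintype.sum_sum_type, Fintype.sum_sum_type, ← add_assoc]
  have key : ∀ (P : Prop) (w : ℤ) (u : ℤ × ℤ), f (if P then w • u else 0)
      = if P then w * latticePairing m u else 0 := by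
    intro P w u
    split_ifs
    · rw [map_zsmul, smul_eq_mul]; rfl
    · exact map_zero f
  simp only [key] at h
  exact h

end TropicalPlaneCurve

/-! ### The dual polygon of a vertex. -/

namespace DualSubdivision

variable {Γ : TropicalPlaneCurve} (N : DualSubdivision Γ)

theorem not_collinear (v : Γ.graph.V) :
    ¬ Collinear ℝ (latticeToPlane '' maximalExponents N.exponents N.coeff (Γ.pos v)) :=
  (N.vertex_iff _).1 ⟨v, rfl⟩

theorem exponents_nonempty_of_vertex (v : Γ.graph.V) : N.exponents.Nonempty := by
  rw [Finset.nonempty_iff_ne_empty]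
  intro h
  apply N.not_collinear v
  have : maximalExponents N.exponents N.coeff (Γ.pos v) = ∅ := by
    ext m; simp [maximalExponents, h]
  rw [this, Set.image_empty]
  exact collinear_empty ℝ _

/-- The dual cell of a half-edge, oriented by the half-edge. -/
theorem exists_dual_segment (k : Γ.HalfEdge) {x : ℝ × ℝ}
    (hx : x ∈ Γ.edgeInterior (Γ.edgeOf k)) : ∃ m : ℤ × ℤ,
    dualCell N.exponents N.coeff x = segment ℝ (latticeToPlane m)
      (latticeToPlane (m.1 - Γ.halfWeight k * (Γ.outDir k).2,
        m.2 + Γ.halfWeight k * (Γ.outDir k).1)) := by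
  obtain ⟨m, m', h, hseg⟩ := N.edge_dual _ x hx
  have h1 := congrArg Prod.fst h
  have h2 := congrArg Prod.snd h
  simp only [Prod.fst_sub, Prod.snd_sub, Prod.smul_fst, Prod.smul_snd, smul_eq_mul] at h1 h2
  rcases PlaneGraph.outDir_eq_or k with hk | hk
  · refine ⟨m, ?_⟩
    rw [hseg, hk]
    congr 2
    ext
    · simp only [TropicalPlaneCurve.halfWeight]; linarith
    · simp only [TropicalPlaneCurve.halfWeight]; linarith
  · refine ⟨m', ?_⟩
    rw [hseg, hk, segment_symm]
    congr 2
    ext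
    · simp only [TropicalPlaneCurve.halfWeight, Prod.snd_neg]; linarith
    · simp only [TropicalPlaneCurve.halfWeight, Prod.fst_neg]; linarith

/-- The side of the dual polygon of a vertex that is dual to a half-edge. -/
theorem exists_side (k : Γ.HalfEdge) : ∃ m : ℤ × ℤ,
    m ∈ maximalExponents N.exponents N.coeff (Γ.pos (Γ.base k)) ∧
    (m.1 - Γ.halfWeight k * (Γ.outDir k).2, m.2 + Γ.halfWeight k * (Γ.outDir k).1)
      ∈ maximalExponents N.exponents N.coeff (Γ.pos (Γ.base k)) ∧
    latticePairing m (Γ.outDir k)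
      = maxSlope N.exponents N.coeff (Γ.pos (Γ.base k)) (Γ.outDir k) ∧
    ∀ a ∈ maximalExponents N.exponents N.coeff (Γ.pos (Γ.base k)),
      latticePairing a (Γ.outDir k) = latticePairing m (Γ.outDir k) →
      latticeToPlane a ∈ segment ℝ (latticeToPlane m)
        (latticeToPlane (m.1 - Γ.halfWeight k * (Γ.outDir k).2,
          m.2 + Γ.halfWeight k * (Γ.outDir k).1)) := by
  have hS := N.exponents_nonempty_of_vertex (Γ.base k)
  -- At a point of the edge close to the vertex, the maximal exponents form the face of the vertex
  -- polygon in the direction of the half-edge. The dual segment of the edge is therefore the side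
  -- with that outer normal.
  obtain ⟨t, h1, h2⟩ := ((PlaneGraph.eventually_mem_edgeInterior k).and
    (eventually_mem_maximalExponents_iff (c := N.coeff) hS (Γ.pos (Γ.base k)) (Γ.outDir k))).exists
  obtain ⟨m, hm⟩ := N.exists_dual_segment k h1
  have hmA := (h2 m).1 (left_mem_of_convexHull_eq_segment hm)
  have hmA' := (h2 _).1 (right_mem_of_convexHull_eq_segment hm)
  refine ⟨m, hmA.1, hmA'.1, hmA.2, fun a ha ha' => ?_⟩
  rw [← hm]
  exact subset_convexHull _ _ ⟨a, (h2 a).2 ⟨ha, ha'.trans hmA.2⟩, rfl⟩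

/-- The start of the side dual to a half-edge. -/
def sideStart (k : Γ.HalfEdge) : ℤ × ℤ := (N.exists_side k).choose

/-- The dual polygon of a vertex, with its sides. -/
def dualPolygon (v : Γ.graph.V) : LatticePolygon {k : Γ.HalfEdge // Γ.base k = v} where
  pts := maximalExponents N.exponents N.coeff (Γ.pos v)
  finite := maximalExponents_finite _
  normal k := Γ.outDir k.1
  length k := Γ.halfWeight k.1
  start k := N.sideStart k.1
  primitive k := PlaneGraph.outDir_primitive k.1
  length_pos k := TropicalPlaneCurve.halfWeight_pos k.1
  start_mem := by
    rintro ⟨k, rfl⟩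
    exact (N.exists_side k).choose_spec.1
  finish_mem := by
    rintro ⟨k, rfl⟩
    exact (N.exists_side k).choose_spec.2.1
  le_support := by
    rintro ⟨k, rfl⟩ a ha
    exact (le_maxSlope ha _).trans_eq (N.exists_side k).choose_spec.2.2.1.symm
  side_subset := by
    rintro ⟨k, rfl⟩ a ha h
    have hs : latticeToPlane a ∈ segment ℝ (latticeToPlane (N.sideStart k))
        (latticeToPlane ((N.sideStart k).1 - Γ.halfWeight k * (Γ.outDir k).2,
          (N.sideStart k).2 + Γ.halfWeight k * (Γ.outDir k).1)) :=
      (N.exists_side k).choose_spec.2.2.2 a ha h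
    rw [segment_eq_image'] at hs
    obtain ⟨s, ⟨hs0, hs1⟩, hs⟩ := hs
    have hw : (0 : ℝ) ≤ Γ.halfWeight k := Nat.cast_nonneg _
    refine ⟨s * Γ.halfWeight k, by positivity, by nlinarith, ?_, ?_⟩
    · have := congrArg Prod.fst hs
      simp only [latticeToPlane, Prod.fst_add, Prod.smul_fst, Prod.fst_sub, smul_eq_mul] at this
      rw [← this]; push_cast; ring
    · have := congrArg Prod.snd hs
      simp only [latticeToPlane, Prod.snd_add, Prod.smul_snd, Prod.snd_sub, smul_eq_mul] at this
      rw [← this]; push_cast; ring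
  normal_injective := by
    rintro ⟨k, hk⟩ ⟨k', hk'⟩ h
    exact Subtype.ext (TropicalPlaneCurve.halfEdge_eq_of_outDir_eq (hk.trans hk'.symm) h)
  complete := by
    intro u hu a ha b hb hab h hmax
    have hS := N.exponents_nonempty_of_vertex v
    have hslope := maxSlope_eq ha hmax
    obtain ⟨r, hr, hr0⟩ := ((TropicalPlaneCurve.exists_halfEdge_of_mem_carrier v).and
      (self_mem_nhdsWithin : ∀ᶠ r in 𝓝[>] (0 : ℝ), 0 < r)).exists
    have hcont : Continuous fun t : ℝ => Γ.pos v + t • latticeToPlane u := by fun_prop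
    have hball : ∀ᶠ t in 𝓝[>] (0 : ℝ), Γ.pos v + t • latticeToPlane u
        ∈ Metric.ball (Γ.pos v) r := by
      apply (hcont.continuousAt.eventually _).filter_mono nhdsWithin_le_nhds
      simp only [zero_smul, add_zero]
      exact Metric.ball_mem_nhds _ hr0
    obtain ⟨t, ht, htb, ht0⟩ := ((eventually_mem_maximalExponents_iff (c := N.coeff) hS
      (Γ.pos v) u).and (hball.and (self_mem_nhdsWithin : ∀ᶠ r in 𝓝[>] (0 : ℝ), 0 < r))).exists
    -- Both ends `a` and `b` of the face remain maximal a little way along `u`, so the curve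
    -- contains points in that direction. Near `v` the curve consists of half-edges, so one of them
    -- has direction `u`.
    have hcar : Γ.pos v + t • latticeToPlane u ∈ Γ.carrier :=
      (N.mem_carrier_iff _).2 ⟨a, (ht a).2 ⟨ha, hslope.symm⟩, b,
        (ht b).2 ⟨hb, h.symm.trans hslope.symm⟩, hab⟩
    have hne : Γ.pos v + t • latticeToPlane u ≠ Γ.pos v := by
      intro h0
      rw [add_eq_left, smul_eq_zero] at h0
      exact h0.elim (ne_of_gt ht0) (latticeToPlane_ne_zero hu)
    obtain ⟨k, hk, s, hs, he⟩ := hr _ htb hcar hne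
    refine ⟨⟨k, hk⟩, ?_⟩
    exact eq_of_smul_eq_smul (PlaneGraph.outDir_primitive k) hu hs ht0 (add_left_cancel he).symm
  noncollinear := by
    intro u hu
    by_contra hcon
    push Not at hcon
    have heq : ∀ a ∈ maximalExponents N.exponents N.coeff (Γ.pos v),
        ∀ b ∈ maximalExponents N.exponents N.coeff (Γ.pos v),
        latticePairing a u = latticePairing b u := fun a ha b hb =>
      le_antisymm (hcon b hb a ha) (hcon a ha b hb)
    obtain ⟨a0, ha0⟩ := maximalExponents_nonempty (c := N.coeff)
      (N.exponents_nonempty_of_vertex v) (Γ.pos v)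
    apply N.not_collinear v
    rw [collinear_iff_exists_forall_eq_smul_vadd]
    -- With a constant pairing with `u`, all exponents lie on the line through `a0` orthogonal to
    -- `u`. The multiplier supplied below is the coefficient of orthogonal projection onto it.
    refine ⟨latticeToPlane a0, ((-(u.2 : ℝ)), (u.1 : ℝ)), ?_⟩
    rintro _ ⟨a, ha, rfl⟩
    have h := heq a ha a0 ha0
    have h' : (a.1 : ℝ) * u.1 + a.2 * u.2 = a0.1 * u.1 + a0.2 * u.2 := by
      simp only [latticePairing] at h; exact_mod_cast h
    have hu0 : (0 : ℝ) < u.1 * u.1 + u.2 * u.2 := by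
      have : ¬(u.1 = 0 ∧ u.2 = 0) := fun h0 => hu (Prod.ext h0.1 h0.2)
      have : 0 < u.1 * u.1 + u.2 * u.2 := by
        rcases not_and_or.1 this with h | h
        · have := mul_self_pos.2 h; nlinarith [mul_self_nonneg u.2]
        · have := mul_self_pos.2 h; nlinarith [mul_self_nonneg u.1]
      exact_mod_cast this
    have hu1 : (u.1 : ℝ) ^ 2 + (u.2 : ℝ) ^ 2 ≠ 0 := by
      rw [sq, sq]; exact hu0.ne'
    refine ⟨(-(a.1 - a0.1) * u.2 + (a.2 - a0.2) * u.1) / ((u.1 : ℝ) ^ 2 + (u.2 : ℝ) ^ 2), ?_⟩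
    ext
    · simp only [latticeToPlane, vadd_eq_add, Prod.fst_add, Prod.smul_fst, smul_eq_mul]
      field_simp
      linear_combination (u.1 : ℝ) * h'
    · simp only [latticeToPlane, vadd_eq_add, Prod.snd_add, Prod.smul_snd, smul_eq_mul]
      field_simp
      linear_combination (u.2 : ℝ) * h'

open Classical in
/-- The slopes at a vertex of the tropical polynomial that defines a curve: their weighted sum is
twice the area of the dual polygon, which Pick's formula computes. -/
theorem sum_maxSlope_vertex (v : Γ.graph.V) :
    ∑ k : Γ.HalfEdge, (if Γ.base k = v then (Γ.halfWeight k : ℤ)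
        * maxSlope N.exponents N.coeff (Γ.pos v) (Γ.outDir k) else 0)
      = 2 * N.vertexWeight v + (∑ k : Γ.HalfEdge, if Γ.base k = v then (Γ.halfWeight k : ℤ) else 0)
        - 2 := by
  have hpick := (N.dualPolygon v).pick
    (interior_convexHull_nonempty_of_not_collinear (N.not_collinear v))
  have h1 : ∀ g : Γ.HalfEdge → ℤ, ∑ k : Γ.HalfEdge, (if Γ.base k = v then g k else 0)
      = ∑ k : {k : Γ.HalfEdge // Γ.base k = v}, g k.1 := fun g => by
    rw [← Finset.sum_filter]
    exact Finset.sum_subtype _ (fun k => by simp) g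
  rw [h1, h1]
  refine Eq.trans (Finset.sum_congr rfl ?_) hpick
  rintro ⟨k, rfl⟩ _
  rw [← (N.exists_side k).choose_spec.2.2.1]
  rfl

end DualSubdivision

/-! ## Tropical lines -/

/-- The directions of the rays of a tropical line. -/
def tripodDirs : Finset (ℤ × ℤ) := {(-1, 0), (0, -1), (1, 1)}

theorem isCoprime_of_mem_tripodDirs {d : ℤ × ℤ} (hd : d ∈ tripodDirs) : IsCoprime d.1 d.2 := by
  simp only [tripodDirs, Finset.mem_insert, Finset.mem_singleton] at hd
  rcases hd with rfl | rfl | rfl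
  · exact isCoprime_one_left.neg_left
  · exact isCoprime_one_right.neg_right
  · exact isCoprime_one_left

/-- The curve consists of three unbounded edges of weight one with the standard directions, emanating
from `q`, and is defined by the tropical polynomial with coefficients `c` on the unit triangle. -/
structure IsTripod (Λ : TropicalPlaneCurve) (S : Finset (ℤ × ℤ)) (c : ℤ × ℤ → ℝ)
    (q : ℝ × ℝ) : Prop where
  exponents_eq : S = {(0, 0), (1, 0), (0, 1)}
  value_eq : ∀ m ∈ S, c m + planePairing m q = c (0, 0)
  mem_carrier_iff : ∀ x, x ∈ Λ.carrier ↔ (maximalExponents S c x).Nontrivial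
  nonempty_vertex : Nonempty Λ.graph.V
  pos_eq : ∀ v, Λ.pos v = q
  isEmpty_edge : IsEmpty Λ.graph.E
  rayWeight_eq : ∀ r, Λ.rayWeight r = 1
  rayDir_mem : ∀ r, Λ.rayDir r ∈ tripodDirs
  rayDir_injective : Function.Injective Λ.rayDir
  exists_rayDir : ∀ d ∈ tripodDirs, ∃ r, Λ.rayDir r = d

section Line

variable {Λ : TropicalPlaneCurve} (M : DualSubdivision Λ)

variable {M} in
/-- A half-plane contains the exponents of a curve of degree `d` if and only if it contains the
vertices of its Newton polygon. -/
theorem forall_exponents_le_iff {d : ℕ} (hM : M.HasDegree d) (α β γ : ℝ) :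
    (∀ m ∈ M.exponents, α * m.1 + β * m.2 ≤ γ) ↔ (0 ≤ γ ∧ α * d ≤ γ ∧ β * d ≤ γ) := by
  have hlin : IsLinearMap ℝ fun z : ℝ × ℝ => α * z.1 + β * z.2 :=
    ⟨fun x y => by simp only [Prod.fst_add, Prod.snd_add]; ring,
      fun c x => by simp only [Prod.smul_fst, Prod.smul_snd, smul_eq_mul]; ring⟩
  have hC := convex_halfSpace_le hlin γ
  have h1 := hC.convexHull_subset_iff (s := latticeToPlane '' (M.exponents : Set (ℤ × ℤ)))
  rw [hM, hC.convexHull_subset_iff] at h1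
  simp only [Set.insert_subset_iff, Set.singleton_subset_iff, Set.mem_ofPred_eq,
    Set.image_subset_iff, mul_zero, add_zero, zero_add] at h1
  rw [h1]
  rfl

variable {M} in
theorem exponents_bounds {d : ℕ} (hM : M.HasDegree d) {m : ℤ × ℤ} (hm : m ∈ M.exponents) :
    0 ≤ m.1 ∧ 0 ≤ m.2 ∧ m.1 + m.2 ≤ d := by
  have hd : (0 : ℝ) ≤ d := Nat.cast_nonneg d
  have h1 := (forall_exponents_le_iff hM (-1) 0 0).2 ⟨le_rfl, by linarith, by linarith⟩ m hm
  have h2 := (forall_exponents_le_iff hM 0 (-1) 0).2 ⟨le_rfl, by linarith, by linarith⟩ m hm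
  have h3 := (forall_exponents_le_iff hM 1 1 d).2 ⟨hd, by linarith, by linarith⟩ m hm
  refine ⟨?_, ?_, ?_⟩
  · have : (0 : ℝ) ≤ m.1 := by linarith
    exact_mod_cast this
  · have : (0 : ℝ) ≤ m.2 := by linarith
    exact_mod_cast this
  · have : (m.1 : ℝ) + m.2 ≤ d := by linarith
    exact_mod_cast this

/-- The triangle has only three lattice points, and none may be missing: a half-plane containing the
other two but not that vertex would contain the whole Newton polygon. -/
theorem exponents_eq_of_hasDegree_one (hM : M.HasDegree 1) :
    M.exponents = {(0, 0), (1, 0), (0, 1)} := by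
  have hsub := forall_exponents_le_iff hM
  simp only [Nat.cast_one, mul_one] at hsub
  have hcases : ∀ m ∈ M.exponents, m = (0, 0) ∨ m = (1, 0) ∨ m = (0, 1) := by
    rintro ⟨x, y⟩ hm
    obtain ⟨h1, h2, h3⟩ := exponents_bounds hM hm
    simp only [Nat.cast_one] at h1 h2 h3
    simp only [Prod.mk.injEq]
    omega
  ext m
  simp only [Finset.mem_insert, Finset.mem_singleton]
  refine ⟨hcases m, ?_⟩
  rintro (rfl | rfl | rfl)
  · by_contra h
    have := (hsub (-1) (-1) (-1)).1 (fun m hm => by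
      rcases hcases m hm with rfl | rfl | rfl
      · exact absurd hm h
      · norm_num
      · norm_num)
    linarith [this.1]
  · by_contra h
    have := (hsub 1 0 0).1 (fun m hm => by
      rcases hcases m hm with rfl | rfl | rfl
      · norm_num
      · exact absurd hm h
      · norm_num)
    linarith [this.2.1]
  · by_contra h
    have := (hsub 0 1 0).1 (fun m hm => by
      rcases hcases m hm with rfl | rfl | rfl
      · norm_num
      · norm_num
      · exact absurd hm h)
    linarith [this.2.2]

/-- The point `q` is where the three terms agree. A vertex needs a non-collinear cell, hence all
three exponents, so it sits at `q`; this excludes bounded edges. The rays are dual to the sides of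
the unit triangle, and all three occur because the points `q + d` lie on the curve. -/
theorem exists_isTripod (hM : M.HasDegree 1) : ∃ q, IsTripod Λ M.exponents M.coeff q := by
  have hS := exponents_eq_of_hasDegree_one M hM
  have mem_S : ∀ m, m ∈ M.exponents ↔ m = (0, 0) ∨ m = (1, 0) ∨ m = (0, 1) := by
    intro m; rw [hS]; simp
  set c := M.coeff with hc
  set q : ℝ × ℝ := (c (0, 0) - c (1, 0), c (0, 0) - c (0, 1)) with hq
  have hval : ∀ m ∈ M.exponents, c m + planePairing m q = c (0, 0) := by
    intro m hm
    rcases (mem_S m).1 hm with rfl | rfl | rfl <;> simp [planePairing, hq]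
  have hmaxq : ∀ m ∈ M.exponents, m ∈ maximalExponents M.exponents c q := fun m hm =>
    mem_maximalExponents.2 ⟨hm, fun n hn => by rw [hval m hm, hval n hn]⟩
  have hvalt : ∀ m ∈ M.exponents, ∀ (t : ℝ) d, c m + planePairing m (q + t • latticeToPlane d)
      = c (0, 0) + t * latticePairing m d := by
    intro m hm t d
    rw [planePairing_add, planePairing_smul_lattice, ← hval m hm]; ring
  have hpos : ∀ v, Λ.pos v = q := by
    intro v
    have hall : ∀ m ∈ M.exponents, m ∈ maximalExponents M.exponents c (Λ.pos v) := by
      intro m hm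
      by_contra hcon
      apply M.not_collinear v
      have hsub : ∀ n ∈ maximalExponents M.exponents c (Λ.pos v), n ∈ M.exponents ∧ n ≠ m :=
        fun n hn => ⟨hn.1, fun h => hcon (h ▸ hn)⟩
      obtain ⟨a, b, hab⟩ : ∃ a b : ℤ × ℤ, ∀ n ∈ M.exponents, n ≠ m → n = a ∨ n = b := by
        rcases (mem_S m).1 hm with rfl | rfl | rfl
        · exact ⟨(1, 0), (0, 1), fun n hn hne => ((mem_S n).1 hn).resolve_left hne⟩
        · exact ⟨(0, 0), (0, 1), fun n hn hne => by
            rcases (mem_S n).1 hn with h | h | h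
            · exact Or.inl h
            · exact absurd h hne
            · exact Or.inr h⟩
        · exact ⟨(0, 0), (1, 0), fun n hn hne => by
            rcases (mem_S n).1 hn with h | h | h
            · exact Or.inl h
            · exact Or.inr h
            · exact absurd h hne⟩
      apply (collinear_pair ℝ (latticeToPlane a) (latticeToPlane b)).subset
      rintro _ ⟨n, hn, rfl⟩
      obtain ⟨h1, h2⟩ := hsub n hn
      rcases hab n h1 h2 with rfl | rfl
      · exact Or.inl rfl
      · exact Or.inr rfl
    have h0 := hall (0, 0) ((mem_S _).2 (Or.inl rfl))
    have h1 := hall (1, 0) ((mem_S _).2 (Or.inr (Or.inl rfl)))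
    have h2 := hall (0, 1) ((mem_S _).2 (Or.inr (Or.inr rfl)))
    have e1 := value_eq_of_mem h0 h1
    have e2 := value_eq_of_mem h0 h2
    simp only [planePairing, Int.cast_zero, Int.cast_one, zero_mul, one_mul, add_zero,
      zero_add] at e1 e2
    ext
    · simp only [hq]; linarith
    · simp only [hq]; linarith
  have hvertex : ∃ v, Λ.pos v = q := by
    rw [M.vertex_iff]
    rw [show maximalExponents M.exponents M.coeff q = (M.exponents : Set (ℤ × ℤ)) from
      Set.Subset.antisymm (fun m hm => hm.1) hmaxq, hS]
    have hmem : latticeToPlane (0, 0) ∈ latticeToPlane ''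
        (({(0, 0), (1, 0), (0, 1)} : Finset (ℤ × ℤ)) : Set (ℤ × ℤ)) := ⟨(0, 0), by simp, rfl⟩
    rw [collinear_iff_of_mem hmem]
    rintro ⟨v, hv⟩
    obtain ⟨r, hr⟩ := hv (latticeToPlane (1, 0)) ⟨_, by simp, rfl⟩
    obtain ⟨s, hs⟩ := hv (latticeToPlane (0, 1)) ⟨_, by simp, rfl⟩
    have a1 := congrArg Prod.fst hr
    have a2 := congrArg Prod.snd hr
    have b1 := congrArg Prod.fst hs
    have b2 := congrArg Prod.snd hs
    simp only [latticeToPlane, vadd_eq_add, Prod.fst_add, Prod.snd_add, Prod.smul_fst,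
      Prod.smul_snd, smul_eq_mul, Int.cast_zero, Int.cast_one, add_zero] at a1 a2 b1 b2
    have : (1 : ℝ) = 0 := by
      calc (1 : ℝ) = (r * v.1) * (s * v.2) := by rw [← a1, ← b2]; norm_num
        _ = (r * v.2) * (s * v.1) := by ring
        _ = 0 := by rw [← a2]; ring
    exact one_ne_zero this
  have hray : ∀ r, Λ.rayWeight r = 1 ∧ Λ.rayDir r ∈ tripodDirs := by
    intro r
    have hx : q + (1 : ℝ) • latticeToPlane (Λ.rayDir r) ∈ Λ.edgeInterior (.inr r) := by
      refine PlaneGraph.mem_edgeInterior.2 ⟨1, Set.mem_Ioi.2 one_pos, ?_⟩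
      rw [← hpos (Λ.graph.root r)]; rfl
    obtain ⟨m, m', hm, hseg⟩ := M.edge_dual (.inr r) _ hx
    have hmm := left_mem_of_convexHull_eq_segment hseg
    have hmm' := right_mem_of_convexHull_eq_segment hseg
    -- The terms agree at `q`, so maximality along the ray compares slopes only. It selects the
    -- outer one of the two primitive normals of the dual side.
    have hle : ∀ n ∈ M.exponents, latticePairing n (Λ.rayDir r)
        ≤ latticePairing m (Λ.rayDir r) := by
      intro n hn
      have := (mem_maximalExponents.1 hmm).2 n hn
      rw [hvalt n hn, hvalt m hmm.1, one_mul, one_mul] at this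
      exact_mod_cast (add_le_add_iff_left _).1 this
    have h1 := congrArg Prod.fst hm
    have h2 := congrArg Prod.snd hm
    change m'.1 - m.1 = (Λ.rayWeight r : ℤ) * -(Λ.rayDir r).2 at h1
    change m'.2 - m.2 = (Λ.rayWeight r : ℤ) * (Λ.rayDir r).1 at h2
    have hw := Λ.rayWeight_pos r
    have hd1 : (Λ.rayWeight r : ℤ) ∣ m'.1 - m.1 := ⟨_, h1⟩
    have hd2 : (Λ.rayWeight r : ℤ) ∣ m'.2 - m.2 := ⟨_, h2⟩
    have hne : ¬(m'.1 - m.1 = 0 ∧ m'.2 - m.2 = 0) := by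
      rintro ⟨h3, h4⟩
      rw [h3, zero_eq_mul, neg_eq_zero] at h1
      rw [h4, zero_eq_mul] at h2
      have hw' : (Λ.rayWeight r : ℤ) ≠ 0 := by exact_mod_cast hw.ne'
      exact ne_zero_of_isCoprime (Λ.rayDir_primitive r)
        (Prod.ext (h2.resolve_left hw') (h1.resolve_left hw'))
    -- The difference of two distinct vertices of the unit triangle has a coordinate `1` or `-1`, so
    -- the weight divides one.
    have hw1 : (Λ.rayWeight r : ℤ) = 1 := by
      have : (Λ.rayWeight r : ℤ) ∣ 1 := by
        rcases (mem_S m).1 hmm.1 with rfl | rfl | rfl <;>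
          rcases (mem_S m').1 hmm'.1 with rfl | rfl | rfl <;>
          simp at hd1 hd2 hne ⊢ <;> assumption
      exact Int.eq_one_of_dvd_one (by positivity) this
    rw [hw1, one_mul] at h1 h2
    refine ⟨by exact_mod_cast hw1, ?_⟩
    have hle0 := hle (0, 0) ((mem_S _).2 (Or.inl rfl))
    have hle1 := hle (1, 0) ((mem_S _).2 (Or.inr (Or.inl rfl)))
    have hle2 := hle (0, 1) ((mem_S _).2 (Or.inr (Or.inr rfl)))
    simp only [tripodDirs, Finset.mem_insert, Finset.mem_singleton, Prod.ext_iff]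
    rcases (mem_S m).1 hmm.1 with rfl | rfl | rfl <;>
      rcases (mem_S m').1 hmm'.1 with rfl | rfl | rfl <;>
      simp only [latticePairing] at hle0 hle1 hle2 h1 h2 hne <;> omega
  have hinj : Function.Injective Λ.rayDir := by
    intro r r' h
    have := TropicalPlaneCurve.halfEdge_eq_of_outDir_eq (Γ := Λ) (k := .inr (.inr r))
      (k' := .inr (.inr r')) (TropicalPlaneCurve.pos_injective (by rw [hpos, hpos])) h
    simpa using this
  have hE : IsEmpty Λ.graph.E := ⟨fun e => PlaneGraph.src_ne_tgt (Γ := Λ.toPlaneGraph) e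
    (TropicalPlaneCurve.pos_injective (by rw [hpos, hpos]))⟩
  refine ⟨q, hS, hval, M.mem_carrier_iff, ⟨hvertex.choose⟩, hpos, hE, fun r => (hray r).1,
    fun r => (hray r).2, hinj, fun d hd => ?_⟩
  have hd0 := isCoprime_of_mem_tripodDirs hd
  have hcar : q + (1 : ℝ) • latticeToPlane d ∈ Λ.carrier := by
    rw [M.mem_carrier_iff]
    obtain ⟨a, b, ha, hb, hab, hmax⟩ : ∃ a b : ℤ × ℤ, a ∈ M.exponents ∧ b ∈ M.exponents ∧ a ≠ b ∧
        ∀ n ∈ M.exponents, latticePairing n d ≤ latticePairing a d ∧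
          latticePairing n d ≤ latticePairing b d := by
      simp only [mem_S, tripodDirs, Finset.mem_insert, Finset.mem_singleton] at hd ⊢
      rcases hd with rfl | rfl | rfl
      · exact ⟨(0, 0), (0, 1), by simp, by simp, by simp, by
          rintro n (rfl | rfl | rfl) <;> simp [latticePairing]⟩
      · exact ⟨(0, 0), (1, 0), by simp, by simp, by simp, by
          rintro n (rfl | rfl | rfl) <;> simp [latticePairing]⟩
      · exact ⟨(1, 0), (0, 1), by simp, by simp, by simp, by
          rintro n (rfl | rfl | rfl) <;> simp [latticePairing]⟩
    refine ⟨a, mem_maximalExponents.2 ⟨ha, fun n hn => ?_⟩, b,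
      mem_maximalExponents.2 ⟨hb, fun n hn => ?_⟩, hab⟩
    · rw [hvalt n hn, hvalt a ha, one_mul, one_mul]
      have : (latticePairing n d : ℝ) ≤ latticePairing a d := by exact_mod_cast (hmax n hn).1
      linarith
    · rw [hvalt n hn, hvalt b hb, one_mul, one_mul]
      have : (latticePairing n d : ℝ) ≤ latticePairing b d := by exact_mod_cast (hmax n hn).2
      linarith
  rcases PlaneGraph.mem_carrier_iff.1 hcar with ⟨v, hv⟩ | ⟨b, hb⟩
  · exfalso
    rw [hpos, left_eq_add, one_smul] at hv
    exact latticeToPlane_ne_zero hd0 hv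
  · rcases b with e | r
    · exact hE.elim e
    · obtain ⟨t, ht, he⟩ := PlaneGraph.mem_edgeInterior.1 hb
      change Λ.pos (Λ.graph.root r) + t • latticeToPlane (Λ.rayDir r) = _ at he
      rw [hpos] at he
      exact ⟨r, eq_of_smul_eq_smul (Λ.rayDir_primitive r) hd0 ht one_pos (add_left_cancel he)⟩

end Line

namespace IsTripod

variable {Λ : TropicalPlaneCurve} {S : Finset (ℤ × ℤ)} {c : ℤ × ℤ → ℝ} {q : ℝ × ℝ}

theorem nonempty (h : IsTripod Λ S c q) : S.Nonempty := by rw [h.exponents_eq]; simp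

theorem mem_edgeInterior_iff (h : IsTripod Λ S c q) {r : Λ.graph.R} {x : ℝ × ℝ} :
    x ∈ Λ.edgeInterior (.inr r) ↔ ∃ t : ℝ, 0 < t ∧ q + t • latticeToPlane (Λ.rayDir r) = x := by
  rw [PlaneGraph.mem_edgeInterior, ← h.pos_eq (Λ.graph.root r)]
  rfl

open Classical in
/-- Sums over the edges of a tripod. -/
theorem sum_edge (h : IsTripod Λ S c q) (P : ℝ × ℝ → Prop) (w : ℤ) (g : ℤ × ℤ → ℤ) :
    (∑ b : Λ.Edge, if ∃ x ∈ Λ.edgeInterior b, P x then w * (Λ.weight b : ℤ) * g (Λ.dir b) else 0)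
      = w * ∑ d ∈ tripodDirs, if ∃ t : ℝ, 0 < t ∧ P (q + t • latticeToPlane d) then g d else 0 := by
  have := h.isEmpty_edge
  rw [Fintype.sum_sum_type, Finset.univ_eq_empty (α := Λ.graph.E), Finset.sum_empty, zero_add,
    Finset.mul_sum]
  refine Finset.sum_nbij Λ.rayDir (fun r _ => h.rayDir_mem r) (fun r _ r' _ e =>
    h.rayDir_injective e) (fun d hd => ?_) fun r _ => ?_
  · obtain ⟨r, hr⟩ := h.exists_rayDir d hd
    exact ⟨r, by simp, hr⟩
  · have e : (∃ x ∈ Λ.edgeInterior (.inr r), P x) ↔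
        ∃ t : ℝ, 0 < t ∧ P (q + t • latticeToPlane (Λ.rayDir r)) := by
      constructor
      · rintro ⟨x, hx, hP⟩
        obtain ⟨t, ht, rfl⟩ := h.mem_edgeInterior_iff.1 hx
        exact ⟨t, ht, hP⟩
      · rintro ⟨t, ht, hP⟩
        exact ⟨_, h.mem_edgeInterior_iff.2 ⟨t, ht, rfl⟩, hP⟩
    rw [mul_ite, mul_zero]
    simp only [e]
    congr 1
    change w * (Λ.rayWeight r : ℤ) * g (Λ.rayDir r) = _
    rw [h.rayWeight_eq]; simp

end IsTripod

/-! ## Stable intersection with a tropical line -/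

/-! ### Maxima of three affine functions on an interval. -/

section Crossing

variable {s₀ s₁ : ℝ}

open Classical in
/-- The jump of slope caused by a change from one to another of two affine functions on an interval,
at a place where a third one is smaller. -/
def crossing (s₀ s₁ : ℝ) (f g h : ℝ × ℤ) : ℤ :=
  if ∃ t ∈ Set.Ioo s₀ s₁, f.1 + t * f.2 = g.1 + t * g.2 ∧ h.1 + t * h.2 < f.1 + t * f.2
    then |f.2 - g.2| else 0

theorem crossing_comm (f g h : ℝ × ℤ) : crossing s₀ s₁ f g h = crossing s₀ s₁ g f h := by
  unfold crossing
  rw [abs_sub_comm]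
  congr 1
  apply propext
  constructor
  · rintro ⟨t, ht, h1, h2⟩
    exact ⟨t, ht, h1.symm, h1 ▸ h2⟩
  · rintro ⟨t, ht, h1, h2⟩
    exact ⟨t, ht, h1.symm, h1 ▸ h2⟩

theorem affine_lt {f h : ℝ × ℤ} {a b t : ℝ} (h0 : a ≤ t) (h1 : t ≤ b)
    (ha : h.1 + a * h.2 < f.1 + a * f.2) (hb : h.1 + b * h.2 < f.1 + b * f.2) :
    h.1 + t * h.2 < f.1 + t * f.2 := by
  rcases eq_or_lt_of_le h0 with rfl | h0
  · exact ha
  rcases eq_or_lt_of_le h1 with rfl | h1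
  · exact hb
  have h2 := mul_pos (sub_pos.2 h1) (sub_pos.2 ha)
  have h3 := mul_pos (sub_pos.2 h0) (sub_pos.2 hb)
  have h4 : 0 < b - a := by linarith
  by_contra hcon
  push Not at hcon
  nlinarith

/-- If the same function is the largest at both ends, there is no crossing. -/
theorem crossing_sum_of_same {f g h : ℝ × ℤ}
    (h0g : g.1 + s₀ * g.2 < f.1 + s₀ * f.2) (h0h : h.1 + s₀ * h.2 < f.1 + s₀ * f.2)
    (h1g : g.1 + s₁ * g.2 < f.1 + s₁ * f.2) (h1h : h.1 + s₁ * h.2 < f.1 + s₁ * f.2) :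
    crossing s₀ s₁ f g h + crossing s₀ s₁ f h g + crossing s₀ s₁ g h f = 0 := by
  have hg : ∀ t ∈ Set.Ioo s₀ s₁, g.1 + t * g.2 < f.1 + t * f.2 := fun t ht =>
    affine_lt ht.1.le ht.2.le h0g h1g
  have hh : ∀ t ∈ Set.Ioo s₀ s₁, h.1 + t * h.2 < f.1 + t * f.2 := fun t ht =>
    affine_lt ht.1.le ht.2.le h0h h1h
  unfold crossing
  rw [if_neg, if_neg, if_neg]
  · rfl
  · rintro ⟨t, ht, -, h2⟩
    exact lt_asymm h2 (hg t ht)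
  · rintro ⟨t, ht, h1, -⟩
    exact (hh t ht).ne' h1
  · rintro ⟨t, ht, h1, -⟩
    exact (hg t ht).ne' h1

/-- The root is written with the factored difference so that the sign of `g - f` can be read off on
either side of it. -/
theorem affine_root {f g : ℝ × ℤ} (hs : s₀ < s₁) (h0 : g.1 + s₀ * g.2 < f.1 + s₀ * f.2)
    (h1 : f.1 + s₁ * f.2 < g.1 + s₁ * g.2) :
    f.2 < g.2 ∧ ∃ t ∈ Set.Ioo s₀ s₁, ∀ s : ℝ,
      (g.1 + s * g.2) - (f.1 + s * f.2) = (s - t) * ((g.2 : ℝ) - f.2) := by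
  have hlt : (f.2 : ℝ) < g.2 := by
    by_contra h
    push Not at h
    nlinarith
  have hpos : (0 : ℝ) < (g.2 : ℝ) - f.2 := sub_pos.2 hlt
  refine ⟨by exact_mod_cast hlt, (f.1 - g.1) / ((g.2 : ℝ) - f.2), ⟨?_, ?_⟩, fun s => ?_⟩
  · rw [lt_div_iff₀ hpos]; linarith
  · rw [div_lt_iff₀ hpos]; linarith
  · rw [sub_mul, div_mul_cancel₀ _ hpos.ne']; ring

/-- The slope of a maximum of three affine functions increases by the sum of the jumps at the
crossings. -/
theorem crossing_sum_of_ne {f g h : ℝ × ℤ} (hs : s₀ < s₁)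
    (h0g : g.1 + s₀ * g.2 < f.1 + s₀ * f.2) (h0h : h.1 + s₀ * h.2 < f.1 + s₀ * f.2)
    (h1f : f.1 + s₁ * f.2 < g.1 + s₁ * g.2) (h1h : h.1 + s₁ * h.2 < g.1 + s₁ * g.2)
    (hne : ∀ t ∈ Set.Ioo s₀ s₁, f.1 + t * f.2 = g.1 + t * g.2 →
      h.1 + t * h.2 ≠ f.1 + t * f.2) :
    crossing s₀ s₁ f g h + crossing s₀ s₁ f h g + crossing s₀ s₁ g h f = g.2 - f.2 := by
  obtain ⟨hfg, t, ht, hroot⟩ := affine_root hs h0g h1f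
  have hfg' : (0 : ℝ) < (g.2 : ℝ) - f.2 := by
    have : (f.2 : ℝ) < g.2 := by exact_mod_cast hfg
    linarith
  have het : f.1 + t * f.2 = g.1 + t * g.2 := by have := hroot t; rw [sub_self, zero_mul] at this; linarith
  have hlt_iff : ∀ s, g.1 + s * g.2 < f.1 + s * f.2 → s < t := by
    intro s h1; have := hroot s; nlinarith
  have hgt_iff : ∀ s, f.1 + s * f.2 < g.1 + s * g.2 → t < s := by
    intro s h1; have := hroot s; nlinarith
  have heq_iff : ∀ s, f.1 + s * f.2 = g.1 + s * g.2 → s = t := by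
    intro s h1
    have := hroot s
    rw [h1, sub_self, zero_eq_mul] at this
    have := this.resolve_right hfg'.ne'
    linarith
  unfold crossing
  -- If the third function is below the tie of `f` and `g`, it is below the maximum on the whole
  -- interval, and the only jump is from `f` to `g`.
  rcases lt_or_gt_of_ne (hne t ht het) with hlt | hgt
  · rw [if_pos ⟨t, ht, het, hlt⟩, if_neg, if_neg, abs_sub_comm, abs_of_pos (by omega)]
    · ring
    · rintro ⟨s, hs', h1, h2⟩
      have h3 := hgt_iff s h2
      have := affine_lt (f := g) (h := h) h3.le hs'.2.le (by rw [← het]; exact hlt) h1h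
      linarith
    · rintro ⟨s, hs', h1, h2⟩
      have h3 := hlt_iff s h2
      have := affine_lt (f := f) (h := h) hs'.1.le h3.le h0h hlt
      linarith
  -- Otherwise the third function takes over before the tie and yields to `g` after it. The tie
  -- itself is hidden, and the two jumps add up to the same increase of slope.
  · obtain ⟨hfh, a, ha, hra⟩ := affine_root (f := f) (g := h) ht.1 h0h hgt
    obtain ⟨hhg, b, hb, hrb⟩ := affine_root (f := h) (g := g) ht.2 (by rw [← het]; exact hgt) h1h
    have ea : f.1 + a * f.2 = h.1 + a * h.2 := by have := hra a; rw [sub_self, zero_mul] at this; linarith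
    have eb : g.1 + b * g.2 = h.1 + b * h.2 := by have := hrb b; rw [sub_self, zero_mul] at this; linarith
    have hga : g.1 + a * g.2 < f.1 + a * f.2 := by
      have := hroot a
      have := mul_pos (sub_pos.2 ha.2) hfg'
      linarith
    have hfb : f.1 + b * f.2 < g.1 + b * g.2 := by
      have := hroot b
      have := mul_pos (sub_pos.2 hb.1) hfg'
      linarith
    rw [if_neg, if_pos ⟨a, ⟨ha.1, ha.2.trans ht.2⟩, ea, hga⟩,
      if_pos ⟨b, ⟨ht.1.trans hb.1, hb.2⟩, eb, hfb⟩, abs_sub_comm, abs_of_pos (by omega),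
      abs_of_pos (by omega)]
    · ring
    · rintro ⟨s, hs', h1, h2⟩
      obtain rfl := heq_iff s h1
      exact lt_asymm h2 hgt

end Crossing

/-! ### Slope increase along a segment crossing a tropical line. -/

namespace IsTripod

variable {Λ : TropicalPlaneCurve} {S : Finset (ℤ × ℤ)} {c : ℤ × ℤ → ℝ} {q : ℝ × ℝ}

theorem value (h : IsTripod Λ S c q) {m : ℤ × ℤ} (hm : m ∈ S) (z : ℝ × ℝ) :
    c m + planePairing m z = c (0, 0) + planePairing m (z - q) := by
  rw [← h.value_eq m hm, add_assoc, ← planePairing_add, add_sub_cancel]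

/-- The segment of a line, as seen by the exponent `m`. -/
def affineValue (c : ℤ × ℤ → ℝ) (z : ℝ × ℝ) (u m : ℤ × ℤ) : ℝ × ℤ :=
  (c m + planePairing m z, latticePairing m u)

theorem affineValue_apply (z : ℝ × ℝ) (u m : ℤ × ℤ) (t : ℝ) :
    (affineValue c z u m).1 + t * (affineValue c z u m).2
      = c m + planePairing m (z + t • latticeToPlane u) := by
  rw [planePairing_add, planePairing_smul_lattice, ← add_assoc]; rfl

-- Each ray of the tripod is the locus where two terms tie and the third is smaller. The two tied
-- exponents differ by the quarter turn of the ray direction up to sign, so the determinant with `u`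
-- is the jump of slope along `u`.
open Classical in
theorem sum_tripodDirs (h : IsTripod Λ S c q) (z : ℝ × ℝ) (u : ℤ × ℤ) (s₀ s₁ : ℝ) :
    (∑ d ∈ tripodDirs, if ∃ t : ℝ, 0 < t ∧
        ∃ s ∈ Set.Ioo s₀ s₁, q + t • latticeToPlane d = z + s • latticeToPlane u
      then |latticeDet u d| else 0)
      = crossing s₀ s₁ (affineValue c z u (0, 0)) (affineValue c z u (1, 0))
          (affineValue c z u (0, 1))
        + crossing s₀ s₁ (affineValue c z u (0, 0)) (affineValue c z u (0, 1))
          (affineValue c z u (1, 0))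
        + crossing s₀ s₁ (affineValue c z u (1, 0)) (affineValue c z u (0, 1))
          (affineValue c z u (0, 0)) := by
  have m0 : ((0, 0) : ℤ × ℤ) ∈ S := by rw [h.exponents_eq]; simp
  have m1 : ((1, 0) : ℤ × ℤ) ∈ S := by rw [h.exponents_eq]; simp
  have m2 : ((0, 1) : ℤ × ℤ) ∈ S := by rw [h.exponents_eq]; simp
  have key : ∀ w : ℝ × ℝ,
      ((∃ t : ℝ, 0 < t ∧ q + t • latticeToPlane (-1, 0) = w) ↔
        (w - q).2 = 0 ∧ (w - q).1 < 0) ∧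
      ((∃ t : ℝ, 0 < t ∧ q + t • latticeToPlane (0, -1) = w) ↔
        (w - q).1 = 0 ∧ (w - q).2 < 0) ∧
      ((∃ t : ℝ, 0 < t ∧ q + t • latticeToPlane (1, 1) = w) ↔
        (w - q).1 = (w - q).2 ∧ 0 < (w - q).1) := by
    intro w
    simp only [Prod.ext_iff, latticeToPlane, Prod.fst_add, Prod.snd_add, Prod.smul_fst,
      Prod.smul_snd, Prod.fst_sub, Prod.snd_sub, smul_eq_mul, Int.cast_neg, Int.cast_one,
      Int.cast_zero]
    refine ⟨⟨?_, ?_⟩, ⟨?_, ?_⟩, ⟨?_, ?_⟩⟩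
    · rintro ⟨t, ht, h1, h2⟩; constructor <;> linarith
    · rintro ⟨h1, h2⟩; exact ⟨q.1 - w.1, by linarith, by linarith, by linarith⟩
    · rintro ⟨t, ht, h1, h2⟩; constructor <;> linarith
    · rintro ⟨h1, h2⟩; exact ⟨q.2 - w.2, by linarith, by linarith, by linarith⟩
    · rintro ⟨t, ht, h1, h2⟩; constructor <;> linarith
    · rintro ⟨h1, h2⟩; exact ⟨w.1 - q.1, by linarith, by linarith, by linarith⟩
  have swap : ∀ d : ℤ × ℤ, (∃ t : ℝ, 0 < t ∧
      ∃ s ∈ Set.Ioo s₀ s₁, q + t • latticeToPlane d = z + s • latticeToPlane u) ↔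
      ∃ s ∈ Set.Ioo s₀ s₁, ∃ t : ℝ, 0 < t ∧ q + t • latticeToPlane d
        = z + s • latticeToPlane u := fun d =>
    ⟨fun ⟨t, ht, s, hs, e⟩ => ⟨s, hs, t, ht, e⟩, fun ⟨s, hs, t, ht, e⟩ => ⟨t, ht, s, hs, e⟩⟩
  have hsum : ∀ (d : ℤ × ℤ) (f g k : ℤ × ℤ), f ∈ S → g ∈ S → k ∈ S →
      (∀ w : ℝ × ℝ, (∃ t : ℝ, 0 < t ∧ q + t • latticeToPlane d = w) ↔
        planePairing f (w - q) = planePairing g (w - q) ∧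
          planePairing k (w - q) < planePairing f (w - q)) →
      |latticeDet u d| = |latticePairing f u - latticePairing g u| →
      (if ∃ t : ℝ, 0 < t ∧ ∃ s ∈ Set.Ioo s₀ s₁,
          q + t • latticeToPlane d = z + s • latticeToPlane u then |latticeDet u d| else 0)
        = crossing s₀ s₁ (affineValue c z u f) (affineValue c z u g) (affineValue c z u k) := by
    intro d f g k hf hg hk hw habs
    unfold crossing
    refine if_congr ?_ habs rfl
    rw [swap]
    simp only [affineValue_apply, h.value hf, h.value hg, h.value hk, hw, add_right_inj,
      add_lt_add_iff_left]
  unfold tripodDirs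
  rw [Finset.sum_insert (by decide), Finset.sum_insert (by decide), Finset.sum_singleton,
    hsum (-1, 0) (0, 0) (0, 1) (1, 0) m0 m2 m1, hsum (0, -1) (0, 0) (1, 0) (0, 1) m0 m1 m2,
    hsum (1, 1) (1, 0) (0, 1) (0, 0) m1 m2 m0]
  · ring
  · intro w
    rw [(key w).2.2]
    simp [planePairing]
  · simp [latticeDet, latticePairing]
  · intro w
    rw [(key w).2.1]
    simp [planePairing, eq_comm]
  · simp [latticeDet, latticePairing]
  · intro w
    rw [(key w).1]
    simp [planePairing, eq_comm]
  · simp [latticeDet, latticePairing]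

/-- Crossing a tropical line along a segment, the slope increases by the intersection numbers. -/
theorem sum_det_eq (h : IsTripod Λ S c q) {z : ℝ × ℝ} {u m₀ m₁ : ℤ × ℤ} {s₀ s₁ : ℝ}
    (hs : s₀ < s₁) (h0 : maximalExponents S c (z + s₀ • latticeToPlane u) = {m₀})
    (h1 : maximalExponents S c (z + s₁ • latticeToPlane u) = {m₁})
    (hq : ∀ t ∈ Set.Ioo s₀ s₁, z + t • latticeToPlane u ≠ q) :
    crossing s₀ s₁ (affineValue c z u (0, 0)) (affineValue c z u (1, 0))
          (affineValue c z u (0, 1))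
        + crossing s₀ s₁ (affineValue c z u (0, 0)) (affineValue c z u (0, 1))
          (affineValue c z u (1, 0))
        + crossing s₀ s₁ (affineValue c z u (1, 0)) (affineValue c z u (0, 1))
          (affineValue c z u (0, 0)) = latticePairing m₁ u - latticePairing m₀ u := by
  have mem_S : ∀ m, m ∈ S ↔ m = (0, 0) ∨ m = (1, 0) ∨ m = (0, 1) := by
    intro m; rw [h.exponents_eq]; simp
  have hstrict : ∀ (s : ℝ) (m : ℤ × ℤ),
      maximalExponents S c (z + s • latticeToPlane u) = {m} → m ∈ S ∧ ∀ n ∈ S, n ≠ m →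
      (affineValue c z u n).1 + s * (affineValue c z u n).2
        < (affineValue c z u m).1 + s * (affineValue c z u m).2 := by
    intro s m hm
    have hmm : m ∈ maximalExponents S c (z + s • latticeToPlane u) := by rw [hm]; rfl
    refine ⟨hmm.1, fun n hn hne => ?_⟩
    rw [affineValue_apply, affineValue_apply]
    refine lt_of_le_of_ne ((mem_maximalExponents.1 hmm).2 n hn) fun he => hne ?_
    have := mem_maximalExponents_of_eq hmm hn he
    rw [hm] at this
    exact this
  -- All three terms tie only at `q`, which the segment avoids.
  have hneq : ∀ f g k : ℤ × ℤ, f ∈ S → g ∈ S → k ∈ S → f ≠ g → f ≠ k → g ≠ k →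
      ∀ t ∈ Set.Ioo s₀ s₁,
      (affineValue c z u f).1 + t * (affineValue c z u f).2
        = (affineValue c z u g).1 + t * (affineValue c z u g).2 →
      (affineValue c z u k).1 + t * (affineValue c z u k).2
        ≠ (affineValue c z u f).1 + t * (affineValue c z u f).2 := by
    intro f g k hf hg hk hfg hfk hgk t ht e1 e2
    apply hq t ht
    rw [affineValue_apply, affineValue_apply, h.value hf, h.value hg, add_right_inj] at e1
    rw [affineValue_apply, affineValue_apply, h.value hf, h.value hk, add_right_inj] at e2
    rw [← sub_eq_zero]
    rcases (mem_S f).1 hf with rfl | rfl | rfl <;> rcases (mem_S g).1 hg with rfl | rfl | rfl <;>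
      rcases (mem_S k).1 hk with rfl | rfl | rfl <;> first | exact absurd rfl ‹_› | skip
    all_goals
      simp only [planePairing, Int.cast_zero, Int.cast_one, zero_mul, one_mul, add_zero,
        zero_add] at e1 e2
      exact Prod.ext (by simp only [Prod.fst_zero]; linarith)
        (by simp only [Prod.snd_zero]; linarith)
  have same : ∀ f g k : ℤ × ℤ, f ∈ S → g ∈ S → k ∈ S → g ≠ f → k ≠ f → m₀ = f → m₁ = f →
      crossing s₀ s₁ (affineValue c z u f) (affineValue c z u g) (affineValue c z u k)
      + crossing s₀ s₁ (affineValue c z u f) (affineValue c z u k) (affineValue c z u g)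
      + crossing s₀ s₁ (affineValue c z u g) (affineValue c z u k) (affineValue c z u f) = 0 := by
    rintro f g k hf hg hk hgf hkf rfl e
    rw [e] at h1
    exact crossing_sum_of_same ((hstrict _ _ h0).2 g hg hgf) ((hstrict _ _ h0).2 k hk hkf)
      ((hstrict _ _ h1).2 g hg hgf) ((hstrict _ _ h1).2 k hk hkf)
  have diff : ∀ f g k : ℤ × ℤ, f ∈ S → g ∈ S → k ∈ S → f ≠ g → f ≠ k → g ≠ k →
      m₀ = f → m₁ = g →
      crossing s₀ s₁ (affineValue c z u f) (affineValue c z u g) (affineValue c z u k)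
      + crossing s₀ s₁ (affineValue c z u f) (affineValue c z u k) (affineValue c z u g)
      + crossing s₀ s₁ (affineValue c z u g) (affineValue c z u k) (affineValue c z u f)
        = latticePairing g u - latticePairing f u := by
    rintro f g k hf hg hk hfg hfk hgk rfl rfl
    exact crossing_sum_of_ne hs ((hstrict _ _ h0).2 _ hg hfg.symm)
      ((hstrict _ _ h0).2 _ hk hfk.symm) ((hstrict _ _ h1).2 _ hf hfg)
      ((hstrict _ _ h1).2 _ hk hgk.symm) (hneq _ _ _ hf hg hk hfg hfk hgk)
  have i0 : ((0, 0) : ℤ × ℤ) ∈ S := (mem_S _).2 (Or.inl rfl)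
  have i1 : ((1, 0) : ℤ × ℤ) ∈ S := (mem_S _).2 (Or.inr (Or.inl rfl))
  have i2 : ((0, 1) : ℤ × ℤ) ∈ S := (mem_S _).2 (Or.inr (Or.inr rfl))
  have c01 := crossing_comm (s₀ := s₀) (s₁ := s₁) (affineValue c z u (0, 0))
    (affineValue c z u (1, 0)) (affineValue c z u (0, 1))
  have c02 := crossing_comm (s₀ := s₀) (s₁ := s₁) (affineValue c z u (0, 0))
    (affineValue c z u (0, 1)) (affineValue c z u (1, 0))
  have c12 := crossing_comm (s₀ := s₀) (s₁ := s₁) (affineValue c z u (1, 0))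
    (affineValue c z u (0, 1)) (affineValue c z u (0, 0))
  rcases (mem_S m₀).1 (hstrict _ _ h0).1 with e0 | e0 | e0 <;>
    rcases (mem_S m₁).1 (hstrict _ _ h1).1 with e1 | e1 | e1
  · have := same _ _ _ i0 i1 i2 (by decide) (by decide) e0 e1
    rw [e0, e1]; linarith
  · have := diff _ _ _ i0 i1 i2 (by decide) (by decide) (by decide) e0 e1
    rw [e0, e1]; linarith
  · have := diff _ _ _ i0 i2 i1 (by decide) (by decide) (by decide) e0 e1
    rw [e0, e1]; linarith
  · have := diff _ _ _ i1 i0 i2 (by decide) (by decide) (by decide) e0 e1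
    rw [e0, e1]; linarith
  · have := same _ _ _ i1 i0 i2 (by decide) (by decide) e0 e1
    rw [e0, e1]; linarith
  · have := diff _ _ _ i1 i2 i0 (by decide) (by decide) (by decide) e0 e1
    rw [e0, e1]; linarith
  · have := diff _ _ _ i2 i0 i1 (by decide) (by decide) (by decide) e0 e1
    rw [e0, e1]; linarith
  · have := diff _ _ _ i2 i1 i0 (by decide) (by decide) (by decide) e0 e1
    rw [e0, e1]; linarith
  · have := same _ _ _ i2 i0 i1 (by decide) (by decide) e0 e1
    rw [e0, e1]; linarith

end IsTripod

/-! ### Local intersection numbers and generic directions. -/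

namespace TropicalPlaneCurve

variable {Γ Λ : TropicalPlaneCurve} {S : Finset (ℤ × ℤ)} {c : ℤ × ℤ → ℝ} {q : ℝ × ℝ}

open Classical in
/-- The contribution of one edge to an intersection number. -/
def edgeCount (Γ Λ : TropicalPlaneCurve) (y : ℝ × ℝ) (U : Set (ℝ × ℝ)) (a : Γ.Edge) : ℤ :=
  ∑ b : Λ.Edge,
    if ∃ x ∈ Λ.edgeInterior b, x + y ∈ Γ.edgeInterior a ∧ x + y ∈ U then
      (Γ.weight a : ℤ) * (Λ.weight b : ℤ) * |latticeDet (Γ.dir a) (Λ.dir b)|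
    else 0

theorem intersectionCount_eq_sum (y : ℝ × ℝ) (U : Set (ℝ × ℝ)) :
    Γ.intersectionCount Λ y U = ∑ a, edgeCount Γ Λ y U a := rfl

theorem edgeCount_eq_zero {y : ℝ × ℝ} {U : Set (ℝ × ℝ)} {a : Γ.Edge}
    (h : ∀ z ∈ U, z ∉ Γ.edgeInterior a) : edgeCount Γ Λ y U a = 0 :=
  Finset.sum_eq_zero fun _ _ => if_neg fun ⟨_, _, h1, h2⟩ => h _ h2 h1

theorem abs_latticeDet_eq {u v d : ℤ × ℤ} (h : u = v ∨ u = -v) :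
    |latticeDet u d| = |latticeDet v d| := by
  rcases h with rfl | rfl
  · rfl
  · rw [← abs_neg]
    congr 1
    simp only [latticeDet, Prod.fst_neg, Prod.snd_neg]; ring

/-- Translating back by `y` turns the edge segment into a segment crossing the fixed tripod, to
which `IsTripod.sum_det_eq` applies. Properness keeps the vertex of the translated line off the
curve. The direction `u` may be reversed because multiplicities are absolute values. -/
theorem edgeCount_eq (hT : IsTripod Λ S c q) {x y : ℝ × ℝ} {U : Set (ℝ × ℝ)} {a : Γ.Edge}
    (hy : Γ.MeetsProperly Λ y) {u m₀ m₁ : ℤ × ℤ} (hu : u = Γ.dir a ∨ u = -Γ.dir a) {s₀ s₁ : ℝ}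
    (hs : s₀ < s₁)
    (hU : ∀ z, z ∈ Γ.edgeInterior a ∧ z ∈ U ↔ ∃ t ∈ Set.Ioo s₀ s₁, z = x + t • latticeToPlane u)
    (h0 : maximalExponents S c (x + s₀ • latticeToPlane u - y) = {m₀})
    (h1 : maximalExponents S c (x + s₁ • latticeToPlane u - y) = {m₁}) :
    edgeCount Γ Λ y U a = Γ.weight a * (latticePairing m₁ u - latticePairing m₀ u) := by
  classical
  have e : ∀ t : ℝ, x + t • latticeToPlane u - y = (x - y) + t • latticeToPlane u := fun t => by
    abel
  rw [e] at h0 h1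
  rw [← hT.sum_det_eq hs h0 h1, ← hT.sum_tripodDirs, edgeCount,
    hT.sum_edge (fun x => x + y ∈ Γ.edgeInterior a ∧ x + y ∈ U) (Γ.weight a)
      fun d => |latticeDet (Γ.dir a) d|]
  · congr 1
    refine Finset.sum_congr rfl fun d _ => ?_
    refine if_congr ?_ (abs_latticeDet_eq hu).symm rfl
    simp only [hU]
    refine exists_congr fun t => and_congr_right fun _ => exists_congr fun s =>
      and_congr_right fun _ => ?_
    rw [← e, eq_sub_iff_add_eq]
  · intro t ht hq
    obtain ⟨v⟩ := hT.nonempty_vertex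
    have hmem := ((hU (x + t • latticeToPlane u)).2 ⟨t, ht, rfl⟩).1
    refine hy.2.1 v _ (PlaneGraph.edgeInterior_subset_carrier a hmem) ?_
    rw [hT.pos_eq, ← hq]; abel

theorem exists_maximalExponents_eq_singleton (hT : IsTripod Λ S c q) {z : ℝ × ℝ}
    (hz : z ∉ Λ.carrier) : ∃ m, maximalExponents S c z = {m} := by
  rw [hT.mem_carrier_iff, Set.not_nontrivial_iff] at hz
  obtain ⟨m, hm⟩ := maximalExponents_nonempty (c := c) hT.nonempty z
  exact ⟨m, hz.eq_singleton_of_mem hm⟩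

/-- At a point of an edge at which the tropical polynomial of the line has only one slope along the
edge, the translated line does not pass. -/
theorem exists_maximalExponents_eq_of_slope (hT : IsTripod Λ S c q) {z y : ℝ × ℝ} {a : Γ.Edge}
    (hy : Γ.MeetsProperly Λ y) (hz : z ∈ Γ.edgeInterior a) {u : ℤ × ℤ}
    (hu : u = Γ.dir a ∨ u = -Γ.dir a) {σ : ℤ}
    (hσ : ∀ m ∈ maximalExponents S c (z - y), latticePairing m u = σ) :
    ∃ m, maximalExponents S c (z - y) = {m} ∧ latticePairing m u = σ := by
  by_cases hc : z - y ∈ Λ.carrier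
  · exfalso
    obtain ⟨m, hm, n, hn, hmn⟩ := (hT.mem_carrier_iff _).1 hc
    rcases PlaneGraph.mem_carrier_iff.1 hc with ⟨v, hv⟩ | ⟨b, hb⟩
    · refine hy.2.1 v z (PlaneGraph.edgeInterior_subset_carrier a hz) ?_
      rw [hv]; abel
    · rcases b with e | r
      · exact hT.isEmpty_edge.elim e
      · have hdet := hy.2.2 a (.inr r) ⟨_, hb, by rwa [sub_add_cancel]⟩
        obtain ⟨t, ht, he⟩ := hT.mem_edgeInterior_iff.1 hb
        have h1 := value_eq_of_mem hm hn
        rw [hT.value hm.1, hT.value hn.1, add_right_inj, ← he, add_sub_cancel_left,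
          planePairing_smul_lattice, planePairing_smul_lattice] at h1
        have h2 : latticePairing n (Λ.rayDir r) = latticePairing m (Λ.rayDir r) := by
          exact_mod_cast mul_left_cancel₀ ht.ne' h1
        -- Two tied exponents have equal pairings with the ray direction and, by assumption, with
        -- `u`. These vectors are independent by properness, so the exponents coincide.
        have h3 := (hσ m hm).trans (hσ n hn).symm
        have h4 : |latticeDet u (Λ.rayDir r)| ≠ 0 := by
          rw [abs_latticeDet_eq hu]; exact abs_ne_zero.2 hdet
        rw [abs_ne_zero] at h4
        simp only [latticePairing] at h2 h3
        simp only [latticeDet] at h4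
        apply hmn
        ext
        · have : (m.1 - n.1) * (u.1 * (Λ.rayDir r).2 - u.2 * (Λ.rayDir r).1) = 0 := by
            linear_combination (Λ.rayDir r).2 * h3 + u.2 * h2
          have := (mul_eq_zero.1 this).resolve_right h4
          linarith
        · have : (m.2 - n.2) * (u.1 * (Λ.rayDir r).2 - u.2 * (Λ.rayDir r).1) = 0 := by
            linear_combination -u.1 * h2 - (Λ.rayDir r).1 * h3
          have := (mul_eq_zero.1 this).resolve_right h4
          linarith
  · obtain ⟨m, hm⟩ := exists_maximalExponents_eq_singleton hT hc
    exact ⟨m, hm, hσ m (by rw [hm]; rfl)⟩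

/-- Close to a point, in a fixed direction and up to a small translation, there is only one slope. -/
theorem eventually_slope_eq (hS : S.Nonempty) (x : ℝ × ℝ) {u : ℤ × ℤ} (v : ℝ × ℝ) {ν : ℝ}
    (hν : 0 < ν) : ∀ᶠ r in 𝓝[>] (0 : ℝ), ∀ᶠ ε in 𝓝[>] (0 : ℝ),
      ∀ m ∈ maximalExponents S c (x + (r / ν) • latticeToPlane u - ε • v),
        latticePairing m u = maxSlope S c x u := by
  have htend : Tendsto (fun r : ℝ => r / ν) (𝓝[>] 0) (𝓝[>] 0) := by
    refine tendsto_nhdsWithin_iff.2 ⟨?_, ?_⟩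
    · have := (continuous_id.div_const ν).tendsto (0 : ℝ)
      simp only [id, zero_div] at this
      exact this.mono_left nhdsWithin_le_nhds
    · filter_upwards [self_mem_nhdsWithin] with r (hr : 0 < r)
      exact Set.mem_Ioi.2 (by positivity)
  filter_upwards [htend.eventually (eventually_mem_maximalExponents_iff (c := c) hS x u)] with r hr
  have hcont : Continuous fun ε : ℝ => x + (r / ν) • latticeToPlane u - ε • v := by fun_prop
  have htend2 : Tendsto (fun ε : ℝ => x + (r / ν) • latticeToPlane u - ε • v) (𝓝[>] 0)
      (𝓝 (x + (r / ν) • latticeToPlane u)) := by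
    have := hcont.tendsto 0
    simp only [zero_smul, sub_zero] at this
    exact this.mono_left nhdsWithin_le_nhds
  -- With `r` fixed, a sufficiently small translation can only shrink the set of maximal exponents.
  filter_upwards [htend2.eventually (eventually_maximalExponents_subset hS _)] with ε hε m hm
  exact ((hr m).1 (hε hm)).2

-- An edge ending at `v` does so at only one of its ends, so no term is counted twice.
open Classical in
theorem sum_edge_eq_sum_halfEdge (v : Γ.graph.V) (f : Γ.Edge → ℤ)
    (hf : ∀ a, (∀ k : Γ.HalfEdge, Γ.base k = v → Γ.edgeOf k ≠ a) → f a = 0) :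
    ∑ a, f a = ∑ k : Γ.HalfEdge, if Γ.base k = v then f (Γ.edgeOf k) else 0 := by
  rw [Fintype.sum_sum_type, Fintype.sum_sum_type, Fintype.sum_sum_type, ← add_assoc,
    ← Finset.sum_add_distrib]
  congr 1
  · refine Finset.sum_congr rfl fun e _ => ?_
    change f (.inl e) = (if Γ.graph.src e = v then f (.inl e) else 0)
      + if Γ.graph.tgt e = v then f (.inl e) else 0
    by_cases h1 : Γ.graph.src e = v
    · rw [if_pos h1, if_neg, add_zero]
      intro h2
      exact PlaneGraph.src_ne_tgt e (h1.trans h2.symm)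
    · by_cases h2 : Γ.graph.tgt e = v
      · rw [if_neg h1, if_pos h2, zero_add]
      · rw [if_neg h1, if_neg h2, hf]
        · rfl
        · rintro (e' | e' | r) hk he <;>
            simp only [PlaneGraph.edgeOf, PlaneGraph.base, Sum.elim_inl, Sum.elim_inr,
              Sum.inl.injEq, reduceCtorEq] at he hk
          · exact h1 (he ▸ hk)
          · exact h2 (he ▸ hk)
  · refine Finset.sum_congr rfl fun r _ => ?_
    change f (.inr r) = if Γ.graph.root r = v then f (.inr r) else 0
    split_ifs with h
    · rfl
    · apply hf
      rintro (e' | e' | r') hk he <;>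
        simp only [PlaneGraph.edgeOf, PlaneGraph.base, Sum.elim_inl, Sum.elim_inr,
          Sum.inr.injEq, reduceCtorEq] at he hk
      exact h (he ▸ hk)

open Classical in
/-- The stable intersection number with a tropical line at a vertex. -/
theorem eventually_intersectionCount_vertex (hT : IsTripod Λ S c q) {y : ℝ × ℝ}
    (hy : Γ.GenericDirection Λ y) (v : Γ.graph.V) :
    ∀ᶠ r in 𝓝[>] (0 : ℝ), ∀ᶠ ε in 𝓝[>] (0 : ℝ),
      Γ.intersectionCount Λ (ε • y) (Metric.ball (Γ.pos v) r)
        = ∑ k : Γ.HalfEdge, if Γ.base k = v then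
            (Γ.halfWeight k : ℤ) * maxSlope S c (Γ.pos v) (Γ.outDir k) else 0 := by
  have h1 : ∀ᶠ r in 𝓝[>] (0 : ℝ), ∀ k : Γ.HalfEdge, _ :=
    eventually_all.2 fun k => PlaneGraph.eventually_edgeOf_inter_ball k
  have h2 : ∀ᶠ r in 𝓝[>] (0 : ℝ), ∀ k : Γ.HalfEdge, _ :=
    eventually_all.2 fun k : Γ.HalfEdge => eventually_slope_eq (c := c) (u := Γ.outDir k)
      hT.nonempty (Γ.pos v) y (PlaneGraph.norm_outDir_pos k)
  filter_upwards [h1, h2, eventually_edgeInterior_vertex v, self_mem_nhdsWithin]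
    with r h1 h2 h3 (hr : 0 < r)
  filter_upwards [hy, eventually_all.2 h2] with ε hε h2
  -- The translated line misses the vertex, so one term is maximal there; the same `m₀` serves as
  -- starting term for every half-edge at `v`.
  obtain ⟨m₀, hm₀⟩ := exists_maximalExponents_eq_singleton hT (z := Γ.pos v - ε • y)
    fun hmem => hε.1 v _ hmem (by rw [sub_add_cancel])
  have hcount : ∀ k : Γ.HalfEdge, Γ.base k = v →
      edgeCount Γ Λ (ε • y) (Metric.ball (Γ.pos v) r) (Γ.edgeOf k)
        = Γ.halfWeight k * (maxSlope S c (Γ.pos v) (Γ.outDir k)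
          - latticePairing m₀ (Γ.outDir k)) := by
    rintro k rfl
    obtain ⟨h4, h5⟩ := h1 k
    obtain ⟨m₁, hm₁, hslope⟩ := exists_maximalExponents_eq_of_slope hT hε h5
      (PlaneGraph.outDir_eq_or k) (h2 k)
    rw [← hslope]
    refine edgeCount_eq hT hε (PlaneGraph.outDir_eq_or k)
      (div_pos hr (PlaneGraph.norm_outDir_pos k)) h4 ?_ hm₁
    rw [zero_smul, add_zero]; exact hm₀
  rw [intersectionCount_eq_sum, sum_edge_eq_sum_halfEdge v _ fun a ha =>
    edgeCount_eq_zero fun z hz => h3 a ha z hz]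
  -- The starting slopes all come from `m₀`, and their weighted sum vanishes by balancing.
  have hbal := balanced_halfEdge v m₀
  refine Eq.trans ?_ (sub_eq_self.2 hbal)
  rw [← Finset.sum_sub_distrib]
  refine Finset.sum_congr rfl fun k _ => ?_
  split_ifs with hk
  · rw [hcount k hk]; ring
  · rfl

/-- The stable intersection number with a tropical line at an interior point of an edge. -/
theorem eventually_intersectionCount_edge (hT : IsTripod Λ S c q) {y : ℝ × ℝ}
    (hy : Γ.GenericDirection Λ y) {a : Γ.Edge} {x : ℝ × ℝ} (hx : x ∈ Γ.edgeInterior a) :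
    ∀ᶠ r in 𝓝[>] (0 : ℝ), ∀ᶠ ε in 𝓝[>] (0 : ℝ),
      Γ.intersectionCount Λ (ε • y) (Metric.ball x r)
        = Γ.weight a * (maxSlope S c x (Γ.dir a) + maxSlope S c x (-Γ.dir a)) := by
  classical
  have hu : 0 < ‖latticeToPlane (Γ.dir a)‖ :=
    norm_pos_iff.2 (latticeToPlane_ne_zero (PlaneGraph.dir_primitive a))
  have h3 : ∀ᶠ r in 𝓝[>] (0 : ℝ), ∀ b : Γ.Edge, b ≠ a →
      ∀ z ∈ Metric.ball x r, z ∉ Γ.edgeInterior b := by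
    rw [eventually_all]
    intro b
    by_cases hb : b = a
    · exact Eventually.of_forall fun _ h => absurd hb h
    · filter_upwards [PlaneGraph.eventually_edgeInterior_inter_ball_empty b
        fun h => hb (edge_eq_of_mem_closedEdge hx h).symm] with r hr _
      exact hr
  filter_upwards [PlaneGraph.eventually_edgeInterior_inter_ball a hx, h3,
    eventually_slope_eq (c := c) (u := Γ.dir a) hT.nonempty x y hu,
    eventually_slope_eq (c := c) (u := -Γ.dir a) hT.nonempty x y hu, self_mem_nhdsWithin]
    with r h1 h3 h4 h5 (hr : 0 < r)
  filter_upwards [hy, h4, h5] with ε hε h4 h5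
  have e : ∀ t : ℝ, t • latticeToPlane (-Γ.dir a) = (-t) • latticeToPlane (Γ.dir a) := fun t => by
    rw [latticeToPlane_neg, smul_neg, neg_smul]
  rw [e] at h5
  obtain ⟨m₁, hm₁, hs₁⟩ := exists_maximalExponents_eq_of_slope hT hε h1.2.1 (Or.inl rfl) h4
  obtain ⟨m₀, hm₀, hs₀⟩ := exists_maximalExponents_eq_of_slope hT hε h1.2.2 (Or.inr rfl) h5
  have hpos : 0 < r / ‖latticeToPlane (Γ.dir a)‖ := div_pos hr hu
  -- The increase of slope between the two exits from the ball is the sum of the two outward slopes,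
  -- as reversing the direction changes the sign.
  rw [intersectionCount_eq_sum, Finset.sum_eq_single_of_mem a (Finset.mem_univ _)
    fun b _ hb => edgeCount_eq_zero (h3 b hb),
    edgeCount_eq hT hε (Or.inl rfl) (by linarith) h1.1 hm₀ hm₁, ← hs₁, ← hs₀, latticePairing_neg]
  ring

/-- A translation in an irrational direction moves a point off a line of rational slope. -/
theorem eventually_ne_smul_add {d : ℤ × ℤ} (hd : d ≠ 0) (z : ℝ × ℝ) :
    ∀ᶠ ε in 𝓝[>] (0 : ℝ), ∀ s : ℝ, z ≠ s • latticeToPlane d + ε • ((1 : ℝ), √2) := by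
  -- This is the determinant of `d` with `(1, √2)`. As it is nonzero, at most one value of `ε` puts
  -- the point on the translated line.
  have hdet : (d.1 : ℝ) * √2 - d.2 ≠ 0 := by
    intro h
    by_cases h1 : d.1 = 0
    · rw [h1] at h
      apply hd
      ext
      · exact h1
      · have : (d.2 : ℝ) = 0 := by push_cast at h; linarith
        exact_mod_cast this
    · apply irrational_sqrt_two
      have h1' : (d.1 : ℝ) ≠ 0 := by exact_mod_cast h1
      refine ⟨(d.2 : ℚ) / d.1, ?_⟩
      push_cast
      rw [div_eq_iff h1']
      linarith
  have hne : ∀ᶠ ε in 𝓝[>] (0 : ℝ),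
      d.1 * z.2 - d.2 * z.1 ≠ ε * ((d.1 : ℝ) * √2 - d.2) := by
    have h2 : ∀ᶠ ε in 𝓝[>] (0 : ℝ),
        ε ≠ (d.1 * z.2 - d.2 * z.1) / ((d.1 : ℝ) * √2 - d.2) := by
      by_cases h0 : (d.1 * z.2 - d.2 * z.1) / ((d.1 : ℝ) * √2 - d.2) = 0
      · rw [h0]
        filter_upwards [self_mem_nhdsWithin] with ε hε
        exact (Set.mem_Ioi.1 hε).ne'
      · exact (continuousAt_id.eventually_ne (Ne.symm h0)).filter_mono nhdsWithin_le_nhds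
    filter_upwards [h2] with ε hε h
    exact hε (by rw [eq_div_iff hdet]; exact h.symm)
  filter_upwards [hne] with ε hε s he
  apply hε
  have e1 := congrArg Prod.fst he
  have e2 := congrArg Prod.snd he
  simp only [latticeToPlane, Prod.fst_add, Prod.snd_add, Prod.smul_fst, Prod.smul_snd,
    smul_eq_mul, mul_one] at e1 e2
  rw [e1, e2]; ring

/-- Improper intersection would put one of finitely many vectors `Γ.pos v - q` or `Γ.origin a - q`
on the translate by `ε • (1, √2)` of a rational line through the origin. This happens for no small
positive `ε`. -/
theorem genericDirection (hT : IsTripod Λ S c q) : Γ.GenericDirection Λ ((1 : ℝ), √2) := by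
  have h1 : ∀ᶠ ε in 𝓝[>] (0 : ℝ), ∀ (v : Γ.graph.V), ∀ d ∈ tripodDirs, ∀ s : ℝ,
      Γ.pos v - q ≠ s • latticeToPlane d + ε • ((1 : ℝ), √2) := by
    rw [eventually_all]
    intro v
    rw [eventually_all_finset]
    intro d hd
    exact eventually_ne_smul_add (ne_zero_of_isCoprime (isCoprime_of_mem_tripodDirs hd)) _
  have h2 : ∀ᶠ ε in 𝓝[>] (0 : ℝ), ∀ (a : Γ.Edge), ∀ s : ℝ,
      Γ.origin a - q ≠ s • latticeToPlane (Γ.dir a) + ε • ((1 : ℝ), √2) :=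
    eventually_all.2 fun a =>
      eventually_ne_smul_add (ne_zero_of_isCoprime (PlaneGraph.dir_primitive a)) _
  filter_upwards [h1, h2] with ε h1 h2
  -- For coinciding vertices the parameter on the line is `s = 0`, so any direction of the tripod
  -- will do.
  have h11 : ((1, 1) : ℤ × ℤ) ∈ tripodDirs := by decide
  refine ⟨fun v x hx he => ?_, fun v x hx he => ?_, fun a b hab hdet => ?_⟩
  · rcases PlaneGraph.mem_carrier_iff.1 hx with ⟨w, rfl⟩ | ⟨b, hb⟩
    · refine h1 v _ h11 0 ?_
      rw [he, hT.pos_eq, zero_smul, zero_add, add_sub_cancel_left]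
    · rcases b with e | r
      · exact hT.isEmpty_edge.elim e
      · obtain ⟨t, ht, rfl⟩ := hT.mem_edgeInterior_iff.1 hb
        refine h1 v _ (hT.rayDir_mem r) t ?_
        rw [he]; abel
  · rw [hT.pos_eq] at he
    rcases PlaneGraph.mem_carrier_iff.1 hx with ⟨w, rfl⟩ | ⟨a, ha⟩
    · refine h1 w _ h11 0 ?_
      rw [he, zero_smul, zero_add, add_sub_cancel_left]
    · obtain ⟨t, ht, rfl⟩ := PlaneGraph.mem_edgeInterior.1 ha
      refine h2 a (-t) ?_
      rw [neg_smul, eq_sub_of_add_eq he]; abel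
  · obtain ⟨x, hx, hxa⟩ := hab
    rcases b with e | r
    · exact hT.isEmpty_edge.elim e
    · obtain ⟨t, ht, rfl⟩ := hT.mem_edgeInterior_iff.1 hx
      obtain ⟨s, hs, he⟩ := PlaneGraph.mem_edgeInterior.1 hxa
      have hd : ∃ τ : ℝ, t • latticeToPlane (Λ.rayDir r) = τ • latticeToPlane (Γ.dir a) := by
        rcases eq_or_eq_neg_of_latticeDet_eq_zero (PlaneGraph.dir_primitive a)
          (Λ.rayDir_primitive r) hdet with h | h
        · exact ⟨t, by rw [h]⟩
        · exact ⟨-t, by rw [h, latticeToPlane_neg, smul_neg, neg_smul, neg_neg]⟩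
      obtain ⟨τ, hτ⟩ := hd
      refine h2 a (τ - s) ?_
      rw [hτ] at he
      rw [eq_sub_of_add_eq he, sub_smul]; abel

end TropicalPlaneCurve

/-! ## The behaviour of a quartic at infinity -/

/-- Here `H` is the support function at `u` of the triangle of size `d`. If two distinct lattice
points attain it, `u` is an outer normal of a side: relative to a maximizing vertex, the defect of
each point is a sum of two nonnegative products, which must both vanish. -/
theorem primitive_mem_tripodDirs {d : ℤ} (hd : 0 < d) {u m m' : ℤ × ℤ} (hu : IsCoprime u.1 u.2)
    {H : ℤ} (h0 : 0 ≤ H) (h1 : d * u.1 ≤ H) (h2 : d * u.2 ≤ H)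
    (hH : H = 0 ∨ H = d * u.1 ∨ H = d * u.2)
    (hm : 0 ≤ m.1 ∧ 0 ≤ m.2 ∧ m.1 + m.2 ≤ d) (hm' : 0 ≤ m'.1 ∧ 0 ≤ m'.2 ∧ m'.1 + m'.2 ≤ d)
    (hne : m ≠ m') (hmu : latticePairing m u = H) (hmu' : latticePairing m' u = H) :
    (u = (-1, 0) ∧ H = 0) ∨ (u = (0, -1) ∧ H = 0) ∨ (u = (1, 1) ∧ H = d) := by
  obtain ⟨x, y⟩ := u
  obtain ⟨a, b⟩ := m
  obtain ⟨a', b'⟩ := m'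
  simp only [latticePairing] at *
  simp only [ne_eq, Prod.mk.injEq, not_and] at hne
  simp only [Prod.mk.injEq]
  rcases hH with rfl | rfl | rfl
  · have hx : x ≤ 0 := by by_contra h; push Not at h; nlinarith
    have hy : y ≤ 0 := by by_contra h; push Not at h; nlinarith
    have e1 : a * x = 0 := by nlinarith
    have e2 : b * y = 0 := by nlinarith
    have e3 : a' * x = 0 := by nlinarith
    have e4 : b' * y = 0 := by nlinarith
    by_cases hx0 : x = 0
    · subst hx0
      rw [isCoprime_zero_left, Int.isUnit_iff] at hu
      right; left; omega
    · by_cases hy0 : y = 0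
      · subst hy0
        rw [isCoprime_zero_right, Int.isUnit_iff] at hu
        left; omega
      · exfalso
        have := (mul_eq_zero.1 e1).resolve_right hx0
        have := (mul_eq_zero.1 e2).resolve_right hy0
        have := (mul_eq_zero.1 e3).resolve_right hx0
        have := (mul_eq_zero.1 e4).resolve_right hy0
        exact hne (by omega) (by omega)
  · have hx : 0 ≤ x := by by_contra h; push Not at h; nlinarith
    have hyx : y ≤ x := by by_contra h; push Not at h; nlinarith
    have key : ∀ a b : ℤ, 0 ≤ b → a + b ≤ d → a * x + b * y = d * x →
        (d - a - b) * x = 0 ∧ b * (x - y) = 0 := by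
      intro a b hb hab h
      have e1 : 0 ≤ (d - a - b) * x := mul_nonneg (by omega) hx
      have e2 : 0 ≤ b * (x - y) := mul_nonneg hb (by omega)
      constructor <;> nlinarith
    obtain ⟨e1, e2⟩ := key a b hm.2.1 hm.2.2 hmu
    obtain ⟨e3, e4⟩ := key a' b' hm'.2.1 hm'.2.2 hmu'
    by_cases hxy : x = y
    · subst hxy
      rw [isCoprime_self, Int.isUnit_iff] at hu
      obtain rfl : x = 1 := by omega
      right; right; simp
    · have hb := (mul_eq_zero.1 e2).resolve_right (by omega)
      have hb' := (mul_eq_zero.1 e4).resolve_right (by omega)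
      by_cases hx0 : x = 0
      · subst hx0
        rw [isCoprime_zero_left, Int.isUnit_iff] at hu
        right; left; refine ⟨⟨rfl, by omega⟩, by simp⟩
      · exfalso
        have := (mul_eq_zero.1 e1).resolve_right hx0
        have := (mul_eq_zero.1 e3).resolve_right hx0
        exact hne (by omega) (by omega)
  · have hy : 0 ≤ y := by by_contra h; push Not at h; nlinarith
    have hxy : x ≤ y := by by_contra h; push Not at h; nlinarith
    have key : ∀ a b : ℤ, 0 ≤ a → a + b ≤ d → a * x + b * y = d * y →
        (d - a - b) * y = 0 ∧ a * (y - x) = 0 := by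
      intro a b hb hab h
      have e1 : 0 ≤ (d - a - b) * y := mul_nonneg (by omega) hy
      have e2 : 0 ≤ a * (y - x) := mul_nonneg hb (by omega)
      constructor <;> nlinarith
    obtain ⟨e1, e2⟩ := key a b hm.1 hm.2.2 hmu
    obtain ⟨e3, e4⟩ := key a' b' hm'.1 hm'.2.2 hmu'
    by_cases hxy : x = y
    · subst hxy
      rw [isCoprime_self, Int.isUnit_iff] at hu
      obtain rfl : x = 1 := by omega
      right; right; simp
    · have hb := (mul_eq_zero.1 e2).resolve_right (by omega)
      have hb' := (mul_eq_zero.1 e4).resolve_right (by omega)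
      by_cases hy0 : y = 0
      · subst hy0
        rw [isCoprime_zero_right, Int.isUnit_iff] at hu
        left; refine ⟨⟨by omega, rfl⟩, by simp⟩
      · exfalso
        have := (mul_eq_zero.1 e1).resolve_right hy0
        have := (mul_eq_zero.1 e3).resolve_right hy0
        exact hne (by omega) (by omega)

theorem exponents_nonempty {Γ : TropicalPlaneCurve} {N : DualSubdivision Γ} {d : ℕ}
    (hN : N.HasDegree d) : N.exponents.Nonempty := by
  rw [Finset.nonempty_iff_ne_empty]
  intro h
  have := (forall_exponents_le_iff hN 0 0 (-1)).1 (by simp [h])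
  linarith [this.1]

/-- The unbounded edges of a curve of degree `d` have the directions of a tropical line. -/
theorem rayDir_endSlope {Γ : TropicalPlaneCurve} {N : DualSubdivision Γ} {d : ℕ} (hd : 0 < d)
    (hN : N.HasDegree d) (r : Γ.graph.R) :
    (Γ.rayDir r = (-1, 0) ∧ endSlope N.exponents (Γ.rayDir r) = 0) ∨
    (Γ.rayDir r = (0, -1) ∧ endSlope N.exponents (Γ.rayDir r) = 0) ∨
    (Γ.rayDir r = (1, 1) ∧ endSlope N.exponents (Γ.rayDir r) = d) := by
  have hS := exponents_nonempty hN
  set u := Γ.rayDir r with hu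
  set H := endSlope N.exponents u with hH
  have hle : ∀ m ∈ N.exponents, (u.1 : ℝ) * m.1 + u.2 * m.2 ≤ H := by
    intro m hm
    have : ((latticePairing m u : ℤ) : ℝ) ≤ H := by exact_mod_cast le_endSlope hm u
    simp only [latticePairing] at this; push_cast at this; linarith
  obtain ⟨h0, h1, h2⟩ := (forall_exponents_le_iff hN _ _ _).1 hle
  have h0' : 0 ≤ H := by exact_mod_cast h0
  have h1' : d * u.1 ≤ H := by rw [mul_comm]; exact_mod_cast h1
  have h2' : d * u.2 ≤ H := by rw [mul_comm]; exact_mod_cast h2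
  -- A linear form attains its maximum over the triangle at one of the three vertices.
  have hHeq : H = 0 ∨ H = d * u.1 ∨ H = d * u.2 := by
    have hmax : H ≤ max 0 (max (d * u.1) (d * u.2)) := by
      obtain ⟨m, hm, hmu⟩ := exists_endSlope hS u
      have := (forall_exponents_le_iff hN u.1 u.2
        ((max 0 (max (d * u.1) (d * u.2)) : ℤ) : ℝ)).2 ⟨?_, ?_, ?_⟩ m hm
      · rw [hH, ← hmu, latticePairing]
        have h3 : u.1 * m.1 + u.2 * m.2 ≤ max 0 (max (d * u.1) (d * u.2)) := by
          exact_mod_cast this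
        linarith
      · exact_mod_cast le_max_left _ _
      · rw [mul_comm]
        have : d * u.1 ≤ max 0 (max (d * u.1) (d * u.2)) :=
          (le_max_left _ _).trans (le_max_right _ _)
        exact_mod_cast this
      · rw [mul_comm]
        have : d * u.2 ≤ max 0 (max (d * u.1) (d * u.2)) :=
          (le_max_right _ _).trans (le_max_right _ _)
        exact_mod_cast this
    rcases le_max_iff.1 hmax with h | h
    · exact Or.inl (le_antisymm h h0')
    · rcases le_max_iff.1 h with h | h
      · exact Or.inr (Or.inl (le_antisymm h h1'))
      · exact Or.inr (Or.inr (le_antisymm h h2'))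
  -- Far out, both ends of the dual segment have the end slope. They are distinct lattice points of
  -- the triangle because the weight is positive.
  obtain ⟨T, hT, _, _, hall⟩ := exists_forall_maximalExponents (c := N.coeff) hS
    (Γ.pos (Γ.graph.root r)) u
  have hx : Γ.pos (Γ.graph.root r) + (T + 1) • latticeToPlane u ∈ Γ.edgeInterior (.inr r) :=
    PlaneGraph.mem_edgeInterior.2 ⟨T + 1, Set.mem_Ioi.2 (by linarith), rfl⟩
  obtain ⟨m, m', hm, hseg⟩ := N.edge_dual (.inr r) _ hx
  have hmm := left_mem_of_convexHull_eq_segment hseg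
  have hmm' := right_mem_of_convexHull_eq_segment hseg
  have hslope := (hall (T + 1) (by linarith)).2
  refine primitive_mem_tripodDirs (by exact_mod_cast hd) (Γ.rayDir_primitive r) h0' h1' h2' hHeq
    (exponents_bounds hN hmm.1) (exponents_bounds hN hmm'.1) ?_ (hslope m hmm) (hslope m' hmm')
  rintro rfl
  rw [sub_self] at hm
  rcases smul_eq_zero.1 hm.symm with hm | hm
  · exact (Γ.rayWeight_pos r).ne' (by exact_mod_cast hm)
  · rw [Prod.mk_eq_zero, neg_eq_zero] at hm
    exact ne_zero_of_isCoprime (Γ.rayDir_primitive r) (Prod.ext hm.2 hm.1)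

/-- The slopes at infinity: the Newton polygon of a quartic has the same sides as that of a line,
moved outwards by one and translated by `(1, 1)`. -/
theorem endSlope_quartic {Γ : TropicalPlaneCurve} {N : DualSubdivision Γ} (hN : N.HasDegree 4)
    (r : Γ.graph.R) : endSlope N.exponents (Γ.rayDir r)
      - endSlope {(0, 0), (1, 0), (0, 1)} (Γ.rayDir r) - endSlope {(1, 1)} (Γ.rayDir r) = 1 := by
  have h1 : ∀ u : ℤ × ℤ, endSlope {(1, 1)} u = u.1 + u.2 := fun u =>
    endSlope_eq ⟨_, Finset.mem_singleton_self _, by simp [latticePairing]⟩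
      (by simp [latticePairing])
  rw [h1]
  rcases rayDir_endSlope (by norm_num) hN r with ⟨hu, h⟩ | ⟨hu, h⟩ | ⟨hu, h⟩
  · rw [h, hu, endSlope_eq (a := 0) ⟨(0, 0), by simp, by simp [latticePairing]⟩
      (by simp [latticePairing])]
    norm_num
  · rw [h, hu, endSlope_eq (a := 0) ⟨(0, 0), by simp, by simp [latticePairing]⟩
      (by simp [latticePairing])]
    norm_num
  · rw [h, hu, endSlope_eq (a := 1) ⟨(1, 0), by simp, by simp [latticePairing]⟩
      (by simp [latticePairing])]
    norm_num

/-! ## Divisors on the paired metric graph -/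

namespace MetricGraph

theorem canonical_vertex (G : MetricGraph) (v : G.V) :
    G.canonical (.vertex v) = (G.valency v : ℤ) - 2 := by
  classical
  simp [canonical, Finsupp.single_apply]

theorem canonical_inEdge (G : MetricGraph) (e : G.E) (t) : G.canonical (.inEdge e t) = 0 := by
  simp [canonical]

theorem canonical_inRay (G : MetricGraph) (r : G.R) (t) : G.canonical (.inRay r t) = 0 := by
  simp [canonical]

theorem canonical_infty (G : MetricGraph) (r : G.R) : G.canonical (.infty r) = -1 := by
  classical
  simp [canonical, Finsupp.single_apply]

end MetricGraph

/-- The family `g` need not exhaust the fibre, only the part where `L` is nonzero. At a vertex this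
lets the loop points collapsed to it be ignored. -/
theorem Finsupp.mapDomain_apply_eq_sum_of_injective {α β M ι : Type*} [AddCommMonoid M] [Fintype ι] (f : α → β)
    (L : α →₀ M) (b : β) (g : ι → α) (hg : Function.Injective g) (hfg : ∀ i, f (g i) = b)
    (hL : ∀ a, f a = b → L a ≠ 0 → a ∈ Set.range g) :
    Finsupp.mapDomain f L b = ∑ i, L (g i) := by
  classical
  rw [Finsupp.mapDomain, Finsupp.sum_apply, Finsupp.sum]
  simp only [Finsupp.single_apply]
  rw [← Finset.sum_filter, ← Finset.sum_image (f := fun a => L a) fun i _ j _ h => hg h]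
  apply Finset.sum_subset
  · intro a ha
    rw [Finset.mem_filter, Finsupp.mem_support_iff] at ha
    obtain ⟨i, rfl⟩ := hL a ha.2 ha.1
    exact Finset.mem_image_of_mem _ (Finset.mem_univ i)
  · intro a ha hn
    obtain ⟨i, -, rfl⟩ := Finset.mem_image.1 ha
    by_contra h0
    exact hn (Finset.mem_filter.2 ⟨Finsupp.mem_support_iff.2 h0, hfg i⟩)

/-! ### Uniqueness of pullbacks, and tropical polynomials on the paired graph. -/

namespace DualSubdivision

variable {Γ : TropicalPlaneCurve} (N : DualSubdivision Γ) (ε : ℝ) (hε : 0 < ε)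

/-- The pullback of a divisor is unique. -/
theorem IsPullback.unique {N : DualSubdivision Γ} {ε : ℝ} {hε : 0 < ε} {D : Γ.graph.Divisor}
    {L L' : (N.pairedGraph ε hε).Divisor} (h : N.IsPullback ε hε D L)
    (h' : N.IsPullback ε hε D L') : L = L' := by
  classical
  rw [← sub_eq_zero]
  by_contra hne
  obtain ⟨p, hp⟩ := Finsupp.ne_iff.1 hne
  rw [Finsupp.zero_apply] at hp
  have hloop : ∀ p, (L - L') p ≠ 0 → ¬ N.InLoop ε hε p := by
    intro p hp hl
    apply hp
    rw [Finsupp.sub_apply, h.off_loops p hl, h'.off_loops p hl, sub_zero]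
  have h0 : Finsupp.mapDomain (N.pairing ε hε) (L - L') (N.pairing ε hε p) = 0 := by
    have : N.pushforward ε hε (L - L') = 0 := by rw [map_sub, h.lift, h'.lift, sub_self]
    exact DFunLike.congr_fun this _
  rw [Finsupp.mapDomain, Finsupp.sum_apply, Finsupp.sum] at h0
  simp only [Finsupp.single_apply] at h0
  -- The difference of two pullbacks is constant on its support within a fibre, so the push-forward
  -- there is a positive multiple of that constant and can vanish only with it.
  rw [← Finset.sum_filter, Finset.sum_congr rfl (g := fun _ => (L - L') p), Finset.sum_const,
    smul_eq_zero, Finset.card_eq_zero] at h0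
  · rcases h0 with h0 | h0
    · have : p ∈ (∅ : Finset _) := h0 ▸ Finset.mem_filter.2 ⟨Finsupp.mem_support_iff.2 hp, rfl⟩
      simp at this
    · exact hp h0
  · intro r hr
    rw [Finset.mem_filter, Finsupp.mem_support_iff] at hr
    have h1 := hloop r hr.1
    have h2 := hloop p hp
    rw [Finsupp.sub_apply, Finsupp.sub_apply, h.even r p h1 h2 hr.2, h'.even r p h1 h2 hr.2]

variable {S : Finset (ℤ × ℤ)} (c : ℤ × ℤ → ℝ)

/-- The pullback of a tropical polynomial to the paired metric graph. -/
def tropicalFunction (hS : S.Nonempty) : (N.pairedGraph ε hε).RationalFunction where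
  onVertex v := tropicalEval S c (Γ.pos v)
  onEdge := Sum.elim
    (fun a t => tropicalEval S c (Γ.pos (Γ.graph.src a.1) + t • latticeToPlane (Γ.edgeDir a.1)))
    (fun b _ => tropicalEval S c (Γ.pos b.1))
  onRay a t :=
    tropicalEval S c (Γ.pos (Γ.graph.root a.1) + t • latticeToPlane (Γ.rayDir a.1))
  edgeRight := Sum.elim
    (fun a t => maxSlope S c (Γ.pos (Γ.graph.src a.1) + t • latticeToPlane (Γ.edgeDir a.1))
      (Γ.edgeDir a.1))
    (fun _ _ => 0)
  edgeLeft := Sum.elim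
    (fun a t => maxSlope S c (Γ.pos (Γ.graph.src a.1) + t • latticeToPlane (Γ.edgeDir a.1))
      (-Γ.edgeDir a.1))
    (fun _ _ => 0)
  rayRight a t := maxSlope S c (Γ.pos (Γ.graph.root a.1) + t • latticeToPlane (Γ.rayDir a.1))
    (Γ.rayDir a.1)
  rayLeft a t := maxSlope S c (Γ.pos (Γ.graph.root a.1) + t • latticeToPlane (Γ.rayDir a.1))
    (-Γ.rayDir a.1)
  rayEnd a := endSlope S (Γ.rayDir a.1)
  onEdge_src := by
    rintro (a | b)
    · simp [pairedGraph]
    · rfl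
  onEdge_tgt := by
    rintro (a | b)
    · change tropicalEval S c (Γ.pos (Γ.graph.src a.1)
        + Γ.graph.len a.1 • latticeToPlane (Γ.edgeDir a.1)) = _
      rw [← Γ.pos_tgt]; rfl
    · rfl
  onRay_root a := by simp [pairedGraph]
  edgeRight_spec := by
    rintro (a | b) t -
    · filter_upwards [eventually_tropicalEval_eq (c := c) hS
        (Γ.pos (Γ.graph.src a.1) + t • latticeToPlane (Γ.edgeDir a.1)) (Γ.edgeDir a.1)] with h hh
      simp only [Sum.elim_inl]
      rw [← hh, add_smul, add_assoc]
    · simp [MetricGraph.HasRightSlope]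
  edgeLeft_spec := by
    rintro (a | b) t -
    · filter_upwards [eventually_tropicalEval_eq (c := c) hS
        (Γ.pos (Γ.graph.src a.1) + t • latticeToPlane (Γ.edgeDir a.1)) (-Γ.edgeDir a.1)] with h hh
      simp only [Sum.elim_inl]
      rw [← hh, sub_smul, latticeToPlane_neg, smul_neg, ← sub_eq_add_neg, add_sub_assoc]
    · simp [MetricGraph.HasLeftSlope]
  rayRight_spec a t _ := by
    filter_upwards [eventually_tropicalEval_eq (c := c) hS
      (Γ.pos (Γ.graph.root a.1) + t • latticeToPlane (Γ.rayDir a.1)) (Γ.rayDir a.1)] with h hh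
    rw [← hh, add_smul, add_assoc]
  rayLeft_spec a t _ := by
    filter_upwards [eventually_tropicalEval_eq (c := c) hS
      (Γ.pos (Γ.graph.root a.1) + t • latticeToPlane (Γ.rayDir a.1)) (-Γ.rayDir a.1)] with h hh
    rw [← hh, sub_smul, latticeToPlane_neg, smul_neg, ← sub_eq_add_neg, add_sub_assoc]
  rayEnd_spec a := exists_tropicalEval_eventually_linear hS _ _

open Classical in
/-- Sums over the edges of the paired graph at a vertex, loops aside. -/
theorem sum_pairedGraph (v : Γ.graph.V) (f g : Γ.graph.E → ℤ) (h : Γ.graph.R → ℤ) :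
    (∑ e : (N.pairedGraph ε hε).E, if (N.pairedGraph ε hε).src e = v
        then Sum.elim (fun a => f a.1) (fun _ => 0) e else 0)
      + (∑ e : (N.pairedGraph ε hε).E, if (N.pairedGraph ε hε).tgt e = v
        then Sum.elim (fun a => g a.1) (fun _ => 0) e else 0)
      + (∑ r : (N.pairedGraph ε hε).R, if (N.pairedGraph ε hε).root r = v then h r.1 else 0)
      = ∑ k : Γ.HalfEdge, if Γ.base k = v then
          (Γ.halfWeight k : ℤ) * Sum.elim f (Sum.elim g h) k else 0 := by
  have key : ∀ (P : Prop) (w : ℕ) (a : ℤ),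
      ∑ _i : Fin w, (if P then a else 0) = if P then (w : ℤ) * a else 0 := by
    intro P w a
    rw [Finset.sum_const, Finset.card_univ, Fintype.card_fin, nsmul_eq_mul, mul_ite, mul_zero]
  have h1 : ∀ (s : Γ.graph.E → Γ.graph.V) (f : Γ.graph.E → ℤ)
      (s' : (Σ v : Γ.graph.V, Fin (N.vertexWeight v)) → Γ.graph.V),
      (∑ e : (Σ e : Γ.graph.E, Fin (Γ.edgeWeight e)) ⊕ (Σ v : Γ.graph.V, Fin (N.vertexWeight v)),
        if (Sum.elim (fun a => s a.1) s' e : Γ.graph.V) = v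
          then (Sum.elim (fun a => f a.1) (fun _ => 0) e : ℤ) else 0)
        = ∑ e : Γ.graph.E, if s e = v then (Γ.edgeWeight e : ℤ) * f e else 0 := by
    intro s f s'
    rw [Fintype.sum_sum_type, Fintype.sum_sigma]
    refine Eq.trans (congrArg₂ (· + ·) (Finset.sum_congr rfl fun e _ =>
      key (s e = v) (Γ.edgeWeight e) (f e)) ?_) (add_zero _)
    exact Finset.sum_eq_zero fun b _ => ite_self _
  rw [Fintype.sum_sum_type, Fintype.sum_sum_type, ← add_assoc]
  congr 1
  · exact congrArg₂ (· + ·) (h1 _ f _) (h1 _ g _)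
  · change (∑ r : (Σ r : Γ.graph.R, Fin (Γ.rayWeight r)),
      if Γ.graph.root r.1 = v then h r.1 else 0) = _
    rw [Fintype.sum_sigma]
    simp only [key]
    rfl

-- Loops carry a constant function and contribute nothing, while an edge of weight `w` contributes
-- its slope `w` times. The sign is that of incoming slopes.
open Classical in
theorem ord_vertex (hS : S.Nonempty) (v : Γ.graph.V) :
    (N.tropicalFunction ε hε c hS).ord (.vertex v)
      = -∑ k : Γ.HalfEdge, if Γ.base k = v then
          (Γ.halfWeight k : ℤ) * maxSlope S c (Γ.pos v) (Γ.outDir k) else 0 := by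
  have h := N.sum_pairedGraph ε hε v
    (fun e => maxSlope S c (Γ.pos (Γ.graph.src e)) (Γ.edgeDir e))
    (fun e => maxSlope S c (Γ.pos (Γ.graph.tgt e)) (-Γ.edgeDir e))
    (fun r => maxSlope S c (Γ.pos (Γ.graph.root r)) (Γ.rayDir r))
  have h2 : (∑ k : Γ.HalfEdge, if Γ.base k = v then
          (Γ.halfWeight k : ℤ) * maxSlope S c (Γ.pos v) (Γ.outDir k) else 0)
      = ∑ k : Γ.HalfEdge, if Γ.base k = v then (Γ.halfWeight k : ℤ) *
        Sum.elim (fun e => maxSlope S c (Γ.pos (Γ.graph.src e)) (Γ.edgeDir e))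
          (Sum.elim (fun e => maxSlope S c (Γ.pos (Γ.graph.tgt e)) (-Γ.edgeDir e))
            (fun r => maxSlope S c (Γ.pos (Γ.graph.root r)) (Γ.rayDir r))) k else 0 := by
    refine Finset.sum_congr rfl fun k _ => ?_
    split_ifs with hk
    · subst hk
      rcases k with e | e | r <;> rfl
    · rfl
  rw [h2, ← h]
  change -(_ + _ + _) = _
  congr 2
  · congr 1
    · refine Finset.sum_congr rfl fun e _ => ?_
      rcases e with a | b
      · simp [tropicalFunction]
      · rfl
    · refine Finset.sum_congr rfl fun e _ => ?_
      rcases e with a | b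
      · change (if _ then maxSlope S c (Γ.pos (Γ.graph.src a.1)
          + Γ.graph.len a.1 • latticeToPlane (Γ.edgeDir a.1)) (-Γ.edgeDir a.1) else 0) = _
        rw [← Γ.pos_tgt]; rfl
      · rfl
  · refine Finset.sum_congr rfl fun r _ => ?_
    simp [tropicalFunction]

-- An edge of weight `w` gives `w` edge ends, and each loop counts twice.
open Classical in
theorem valency_pairedGraph (v : Γ.graph.V) : ((N.pairedGraph ε hε).valency v : ℤ)
    = (∑ k : Γ.HalfEdge, if Γ.base k = v then (Γ.halfWeight k : ℤ) else 0)
      + 2 * N.vertexWeight v := by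
  have h := N.sum_pairedGraph ε hε v (fun _ => 1) (fun _ => 1) (fun _ => 1)
  have h2 : (∑ k : Γ.HalfEdge, if Γ.base k = v then (Γ.halfWeight k : ℤ) else 0)
      = ∑ k : Γ.HalfEdge, if Γ.base k = v then (Γ.halfWeight k : ℤ) *
        Sum.elim (fun _ => 1) (Sum.elim (fun _ => 1) (fun _ => 1)) k else 0 := by
    refine Finset.sum_congr rfl fun k _ => ?_
    rcases k with e | e | r <;> simp
  have hloop : ∑ b : (Σ v : Γ.graph.V, Fin (N.vertexWeight v)), (if b.1 = v then (1 : ℤ) else 0)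
      = N.vertexWeight v := by
    rw [Fintype.sum_sigma, Finset.sum_eq_single v]
    · simp
    · exact fun b _ hb => Finset.sum_eq_zero fun _ _ => if_neg hb
    · exact fun h => absurd (Finset.mem_univ v) h
  have hend : ∀ s : Γ.graph.E → Γ.graph.V,
      (∑ e : (Σ e : Γ.graph.E, Fin (Γ.edgeWeight e)) ⊕ (Σ v : Γ.graph.V, Fin (N.vertexWeight v)),
        if (Sum.elim (fun a => s a.1) (fun b => b.1) e : Γ.graph.V) = v then (1 : ℤ) else 0)
      = (∑ e : (Σ e : Γ.graph.E, Fin (Γ.edgeWeight e)) ⊕ (Σ v : Γ.graph.V, Fin (N.vertexWeight v)),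
        if (Sum.elim (fun a => s a.1) (fun b => b.1) e : Γ.graph.V) = v
          then (Sum.elim (fun _ => 1) (fun _ => 0) e : ℤ) else 0) + N.vertexWeight v := by
    intro s
    rw [Fintype.sum_sum_type, Fintype.sum_sum_type, ← hloop]
    refine congrArg₂ (· + ·) ?_ rfl
    exact ((congrArg₂ (· + ·) rfl (Finset.sum_eq_zero fun b _ => ite_self _)).trans
      (add_zero _)).symm
  rw [h2, ← h]
  unfold MetricGraph.valency
  push_cast
  have e1 := hend Γ.graph.src
  have e2 := hend Γ.graph.tgt
  refine (congrArg₂ (· + ·) (congrArg₂ (· + ·) e1 e2) rfl).trans ?_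
  rw [two_mul, add_add_add_comm, add_assoc, add_assoc, add_comm (_ + _ : ℤ) (Finset.sum _ _)]
  simp only [← add_assoc]
  rfl

end DualSubdivision

/-! ## The line section and the canonical divisor -/

namespace TropicalPlaneCurve

/-- The stable intersection is unique. -/
theorem IsStableIntersection.unique {Γ Λ : TropicalPlaneCurve} {D D' : Γ.graph.Divisor}
    (h : Γ.IsStableIntersection Λ D) (h' : Γ.IsStableIntersection Λ D') : D = D' := by
  obtain ⟨v, hv⟩ := h.exists_generic
  have key : ∀ p x, Γ.location p = some x → D p = D' p := by
    intro p x hp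
    obtain ⟨r, h1, h2⟩ := ((h.limit v hv p x hp).and (h'.limit v hv p x hp)).exists
    obtain ⟨δ, h3, h4⟩ := (h1.and h2).exists
    exact h3.symm.trans h4
  ext p
  cases p with
  | vertex v => exact key _ _ rfl
  | inEdge e t => exact key _ _ rfl
  | inRay r t => exact key _ _ rfl
  | infty r => rw [h.infty, h'.infty]

end TropicalPlaneCurve

/-! ### The section divisor and its comparison with the canonical divisor. -/

namespace DualSubdivision

variable {Γ : TropicalPlaneCurve} (N : DualSubdivision Γ) (ε : ℝ) (hε : 0 < ε)

section Pushforward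

variable {N ε hε} {L : (N.pairedGraph ε hε).Divisor}

theorem pushforward_vertex (hL : ∀ p, N.InLoop ε hε p → L p = 0) (v : Γ.graph.V) :
    N.pushforward ε hε L (.vertex v) = L (.vertex v) := by
  refine (Finsupp.mapDomain_apply_eq_sum_of_injective _ _ _
    (fun _ : Unit => .vertex v) (fun _ _ _ => rfl) (fun _ => rfl) ?_).trans
    (Fintype.sum_unique _)
  rintro (w | ⟨a | b, t⟩ | ⟨a, t⟩ | a) hp hne
  · obtain rfl := MetricGraph.Point.vertex.inj (G := Γ.graph)
      (show MetricGraph.Point.vertex (G := Γ.graph) w = .vertex v from hp)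
    exact ⟨(), rfl⟩
  · simp [pairing] at hp
  · exact absurd (hL (.inEdge (.inr b) t) trivial) hne
  · simp [pairing] at hp
  · simp [pairing] at hp

theorem pushforward_inEdge (e : Γ.graph.E) (t) : N.pushforward ε hε L (.inEdge e t)
    = ∑ i : Fin (Γ.edgeWeight e), L (.inEdge (.inl ⟨e, i⟩) t) := by
  refine Finsupp.mapDomain_apply_eq_sum_of_injective _ _ _
    (fun i : Fin (Γ.edgeWeight e) =>
      MetricGraph.Point.inEdge (G := N.pairedGraph ε hε) (.inl ⟨e, i⟩) t)
    (fun i j h => ?_) (fun _ => rfl) ?_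
  · exact eq_of_heq (Sigma.mk.inj (Sum.inl_injective ((MetricGraph.Point.inEdge.inj h).1))).2
  rintro (w | ⟨⟨e', i⟩ | b, t'⟩ | ⟨a, t'⟩ | a) hp hne
  · simp [pairing] at hp
  · obtain ⟨rfl, ht⟩ := MetricGraph.Point.inEdge.inj hp
    cases eq_of_heq ht
    exact ⟨i, rfl⟩
  · simp [pairing] at hp
  · simp [pairing] at hp
  · simp [pairing] at hp

theorem pushforward_inRay (r : Γ.graph.R) (t) : N.pushforward ε hε L (.inRay r t)
    = ∑ i : Fin (Γ.rayWeight r), L (.inRay ⟨r, i⟩ t) := by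
  refine Finsupp.mapDomain_apply_eq_sum_of_injective _ _ _
    (fun i : Fin (Γ.rayWeight r) =>
      MetricGraph.Point.inRay (G := N.pairedGraph ε hε) ⟨r, i⟩ t)
    (fun i j h => ?_) (fun _ => rfl) ?_
  · exact eq_of_heq (Sigma.mk.inj ((MetricGraph.Point.inRay.inj h).1)).2
  rintro (w | ⟨a | b, t'⟩ | ⟨⟨r', i⟩, t'⟩ | a) hp hne
  · simp [pairing] at hp
  · simp [pairing] at hp
  · simp [pairing] at hp
  · obtain ⟨rfl, ht⟩ := MetricGraph.Point.inRay.inj hp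
    cases ht
    exact ⟨i, rfl⟩
  · simp [pairing] at hp

theorem pushforward_infty (r : Γ.graph.R) : N.pushforward ε hε L (.infty r)
    = ∑ i : Fin (Γ.rayWeight r), L (.infty ⟨r, i⟩) := by
  refine Finsupp.mapDomain_apply_eq_sum_of_injective _ _ _
    (fun i : Fin (Γ.rayWeight r) =>
      MetricGraph.Point.infty (G := N.pairedGraph ε hε) ⟨r, i⟩)
    (fun i j h => ?_) (fun _ => rfl) ?_
  · exact eq_of_heq (Sigma.mk.inj (MetricGraph.Point.infty.inj h)).2
  rintro (w | ⟨a | b, t'⟩ | ⟨a, t'⟩ | ⟨r', i⟩) hp hne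
  · simp [pairing] at hp
  · simp [pairing] at hp
  · simp [pairing] at hp
  · simp [pairing] at hp
  · cases MetricGraph.Point.infty.inj hp
    exact ⟨i, rfl⟩

end Pushforward

section TropicalFunction

variable {S : Finset (ℤ × ℤ)} (c : ℤ × ℤ → ℝ) (hS : S.Nonempty)

theorem ord_edge (a : Σ e : Γ.graph.E, Fin (Γ.edgeWeight e)) (t : Set.Ioo 0 (Γ.graph.len a.1)) :
    (N.tropicalFunction ε hε c hS).ord (.inEdge (.inl a) t)
      = -(maxSlope S c (Γ.pos (Γ.graph.src a.1) + t.1 • latticeToPlane (Γ.edgeDir a.1))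
          (Γ.edgeDir a.1)
        + maxSlope S c (Γ.pos (Γ.graph.src a.1) + t.1 • latticeToPlane (Γ.edgeDir a.1))
          (-Γ.edgeDir a.1)) := rfl

theorem ord_ray (a : Σ r : Γ.graph.R, Fin (Γ.rayWeight r)) (t) :
    (N.tropicalFunction ε hε c hS).ord (.inRay a t)
      = -(maxSlope S c (Γ.pos (Γ.graph.root a.1) + t.1 • latticeToPlane (Γ.rayDir a.1))
          (Γ.rayDir a.1)
        + maxSlope S c (Γ.pos (Γ.graph.root a.1) + t.1 • latticeToPlane (Γ.rayDir a.1))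
          (-Γ.rayDir a.1)) := rfl

theorem ord_infty (a : Σ r : Γ.graph.R, Fin (Γ.rayWeight r)) :
    (N.tropicalFunction ε hε c hS).ord (.infty a) = endSlope S (Γ.rayDir a.1) := rfl

/-- Vertices and points at infinity are finite in number, loops carry no zeros, and on each edge the
slope changes at finitely many points. -/
theorem finite_setOf_ord_ne_zero : {p | (N.tropicalFunction ε hε c hS).ord p ≠ 0}.Finite := by
  refine ((Set.finite_range MetricGraph.Point.vertex).union
    ((Set.finite_iUnion fun a : Σ e : Γ.graph.E, Fin (Γ.edgeWeight e) =>
      Set.Finite.image (fun t => MetricGraph.Point.inEdge (G := N.pairedGraph ε hε) (.inl a) t)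
      ((finite_setOf_maxSlope_add_ne_zero (c := c) (Γ.pos (Γ.graph.src a.1))
        (Γ.edgeDir a.1) hS).preimage Subtype.val_injective.injOn)).union
    ((Set.finite_iUnion fun a : Σ r : Γ.graph.R, Fin (Γ.rayWeight r) =>
      Set.Finite.image (fun t => MetricGraph.Point.inRay (G := N.pairedGraph ε hε) a t)
      ((finite_setOf_maxSlope_add_ne_zero (c := c) (Γ.pos (Γ.graph.root a.1))
        (Γ.rayDir a.1) hS).preimage Subtype.val_injective.injOn)).union
    (Set.finite_range MetricGraph.Point.infty)))).subset ?_
  rintro (v | ⟨a | b, t⟩ | ⟨a, t⟩ | a) hp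
  · exact Or.inl ⟨v, rfl⟩
  · exact Or.inr (Or.inl (Set.mem_iUnion.2 ⟨a, t, neg_ne_zero.1 hp, rfl⟩))
  · exact absurd rfl hp
  · exact Or.inr (Or.inr (Or.inl (Set.mem_iUnion.2 ⟨a, t, neg_ne_zero.1 hp, rfl⟩)))
  · exact Or.inr (Or.inr (Or.inr ⟨a, rfl⟩))

/-- The zeros of the tropical polynomial on the finite part of the paired metric graph. -/
def sectionValue : (N.pairedGraph ε hε).Point → ℤ
  -- The end slopes of the polynomial are discarded: the line section has no chips at infinity. The
  -- minus sign below turns incoming slopes into outgoing ones.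
  | .infty _ => 0
  | p => -(N.tropicalFunction ε hε c hS).ord p

theorem finite_support_sectionValue : (N.sectionValue ε hε c hS).support.Finite := by
  refine (N.finite_setOf_ord_ne_zero ε hε c hS).subset ?_
  rintro (v | ⟨e, t⟩ | ⟨a, t⟩ | a) hp
  · exact neg_ne_zero.1 hp
  · exact neg_ne_zero.1 hp
  · exact neg_ne_zero.1 hp
  · exact absurd rfl hp

/-- The divisor cut out on the paired metric graph by a tropical polynomial. -/
def sectionDivisor : (N.pairedGraph ε hε).Divisor :=
  Finsupp.ofSupportFinite _ (N.finite_support_sectionValue ε hε c hS)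

theorem sectionDivisor_vertex (v) : N.sectionDivisor ε hε c hS (.vertex v)
    = -(N.tropicalFunction ε hε c hS).ord (.vertex v) := rfl

theorem sectionDivisor_inEdge (e t) : N.sectionDivisor ε hε c hS (.inEdge e t)
    = -(N.tropicalFunction ε hε c hS).ord (.inEdge e t) := rfl

theorem sectionDivisor_inRay (a t) : N.sectionDivisor ε hε c hS (.inRay a t)
    = -(N.tropicalFunction ε hε c hS).ord (.inRay a t) := rfl

theorem sectionDivisor_infty (a) : N.sectionDivisor ε hε c hS (.infty a) = 0 := rfl

theorem sectionDivisor_inLoop (p) (hp : N.InLoop ε hε p) : N.sectionDivisor ε hε c hS p = 0 := by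
  rcases p with v | ⟨a | b, t⟩ | ⟨a, t⟩ | a
  · exact hp.elim
  · exact hp.elim
  · rfl
  · exact hp.elim
  · exact hp.elim

/-- Parallel edges carry identical copies of the function, so the order outside the loops depends
only on the image point. -/
theorem isPullback_sectionDivisor : N.IsPullback ε hε
    (N.pushforward ε hε (N.sectionDivisor ε hε c hS)) (N.sectionDivisor ε hε c hS) where
  lift := rfl
  off_loops := N.sectionDivisor_inLoop ε hε c hS
  even := by
    rintro (v | ⟨⟨e, i⟩ | b, t⟩ | ⟨⟨r, i⟩, t⟩ | ⟨r, i⟩)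
      (v' | ⟨⟨e', i'⟩ | b', t'⟩ | ⟨⟨r', i'⟩, t'⟩ | ⟨r', i'⟩) h h' hp
    all_goals first
      | exact absurd trivial h
      | exact absurd trivial h'
      | (exfalso; simp [pairing] at hp; done)
      | skip
    · rw [MetricGraph.Point.vertex.inj hp]
    · obtain ⟨rfl, ht⟩ := MetricGraph.Point.inEdge.inj hp
      cases eq_of_heq ht
      rfl
    · obtain ⟨rfl, ht⟩ := MetricGraph.Point.inRay.inj hp
      cases ht
      rfl
    · rfl

/-- The divisor cut out by the tropical polynomial of a line is the stable intersection with the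
line. -/
theorem isStableIntersection_pushforward {Λ : TropicalPlaneCurve} {q : ℝ × ℝ}
    (hT : IsTripod Λ S c q) : Γ.IsStableIntersection Λ
      (N.pushforward ε hε (N.sectionDivisor ε hε c hS)) where
  exists_generic := ⟨_, TropicalPlaneCurve.genericDirection hT⟩
  limit y hy p x hp := by
    rcases p with v | ⟨e, t⟩ | ⟨r, t⟩ | r
    · cases hp
      rw [pushforward_vertex (N.sectionDivisor_inLoop ε hε c hS),
        N.sectionDivisor_vertex ε hε c hS v, N.ord_vertex ε hε c hS v, neg_neg]
      exact TropicalPlaneCurve.eventually_intersectionCount_vertex hT hy v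
    · cases hp
      rw [pushforward_inEdge, Finset.sum_congr rfl fun i _ =>
        ((N.sectionDivisor_inEdge ε hε c hS (.inl ⟨e, i⟩) t).trans (congrArg _ (N.ord_edge ε hε c hS ⟨e, i⟩ t))).trans
          (neg_neg _)]
      dsimp only
      rw [Finset.sum_const, Finset.card_univ, Fintype.card_fin, nsmul_eq_mul]
      exact TropicalPlaneCurve.eventually_intersectionCount_edge hT hy (a := .inl e) ⟨t, rfl⟩
    · cases hp
      rw [pushforward_inRay, Finset.sum_congr rfl fun i _ =>
        ((N.sectionDivisor_inRay ε hε c hS ⟨r, i⟩ t).trans (congrArg _ (N.ord_ray ε hε c hS ⟨r, i⟩ t))).trans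
          (neg_neg _)]
      dsimp only
      rw [Finset.sum_const, Finset.card_univ, Fintype.card_fin, nsmul_eq_mul]
      exact TropicalPlaneCurve.eventually_intersectionCount_edge hT hy (a := .inr r) ⟨t, rfl⟩
    · cases hp
  infty r := by
    rw [pushforward_infty]
    exact Finset.sum_eq_zero fun i _ => sectionDivisor_infty ..

end TropicalFunction

theorem maxSlope_singleton (m : ℤ × ℤ) (c : ℤ × ℤ → ℝ) (x : ℝ × ℝ) (u : ℤ × ℤ) :
    maxSlope {m} c x u = latticePairing m u :=
  maxSlope_eq ⟨Finset.mem_singleton_self m, fun n hn => by rw [Finset.mem_singleton.1 hn]⟩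
    fun n hn => by rw [Finset.mem_singleton.1 hn.1]

/-- The tropical polynomial of a curve is linear along the edges of the curve. -/
theorem maxSlope_edge {a : Γ.Edge} {x : ℝ × ℝ} (hx : x ∈ Γ.edgeInterior a) : maxSlope N.exponents N.coeff x (Γ.dir a)
      + maxSlope N.exponents N.coeff x (-Γ.dir a) = 0 := by
  obtain ⟨m, m', hm, hseg⟩ := N.edge_dual a x hx
  have hmA := left_mem_of_convexHull_eq_segment hseg
  have key : ∀ n ∈ maximalExponents N.exponents N.coeff x,
      latticePairing n (Γ.dir a) = latticePairing m (Γ.dir a) := by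
    intro n hn
    have hn' : latticeToPlane n ∈ segment ℝ (latticeToPlane m) (latticeToPlane m') :=
      hseg ▸ subset_convexHull _ _ ⟨n, hn, rfl⟩
    obtain ⟨s, -, hs⟩ := (segment_eq_image' ℝ (latticeToPlane m) (latticeToPlane m')) ▸ hn'
    have h1 := congrArg Prod.fst hm
    have h2 := congrArg Prod.snd hm
    have h3 := congrArg Prod.fst hs
    have h4 := congrArg Prod.snd hs
    simp only [Prod.fst_sub, Prod.snd_sub, Prod.smul_fst, Prod.smul_snd, smul_eq_mul,
      Prod.fst_add, Prod.snd_add, latticeToPlane] at h1 h2 h3 h4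
    have h1' : (m'.1 : ℝ) - m.1 = Γ.weight a * -((Γ.dir a).2 : ℝ) := by exact_mod_cast h1
    have h2' : (m'.2 : ℝ) - m.2 = Γ.weight a * ((Γ.dir a).1 : ℝ) := by exact_mod_cast h2
    rw [h1'] at h3
    rw [h2'] at h4
    have : ((latticePairing n (Γ.dir a) : ℤ) : ℝ) = (latticePairing m (Γ.dir a) : ℤ) := by
      unfold latticePairing
      push_cast
      rw [← h3, ← h4]
      ring
    exact_mod_cast this
  rw [maxSlope_eq hmA fun n hn => (key n hn).le, maxSlope_eq (u := -Γ.dir a) hmA fun n hn => by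
    rw [latticePairing_neg, latticePairing_neg, key n hn], latticePairing_neg, add_neg_cancel]

open Classical in
/-- The divisor cut out by a line is linearly equivalent to the canonical divisor. -/
theorem linearlyEquivalent_canonical (hN : N.HasDegree 4) {S : Finset (ℤ × ℤ)} (c : ℤ × ℤ → ℝ)
    (hS : S.Nonempty) (hS' : S = {(0, 0), (1, 0), (0, 1)}) :
    (N.pairedGraph ε hε).LinearlyEquivalent (N.sectionDivisor ε hε c hS)
      (N.pairedGraph ε hε).canonical := by
  have hNe := exponents_nonempty hN
  -- The function is `F - ℓ - (x + y)`: the first summand produces `-K` at finite points, the second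
  -- the section, and the third corrects the slopes at infinity.
  refine ⟨((N.tropicalFunction ε hε N.coeff hNe).add (N.tropicalFunction ε hε c hS).neg).add
    (N.tropicalFunction ε hε 0 (Finset.singleton_nonempty (1, 1))).neg, fun p => ?_⟩
  rw [MetricGraph.RationalFunction.ord_add, MetricGraph.RationalFunction.ord_add,
    MetricGraph.RationalFunction.ord_neg, MetricGraph.RationalFunction.ord_neg, Finsupp.sub_apply]
  rcases p with v | ⟨⟨e, i⟩ | b, t⟩ | ⟨⟨r, i⟩, t⟩ | ⟨r, i⟩
  -- Pick's formula gives the order of `F`, and balancing makes the order of the monomial zero.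
  · have key : ∀ v : Γ.graph.V, (N.tropicalFunction ε hε N.coeff hNe).ord (.vertex v)
        - (N.tropicalFunction ε hε 0 (Finset.singleton_nonempty (1, 1))).ord (.vertex v)
        = 2 - (N.pairedGraph ε hε).valency v := by
      intro v
      rw [N.ord_vertex ε hε N.coeff hNe v,
        N.ord_vertex ε hε 0 (Finset.singleton_nonempty (1, 1)) v, N.sum_maxSlope_vertex,
        N.valency_pairedGraph ε hε v]
      simp only [maxSlope_singleton, TropicalPlaneCurve.balanced_halfEdge]
      ring
    rw [MetricGraph.canonical_vertex _ v, N.sectionDivisor_vertex ε hε c hS v]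
    linarith [key v]
  · rw [MetricGraph.canonical_inEdge (N.pairedGraph ε hε) (.inl ⟨e, i⟩) t,
      N.sectionDivisor_inEdge ε hε c hS (.inl ⟨e, i⟩) t, N.ord_edge ε hε N.coeff hNe ⟨e, i⟩ t,
      N.ord_edge ε hε 0 (Finset.singleton_nonempty (1, 1)) ⟨e, i⟩ t, maxSlope_singleton, maxSlope_singleton, latticePairing_neg]
    have := N.maxSlope_edge (a := .inl e) ⟨t, rfl⟩
    change maxSlope _ _ _ (Γ.edgeDir e) + maxSlope _ _ _ (-Γ.edgeDir e) = 0 at this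
    rw [this]
    ring
  · rw [MetricGraph.canonical_inEdge (N.pairedGraph ε hε) (.inr b) t]
    rfl
  · rw [MetricGraph.canonical_inRay (N.pairedGraph ε hε) ⟨r, i⟩ t,
      N.sectionDivisor_inRay ε hε c hS ⟨r, i⟩ t, N.ord_ray ε hε N.coeff hNe ⟨r, i⟩ t,
      N.ord_ray ε hε 0 (Finset.singleton_nonempty (1, 1)) ⟨r, i⟩ t, maxSlope_singleton, maxSlope_singleton, latticePairing_neg]
    have := N.maxSlope_edge (a := .inr r) ⟨t, rfl⟩
    change maxSlope _ _ _ (Γ.rayDir r) + maxSlope _ _ _ (-Γ.rayDir r) = 0 at this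
    rw [this]
    ring
  -- The section vanishes at infinity and the canonical divisor is `-1` there, so the end slope of
  -- the function must be `1`.
  · rw [MetricGraph.canonical_infty (N.pairedGraph ε hε) ⟨r, i⟩, N.sectionDivisor_infty ε hε c hS ⟨r, i⟩,
      N.ord_infty ε hε N.coeff hNe ⟨r, i⟩, N.ord_infty ε hε c hS ⟨r, i⟩,
      N.ord_infty ε hε 0 (Finset.singleton_nonempty (1, 1)) ⟨r, i⟩]
    have := endSlope_quartic hN r
    rw [← hS'] at this
    linarith

theorem picClass_eq_of_linearlyEquivalent {L L' : (N.pairedGraph ε hε).Divisor}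
    (h : (N.pairedGraph ε hε).LinearlyEquivalent L L') :
    N.picClass ε hε (N.pushforward ε hε L) = N.picClass ε hε (N.pushforward ε hε L') := by
  rw [picClass, picClass, QuotientAddGroup.eq_iff_sub_mem, ← map_sub]
  exact AddSubgroup.mem_map_of_mem _ h

end DualSubdivision

/-- Let `Γ` be a tropical plane quartic with subdivided Newton polygon `N`, `Λ` a tropical line,
and `Σ` the paired metric graph of `Γ`.  The line section `Λ · Γ` has a unique pullback to `Σ`, this
pullback is linearly equivalent to the canonical divisor of `Σ`, and `Λ · Γ` is equivalent to the
canonical divisor of `Γ` in the Picard group of `Γ` with respect to `Σ`. -/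
theorem proposition3p3 (Γ : TropicalPlaneCurve) (N : DualSubdivision Γ) (hN : N.HasDegree 4)
    (Λ : TropicalPlaneCurve) (M : DualSubdivision Λ) (hM : M.HasDegree 1)
    (ε : ℝ) (hε : 0 < ε) :
    (∃! D : Γ.graph.Divisor, Γ.IsStableIntersection Λ D) ∧
    ∀ D : Γ.graph.Divisor, Γ.IsStableIntersection Λ D →
      (∃! L : (N.pairedGraph ε hε).Divisor, N.IsPullback ε hε D L) ∧
      (∀ L : (N.pairedGraph ε hε).Divisor, N.IsPullback ε hε D L →
        (N.pairedGraph ε hε).LinearlyEquivalent L (N.pairedGraph ε hε).canonical) ∧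
      N.picClass ε hε D = N.picClass ε hε (N.canonical ε hε) := by
  obtain ⟨q, hT⟩ := exists_isTripod M hM
  have hstable := N.isStableIntersection_pushforward ε hε M.coeff hT.nonempty hT
  have hpull := N.isPullback_sectionDivisor ε hε M.coeff hT.nonempty
  have hequiv := N.linearlyEquivalent_canonical ε hε hN M.coeff hT.nonempty hT.exponents_eq
  refine ⟨⟨_, hstable, fun D hD => hD.unique hstable⟩, fun D hD => ?_⟩
  obtain rfl := hD.unique hstable
  exact ⟨⟨_, hpull, fun L hL => hL.unique hpull⟩, fun L hL => hL.unique hpull ▸ hequiv,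
    N.picClass_eq_of_linearlyEquivalent ε hε hequiv⟩

end
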